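/- For $n\ge 1$ let $\Delta$ be the (non-negative) Laplace--Beltrami operator on $C^\infty(\mathbb S^n)$, where $\mathbb S^n\subset\mathbb R^{n+1}$ is the unit sphere with its standard metric. Let $\zeta_n(s)=\sum_{\lambda}\lambda^{-s}$, where the sum runs over the nonzero eigenvalues of $\Delta$ repeated according to their (finite) multiplicities and converges on some half-plane $\mathrm{Re}\,s>\sigma$. For $n=2,\dots,9$ the function $\zeta_n$ continues to a meromorphic function on $\mathbb C$ that is analytic at $0$; put $\det(\Delta,\mathbb S^n):=e^{-\zeta_n'(0)}$. Let $\zeta$ be the Riemann zeta function and $A:=e^{\frac1{12}-\zeta'(-1)}$ the Glaisher--Kinkelin constant. Then $$\begin{aligned} \det(\Delta,\mathbb S^2)&=e^{1/6}A^4\approx 3.19531,\\ \det(\Delta,\mathbb S^3)&=\pi\exp\Big[\tfrac{\zeta(3)}{2\pi^2}\Big]\approx 3.33885,\\ \det(\Delta,\mathbb S^4)&=\tfrac13\exp\Big[\tfrac{83}{144}-\tfrac{2\zeta'(-3)}{3}\Big]A^{13/3}\approx 1.73694,\\ \det(\Delta,\mathbb S^5)&=\tfrac{\pi}{2}\exp\Big[\tfrac{23\zeta(3)}{24\pi^2}-\tfrac{\zeta(5)}{8\pi^4}\Big]\approx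 1.76292,\\ \det(\Delta,\mathbb S^6)&=\tfrac15\exp\Big[\tfrac{1381}{2160}-2\zeta'(-3)-\tfrac{\zeta'(-5)}{30}\Big]A^{149/30}\approx 1.29002,\\ \det(\Delta,\mathbb S^7)&=\tfrac{\pi}{3}\exp\Big[\tfrac{949\zeta(3)}{720\pi^2}-\tfrac{13\zeta(5)}{24\pi^4}+\tfrac{\zeta(7)}{32\pi^6}\Big]\approx 1.22252,\\ \det(\Delta,\mathbb S^8)&=\tfrac17\exp\Big[\tfrac{4730849}{7257600}-\tfrac{1199\zeta'(-3)}{360}-\tfrac{71\zeta'(-5)}{360}-\tfrac{\zeta'(-7)}{1260}\Big]A^{383/70}\approx 1.05041,\\ \det(\Delta,\mathbb S^9)&=\tfrac{\pi}{4}\exp\Big[\tfrac{16399\zeta(3)}{10080\pi^2}-\tfrac{2087\zeta(5)}{1920\pi^4}+\tfrac{31\zeta(7)}{128\pi^6}-\tfrac{\zeta(9)}{128\pi^8}\Big]\approx 0.94673, \end{aligned}$$ where $\approx$ means that the decimal is the value rounded to five places, i.e. differs from it by less than $5\cdot10^{-6}$. -/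

import Mathlib

open Metric Module
open scoped Manifold ContDiff

noncomputable section

theorem two_le_infty : (2 : ℕ∞ω) ≤ ∞ := WithTop.coe_le_coe.2 (le_top : (2 : ℕ∞) ≤ ⊤)

/-- The unit sphere `𝕊ⁿ` of the Euclidean space `ℝⁿ⁺¹`. -/
abbrev UnitSphere (n : ℕ) : Type := sphere (0 : EuclideanSpace ℝ (Fin (n + 1))) 1

/-- The space `C^∞(𝕊ⁿ)` of real-valued smooth functions on `𝕊ⁿ`. -/
abbrev SmoothSphereFun (n : ℕ) : Type := C^∞⟮𝓡 n, UnitSphere n; ℝ⟯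

/-- The extension of a function `f` on `𝕊ⁿ` to `ℝⁿ⁺¹ ∖ {0}` that is constant along rays from the
origin, `x ↦ f (x / ‖x‖)`. The value `0` given to it at the origin plays no role. -/
def radialExtension {n : ℕ} (f : UnitSphere n → ℝ) (x : EuclideanSpace ℝ (Fin (n + 1))) : ℝ :=
  if hx : x = 0 then 0
  else f ⟨‖x‖⁻¹ • x, by simp [norm_smul, hx]⟩

theorem radialExtension_contDiffAt {n : ℕ} (f : SmoothSphereFun n)
    {x : EuclideanSpace ℝ (Fin (n + 1))} (hx : x ≠ 0) :
    ContDiffAt ℝ ∞ (radialExtension f) x := by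
  have : Fact (finrank ℝ (EuclideanSpace ℝ (Fin (n + 1))) = n + 1) :=
    ⟨finrank_euclideanSpace_fin⟩
  let U : TopologicalSpace.Opens (EuclideanSpace ℝ (Fin (n + 1))) := ⟨{0}ᶜ, isOpen_compl_singleton⟩
  have hU : ∀ y : U, (y : EuclideanSpace ℝ (Fin (n + 1))) ≠ 0 := fun y => y.2
  rw [← contMDiffAt_iff_contDiffAt]
  let p : U → EuclideanSpace ℝ (Fin (n + 1)) := fun y => ‖(y : EuclideanSpace ℝ (Fin (n + 1)))‖⁻¹ • y.1
  have hp : ContMDiff 𝓘(ℝ, EuclideanSpace ℝ (Fin (n + 1)))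
      𝓘(ℝ, EuclideanSpace ℝ (Fin (n + 1))) ∞ p := by
    intro y
    refine (contMDiffAt_subtype_iff (U := U) (f := fun y => ‖y‖⁻¹ • y) (x := y)).2 ?_
    rw [contMDiffAt_iff_contDiffAt]
    exact ((contDiffAt_norm ℝ (hU y)).inv (norm_ne_zero_iff.2 (hU y))).smul contDiffAt_id
  have hps : ∀ y, p y ∈ sphere (0 : EuclideanSpace ℝ (Fin (n + 1))) 1 := fun y => by
    simp [p, norm_smul, hU y]
  have h := f.contMDiff.comp (ContMDiff.codRestrict_sphere (n := n) hp hps)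
  refine (contMDiffAt_subtype_iff (U := U) (f := radialExtension f) (x := ⟨x, hx⟩)).1 ?_
  refine (h ⟨x, hx⟩).congr_of_eventuallyEq (Filter.Eventually.of_forall fun y => ?_)
  simp only [radialExtension, dif_neg (hU y), Function.comp]
  rfl

/-- The (non-negative) Laplace--Beltrami operator `Δ` of the round sphere `𝕊ⁿ ⊆ ℝⁿ⁺¹`, acting on
`C^∞(𝕊ⁿ)`: `(Δ f)(x) = -∑ᵢ ∂ᵢ² F (x)` for `x ∈ 𝕊ⁿ`, where `F(y) = f(y / ‖y‖)`. -/
def sphereLaplacian (n : ℕ) : Module.End ℝ (SmoothSphereFun n) where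
  toFun f :=
    { val := fun x => -Laplacian.laplacian (radialExtension f) (x : EuclideanSpace ℝ (Fin (n + 1)))
      property := by
        have : Fact (finrank ℝ (EuclideanSpace ℝ (Fin (n + 1))) = n + 1) :=
          ⟨finrank_euclideanSpace_fin⟩
        intro x
        have hx : (x : EuclideanSpace ℝ (Fin (n + 1))) ≠ 0 := ne_zero_of_mem_unit_sphere x
        have h : ContDiffAt ℝ ∞ (fun y => -Laplacian.laplacian (radialExtension f) y)
            (x : EuclideanSpace ℝ (Fin (n + 1))) := by
          simp only [InnerProductSpace.laplacian_eq_iteratedFDeriv_stdOrthonormalBasis]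
          refine (ContDiffAt.sum fun i _ => ?_).neg
          have h2 := (radialExtension_contDiffAt f hx).iteratedFDeriv_right (i := 2) (m := ∞) le_rfl
          exact (ContinuousMultilinearMap.apply ℝ (fun _ : Fin 2 => EuclideanSpace ℝ (Fin (n + 1)))
            ℝ _).contDiff.contDiffAt.comp _ h2
        exact h.contMDiffAt.comp x contMDiff_coe_sphere.contMDiffAt }
  map_add' f g := by
    ext x
    have hx : (x : EuclideanSpace ℝ (Fin (n + 1))) ≠ 0 := ne_zero_of_mem_unit_sphere x
    have e : radialExtension (n := n) (f + g) = radialExtension f + radialExtension g := by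
      ext y
      by_cases hy : y = 0 <;> simp [radialExtension, hy]
    have h := ((radialExtension_contDiffAt f hx).of_le (m := 2) two_le_infty).laplacian_add
      ((radialExtension_contDiffAt g hx).of_le (m := 2) two_le_infty)
    change -Laplacian.laplacian (radialExtension (n := n) (f + g)) _ = -_ + -_
    rw [e, h, neg_add]
  map_smul' c f := by
    ext x
    have hx : (x : EuclideanSpace ℝ (Fin (n + 1))) ≠ 0 := ne_zero_of_mem_unit_sphere x
    have e : radialExtension (n := n) (c • f) = c • radialExtension f := by
      ext y
      by_cases hy : y = 0 <;> simp [radialExtension, hy]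
    have h := InnerProductSpace.laplacian_smul c
      ((radialExtension_contDiffAt f hx).of_le (m := 2) two_le_infty)
    change -Laplacian.laplacian (radialExtension (n := n) (c • f)) _ = c • -_
    rw [e, h, smul_neg]

/-- `Z` is the spectral zeta function of the operator `T`: a meromorphic function on `ℂ`, analytic
at `0`, that is given on some half-plane by `∑ λ^(-s)`, the sum being over the nonzero
eigenvalues `λ` of `T`, each repeated according to its (finite) multiplicity. -/
structure IsSpectralZeta {V : Type*} [AddCommGroup V] [Module ℝ V] (T : Module.End ℝ V)
    (Z : ℂ → ℂ) : Prop where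
  meromorphic : Meromorphic Z
  analyticAt_zero : AnalyticAt ℂ Z 0
  finite_multiplicity : ∀ μ : ℝ, μ ≠ 0 → FiniteDimensional ℝ (T.eigenspace μ)
  hasSum : ∃ σ : ℝ, ∀ s : ℂ, σ < s.re →
    HasSum (fun μ : {μ : ℝ // μ ≠ 0} =>
      (finrank ℝ (T.eigenspace (μ : ℝ)) : ℂ) * ((μ : ℝ) : ℂ) ^ (-s)) (Z s)

/-- The germ at `0` of the spectral zeta function is unique, and so is its derivative at `0`. -/
theorem IsSpectralZeta.deriv_eq {V : Type*} [AddCommGroup V] [Module ℝ V] {T : Module.End ℝ V}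
    {Z W : ℂ → ℂ} (hZ : IsSpectralZeta T Z) (hW : IsSpectralZeta T W) :
    deriv Z 0 = deriv W 0 := by
  obtain ⟨a, ha⟩ := hZ.hasSum
  obtain ⟨b, hb⟩ := hW.hasSum
  have hD : MeromorphicOn (Z - W) Set.univ := fun x _ => (hZ.meromorphic x).sub (hW.meromorphic x)
  have h1 : meromorphicOrderAt (Z - W) ((max a b + 1 : ℝ) : ℂ) = ⊤ := by
    rw [meromorphicOrderAt_eq_top_iff]
    have ho : IsOpen {s : ℂ | max a b < s.re} := isOpen_lt continuous_const Complex.continuous_re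
    have hm : ((max a b + 1 : ℝ) : ℂ) ∈ {s : ℂ | max a b < s.re} := by
      simp only [Set.mem_ofPred_eq, Complex.ofReal_re]
      linarith
    filter_upwards [mem_nhdsWithin_of_mem_nhds (ho.mem_nhds hm)] with s hs
    exact sub_eq_zero.2 ((ha s ((le_max_left a b).trans_lt hs)).unique
      (hb s ((le_max_right a b).trans_lt hs)))
  have h2 : meromorphicOrderAt (Z - W) 0 = ⊤ := by
    by_contra h
    exact hD.meromorphicOrderAt_ne_top_of_isPreconnected isPreconnected_univ
      (Set.mem_univ _) (Set.mem_univ _) h h1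
  rw [meromorphicOrderAt_eq_top_iff] at h2
  have h3 := (hZ.analyticAt_zero.sub hW.analyticAt_zero).frequently_zero_iff_eventually_zero.1
    h2.frequently
  refine Filter.EventuallyEq.deriv_eq ?_
  filter_upwards [h3] with s hs
  exact sub_eq_zero.1 hs

open Classical in
/-- The zeta-regularized determinant `exp (-ζ_T'(0))` of the operator `T`, where `ζ_T` is its
spectral zeta function. It is set to `0` if `T` has no spectral zeta function. -/
def zetaDet {V : Type*} [AddCommGroup V] [Module ℝ V] (T : Module.End ℝ V) : ℂ :=
  if h : ∃ Z, IsSpectralZeta T Z then Complex.exp (-deriv h.choose 0) else 0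

theorem zetaDet_eq {V : Type*} [AddCommGroup V] [Module ℝ V] {T : Module.End ℝ V}
    {Z : ℂ → ℂ} (hZ : IsSpectralZeta T Z) : zetaDet T = Complex.exp (-deriv Z 0) := by
  have h : ∃ Z, IsSpectralZeta T Z := ⟨Z, hZ⟩
  rw [zetaDet, dif_pos h, h.choose_spec.deriv_eq hZ]

/-- The determinant `det(Δ, 𝕊ⁿ)` of the Laplacian on the unit sphere `𝕊ⁿ`. -/
def sphereDet (n : ℕ) : ℂ := zetaDet (sphereLaplacian n)

/-- The Glaisher--Kinkelin constant `A = exp (1/12 - ζ'(-1))`, a positive real number. -/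
def glaisherKinkelin : ℂ := Complex.exp (1 / 12 - deriv riemannZeta (-1))

end

/-! Spectrum. The extension of degree 0 of a harmonic homogeneous polynomial of degree `k` shows
that its restriction to the sphere is an eigenfunction with eigenvalue `k (k + n - 1)`. Every
homogeneous polynomial is a combination of products `|x|²ᵐ h` with `h` harmonic
(`MvPolynomial.harmonicSpan_eq`), so by Stone–Weierstrass these eigenfunctions are complete. As the
Laplacian is symmetric for an inner product (`sphereInner_sphereLaplacian`), there are no further
eigenfunctions (`eigenspace_sphereLaplacian`). The multiplicities `d(k)` come from rank–nullity for
the polynomial Laplacian and are polynomial in `k`.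

Derivative at 0. Put `b = n - 1`, so that the zeta function is `∑ d(k) (k (k + b))^(-s)` over `k ≥
1`. It is the case `β = 1` of the family `∑ d(k) k^(-2s) (1 + b/k)^(-βs)`. Expanding the last factor
to `M` terms turns the sum into finitely many values of the Riemann zeta function plus a remainder
series that converges on a half-plane growing with `M`. The case `β = 2` is `∑ d(k) (k + b)^(-2s)`,
which a shift of the index makes an explicit combination of the functions `ζ(2s - j)`. In the
difference "case 1 minus half of case 2" everything whose derivative at 0 is linear in `β` cancels,
in particular the whole remainder series. What survives is the leading term of the expansion and an
effect, quadratic in `β`, of the pole of `ζ` at 1, which produces harmonic numbers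
(`hasDerivAt_continReg_sub`). With `e(x) = d(x - b)` the outcome is `∑ (d_j + e_j) ζ'(-j) + log b`
plus a rational number (`deriv_shiftZeta`).

Values. For even `n` only odd `j` survive, and `ζ'(-1)` is absorbed into the Glaisher–Kinkelin
constant. For odd `n` only even `j` survive: `ζ'(0)` supplies the factor `π`, and the functional
equation turns the other `ζ'(-j)` into `ζ(j + 1) / π^j`.

Decimals. The functional equation reduces the numbers `ζ'(-j)` to `γ`, `log 2π`, `π` and values of
`ζ` and `ζ'` at integers at least 2. These are enclosed by an Euler–Maclaurin formula with a
one-sided error bound (`euler_maclaurin_bounds`), and the exponential is enclosed by its Taylor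
polynomial. -/

noncomputable section

/-! ### Harmonic polynomials: decomposition of homogeneous polynomials and dimensions. -/

namespace MvPolynomial

variable {σ : Type*} [Fintype σ]

/-- The Laplacian `∑ᵢ ∂ᵢ²` on polynomials. -/
def polyLaplacian : MvPolynomial σ ℝ →ₗ[ℝ] MvPolynomial σ ℝ :=
  ∑ i, (pderiv i).toLinearMap ∘ₗ (pderiv i).toLinearMap

theorem polyLaplacian_apply (p : MvPolynomial σ ℝ) :
    polyLaplacian p = ∑ i, pderiv i (pderiv i p) := by
  simp [polyLaplacian]

/-- The polynomial `∑ᵢ xᵢ²`. -/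
def sumSq : MvPolynomial σ ℝ := ∑ i, X i ^ 2

theorem pderiv_sumSq (i : σ) : pderiv i (sumSq : MvPolynomial σ ℝ) = 2 * X i := by
  classical
  simp [sumSq, pderiv_X, Pi.single_apply]

theorem sumSq_isHomogeneous : (sumSq : MvPolynomial σ ℝ).IsHomogeneous 2 :=
  IsHomogeneous.sum _ _ _ fun i _ => isHomogeneous_X_pow i 2

theorem IsHomogeneous.polyLaplacian {p : MvPolynomial σ ℝ} {k : ℕ} (hp : p.IsHomogeneous k) :
    (polyLaplacian p).IsHomogeneous (k - 2) := by
  rw [polyLaplacian_apply]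
  exact IsHomogeneous.sum _ _ _ fun i _ => by simpa [Nat.sub_sub] using hp.pderiv.pderiv

/-- The Leibniz rule gives the cross term `4 ∑ xᵢ ∂ᵢ p`, which Euler's identity turns into `4 k p`.
-/
theorem polyLaplacian_sumSq_mul {p : MvPolynomial σ ℝ} {k : ℕ} (hp : p.IsHomogeneous k) :
    polyLaplacian (sumSq * p) =
      (2 * Fintype.card σ + 4 * k : ℝ) • p + sumSq * polyLaplacian p := by
  have h : ∀ i, pderiv i (pderiv i (sumSq * p)) =
      2 * p + 4 * (X i * pderiv i p) + sumSq * pderiv i (pderiv i p) := by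
    intro i
    have h2 : pderiv i (2 : MvPolynomial σ ℝ) = 0 := by
      exact pderiv_C (a := (2 : ℝ))
    rw [pderiv_mul, map_add, pderiv_mul, pderiv_mul, pderiv_sumSq, pderiv_mul, h2, pderiv_X_self]
    ring
  simp only [polyLaplacian_apply, h, Finset.sum_add_distrib, ← Finset.mul_sum,
    hp.sum_X_mul_pderiv]
  have e : (2 * Fintype.card σ + 4 * k : ℝ) • p = (2 * Fintype.card σ + 4 * k) * p := by
    rw [smul_eq_C_mul]; simp [show (C 2 : MvPolynomial σ ℝ) = 2 from rfl,
        show (C 4 : MvPolynomial σ ℝ) = 4 from rfl]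
  rw [e]
  simp only [Finset.sum_const, Finset.card_univ, nsmul_eq_mul]
  ring

/-- The harmonic homogeneous polynomials of degree `k`. -/
def harmonicSubmodule (σ : Type*) [Fintype σ] (k : ℕ) : Submodule ℝ (MvPolynomial σ ℝ) :=
  homogeneousSubmodule σ ℝ k ⊓ LinearMap.ker polyLaplacian

theorem mem_harmonicSubmodule {k : ℕ} {p : MvPolynomial σ ℝ} :
    p ∈ harmonicSubmodule σ k ↔ p.IsHomogeneous k ∧ polyLaplacian p = 0 := by
  simp [harmonicSubmodule]

theorem harmonicSubmodule_of_lt_two {k : ℕ} (hk : k < 2) :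
    harmonicSubmodule σ k = homogeneousSubmodule σ ℝ k := by
  refine inf_eq_left.2 fun p hp => ?_
  rw [mem_homogeneousSubmodule] at hp
  rw [LinearMap.mem_ker, polyLaplacian_apply]
  refine Finset.sum_eq_zero fun i _ => ?_
  -- The truncated difference `k - 1` is 0 for both `k = 0` and `k = 1`, so every first derivative
  -- is constant.
  have h0 : (pderiv i p).IsHomogeneous 0 := by
    have := hp.pderiv (i := i)
    rwa [show k - 1 = 0 by omega] at this
  rw [← totalDegree_zero_iff_isHomogeneous, totalDegree_eq_zero_iff_eq_C] at h0
  rw [h0, pderiv_C]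

/-- Each extra factor `|x|²` adds a positive number to the constant, so it never vanishes. This is
what allows the Laplacian to be inverted on multiples of `|x|²`. -/
theorem exists_polyLaplacian_sumSq_pow_mul [Nonempty σ] {j : ℕ} {h : MvPolynomial σ ℝ}
    (hh : h ∈ harmonicSubmodule σ j) (m : ℕ) :
    ∃ c : ℝ, 0 < c ∧ polyLaplacian (sumSq ^ (m + 1) * h) = c • (sumSq ^ m * h) := by
  rw [mem_harmonicSubmodule] at hh
  have hd : (0 : ℝ) < Fintype.card σ := by exact_mod_cast Fintype.card_pos
  induction m with
  | zero =>
    refine ⟨2 * Fintype.card σ + 4 * j, by positivity, ?_⟩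
    rw [zero_add, pow_one, polyLaplacian_sumSq_mul hh.1, hh.2]
    simp
  | succ m ih =>
    obtain ⟨c, hc, e⟩ := ih
    have hom := (sumSq_isHomogeneous (σ := σ)).pow (m + 1) |>.mul hh.1
    refine ⟨2 * Fintype.card σ + 4 * (2 * (m + 1) + j : ℕ) + c, by positivity, ?_⟩
    rw [pow_succ' _ (m + 1), mul_assoc, polyLaplacian_sumSq_mul hom, e, add_smul _ c, mul_smul_comm,
      ← mul_assoc, ← pow_succ']

/-- The span of the polynomials `|x|²ᵐ h` of degree `k` with `h` harmonic and homogeneous. -/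
def harmonicSpan (σ : Type*) [Fintype σ] (k : ℕ) : Submodule ℝ (MvPolynomial σ ℝ) :=
  Submodule.span ℝ {q | ∃ m j, ∃ h ∈ harmonicSubmodule σ j, j + 2 * m = k ∧ q = sumSq ^ m * h}

theorem harmonicSpan_le (k : ℕ) : harmonicSpan σ k ≤ homogeneousSubmodule σ ℝ k := by
  refine Submodule.span_le.2 ?_
  rintro _ ⟨m, j, h, hh, rfl, rfl⟩
  rw [mem_harmonicSubmodule] at hh
  simpa [add_comm] using (sumSq_isHomogeneous.pow m).mul hh.1

theorem sumSq_mul_mem_harmonicSpan {k : ℕ} {q : MvPolynomial σ ℝ} (hq : q ∈ harmonicSpan σ k) :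
    sumSq * q ∈ harmonicSpan σ (k + 2) := by
  induction hq using Submodule.span_induction with
  | mem q hq =>
    obtain ⟨m, j, h, hh, rfl, rfl⟩ := hq
    exact Submodule.subset_span ⟨m + 1, j, h, hh, by ring, by ring⟩
  | zero => simp
  | add x y _ _ hx hy => rw [mul_add]; exact add_mem hx hy
  | smul a x _ hx => rw [mul_smul_comm]; exact Submodule.smul_mem _ a hx

theorem exists_polyLaplacian_sumSq_mul_eq [Nonempty σ] {k : ℕ} {q : MvPolynomial σ ℝ}
    (hq : q ∈ harmonicSpan σ k) :
    ∃ g ∈ harmonicSpan σ k, polyLaplacian (sumSq * g) = q := by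
  induction hq using Submodule.span_induction with
  | mem q hq =>
    obtain ⟨m, j, h, hh, rfl, rfl⟩ := hq
    obtain ⟨c, hc, e⟩ := exists_polyLaplacian_sumSq_pow_mul hh m
    refine ⟨c⁻¹ • (sumSq ^ m * h),
      Submodule.smul_mem _ _ (Submodule.subset_span ⟨m, j, h, hh, rfl, rfl⟩), ?_⟩
    rw [mul_smul_comm, map_smul, ← mul_assoc, ← pow_succ', e, smul_smul, inv_mul_cancel₀ hc.ne',
      one_smul]
  | zero => exact ⟨0, zero_mem _, by simp⟩
  | add x y _ _ hx hy =>
    obtain ⟨g, hg, e⟩ := hx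
    obtain ⟨g', hg', e'⟩ := hy
    exact ⟨g + g', add_mem hg hg', by rw [mul_add, map_add, e, e']⟩
  | smul a x _ hx =>
    obtain ⟨g, hg, e⟩ := hx
    exact ⟨a • g, Submodule.smul_mem _ _ hg, by rw [mul_smul_comm, map_smul, e]⟩

/-- Strong induction on the degree: `Δp` lies in the span by induction, so `Δp = Δ(|x|² g)` for some
`g` in the span, and `p - |x|² g` is harmonic. -/
theorem harmonicSpan_eq [Nonempty σ] (k : ℕ) :
    harmonicSpan σ k = homogeneousSubmodule σ ℝ k := by
  refine le_antisymm (harmonicSpan_le k) ?_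
  induction k using Nat.strong_induction_on with
  | _ k ih =>
    rcases lt_or_ge k 2 with hk | hk
    · intro p hp
      rw [← harmonicSubmodule_of_lt_two hk] at hp
      exact Submodule.subset_span ⟨0, k, p, hp, by simp, by simp⟩
    · obtain ⟨k, rfl⟩ := Nat.exists_eq_add_of_le' hk
      intro p hp
      rw [mem_homogeneousSubmodule] at hp
      have hq : polyLaplacian p ∈ harmonicSpan σ k := ih k (by omega) hp.polyLaplacian
      obtain ⟨g, hg, e⟩ := exists_polyLaplacian_sumSq_mul_eq hq
      have hg2 := sumSq_mul_mem_harmonicSpan hg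
      have : p - sumSq * g ∈ harmonicSpan σ (k + 2) := by
        refine Submodule.subset_span ⟨0, k + 2, p - sumSq * g, mem_harmonicSubmodule.2 ⟨?_, ?_⟩,
          by simp, by simp⟩
        · exact hp.sub (harmonicSpan_le _ hg2)
        · rw [map_sub, e, sub_self]
      simpa using add_mem this hg2

instance (k : ℕ) : FiniteDimensional ℝ (homogeneousSubmodule σ ℝ k) :=
  Module.Finite.iff_fg.2 (homogeneousSubmodule_fg σ ℝ k)

instance (k : ℕ) : FiniteDimensional ℝ (harmonicSubmodule σ k) :=
  Submodule.finiteDimensional_of_le inf_le_left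

theorem finrank_homogeneousSubmodule (k : ℕ) :
    finrank ℝ (homogeneousSubmodule σ ℝ k) = (Fintype.card σ).multichoose k := by
  classical
  have hs : {d : σ →₀ ℕ | d.degree = k} = ((Finset.univ : Finset σ).finsuppAntidiag k : Set _) := by
    ext d
    simp [Finset.mem_finsuppAntidiag, Finsupp.degree_eq_sum]
  rw [homogeneousSubmodule_eq_finsupp_supported, hs,
    (AddMonoidAlgebra.supportedEquivFinsupp (R := ℝ) (S := ℝ) _).finrank_eq, finrank_finsupp_self]
  simp [Finset.card_finsuppAntidiag_nat_eq_multichoose]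

theorem finrank_harmonicSubmodule_of_lt_two {k : ℕ} (hk : k < 2) :
    finrank ℝ (harmonicSubmodule σ k) = (Fintype.card σ).multichoose k := by
  rw [← finrank_homogeneousSubmodule, harmonicSubmodule_of_lt_two hk]

/-- Rank–nullity for the Laplacian from degree `k + 2` to degree `k`. It is onto because the target
is spanned by the `|x|²ᵐ h`, on which a preimage is explicit. -/
theorem finrank_harmonicSubmodule_add_two [Nonempty σ] (k : ℕ) :
    finrank ℝ (harmonicSubmodule σ (k + 2)) + (Fintype.card σ).multichoose k =
      (Fintype.card σ).multichoose (k + 2) := by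
  rw [← finrank_homogeneousSubmodule, ← finrank_homogeneousSubmodule]
  let f := (polyLaplacian (σ := σ)).domRestrict (homogeneousSubmodule σ ℝ (k + 2))
  have hr : LinearMap.range f = homogeneousSubmodule σ ℝ k := by
    refine le_antisymm ?_ fun p hp => ?_
    · rintro _ ⟨p, rfl⟩
      exact IsHomogeneous.polyLaplacian p.2
    · rw [← harmonicSpan_eq] at hp
      obtain ⟨g, hg, e⟩ := exists_polyLaplacian_sumSq_mul_eq hp
      exact ⟨⟨sumSq * g, harmonicSpan_le _ (sumSq_mul_mem_harmonicSpan hg)⟩, e⟩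
  have hk : finrank ℝ (LinearMap.ker f) = finrank ℝ (harmonicSubmodule σ (k + 2)) := by
    rw [← Submodule.finrank_map_subtype_eq, harmonicSubmodule,
      ← Submodule.map_comap_subtype]
    rfl
  have := f.finrank_range_add_finrank_ker
  rw [hr, hk] at this
  omega

end MvPolynomial

open MvPolynomial (pderiv polyLaplacian harmonicSubmodule sumSq homogeneousSubmodule harmonicSpan)

theorem MvPolynomial.IsHomogeneous.eval_const_mul {σ : Type*} {p : MvPolynomial σ ℝ} {k : ℕ}
    (hp : p.IsHomogeneous k) (r : ℝ) (x : σ → ℝ) :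
    MvPolynomial.eval (fun i => r * x i) p = r ^ k * MvPolynomial.eval x p := by
  rw [MvPolynomial.eval_eq, MvPolynomial.eval_eq, Finset.mul_sum]
  refine Finset.sum_congr rfl fun d hd => ?_
  have := hp.degree_eq_sum_deg_support hd
  simp only [mul_pow, Finset.prod_mul_distrib, Finset.prod_pow_eq_pow_sum]
  rw [this]
  ring

/-! ### The Euclidean Laplacian of a polynomial times a power of the norm. -/

section Euclidean

variable {ι : Type*} [Fintype ι]

/-- The function on Euclidean space defined by a polynomial. -/
def polyFun (p : MvPolynomial ι ℝ) (x : EuclideanSpace ℝ ι) : ℝ :=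
  MvPolynomial.eval (fun i => x i) p

theorem contDiff_polyFun (p : MvPolynomial ι ℝ) {m : ℕ∞ω} : ContDiff ℝ m (polyFun p) := by
  induction p using MvPolynomial.induction_on with
  | C a =>
    have : polyFun (MvPolynomial.C a : MvPolynomial ι ℝ) = fun _ => a := by
      ext; simp [polyFun]
    rw [this]
    exact contDiff_const
  | add p q hp hq =>
    have : polyFun (p + q) = fun x => polyFun p x + polyFun q x := by ext; simp [polyFun]
    rw [this]
    exact hp.add hq
  | mul_X p j hp =>
    have : polyFun (p * MvPolynomial.X j) =
        fun x => polyFun p x * EuclideanSpace.proj (𝕜 := ℝ) j x := by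
      ext; simp [polyFun]
    rw [this]
    exact hp.mul (ContinuousLinearMap.contDiff _)

theorem fderiv_polyFun (p : MvPolynomial ι ℝ) (x : EuclideanSpace ℝ ι) (i : ι) :
    fderiv ℝ (polyFun p) x (EuclideanSpace.basisFun ι ℝ i) = polyFun (pderiv i p) x := by
  classical
  have hd : ∀ q : MvPolynomial ι ℝ, DifferentiableAt ℝ (polyFun q) x := fun q =>
    (contDiff_polyFun q (m := 1)).differentiable one_ne_zero x
  induction p using MvPolynomial.induction_on with
  | C a =>
    have : polyFun (MvPolynomial.C a : MvPolynomial ι ℝ) = fun _ => a := by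
      ext; simp [polyFun]
    rw [this]
    simp [polyFun]
  | add p q hp hq =>
    have : polyFun (p + q) = fun x => polyFun p x + polyFun q x := by ext; simp [polyFun]
    rw [this, fderiv_fun_add (hd p) (hd q), add_apply, hp, hq]
    simp [polyFun]
  | mul_X p j hp =>
    have : polyFun (p * MvPolynomial.X j) =
        fun x => polyFun p x * EuclideanSpace.proj (𝕜 := ℝ) j x := by
      ext; simp [polyFun]
    rw [this, fderiv_fun_mul (hd p) (ContinuousLinearMap.differentiableAt _)]
    simp only [add_apply, smul_apply, hp,
      ContinuousLinearMap.fderiv]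
    by_cases h : i = j
    · subst h
      simp [polyFun, mul_comm]
    · simp [polyFun, MvPolynomial.pderiv_X, Ne.symm h, mul_comm]

theorem laplacian_eq_sum_fderiv {F : EuclideanSpace ℝ ι → ℝ} {x : EuclideanSpace ℝ ι}
    (hF : ContDiffAt ℝ 2 F x) :
    Laplacian.laplacian F x = ∑ i,
        fderiv ℝ (fun y => fderiv ℝ F y (EuclideanSpace.basisFun ι ℝ i)) x
      (EuclideanSpace.basisFun ι ℝ i) := by
  rw [InnerProductSpace.laplacian_eq_iteratedFDeriv_orthonormalBasis F
    (EuclideanSpace.basisFun ι ℝ)]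
  refine Finset.sum_congr rfl fun i _ => ?_
  have hd : DifferentiableAt ℝ (fderiv ℝ F) x :=
    (hF.fderiv_right (m := 1) (by norm_num)).differentiableAt one_ne_zero
  rw [iteratedFDeriv_two_apply, fderiv_clm_apply hd (differentiableAt_const _)]
  simp

/-- The function `|x|^(2a) p(x)`. -/
def normRpowMul (a : ℝ) (p : MvPolynomial ι ℝ) (x : EuclideanSpace ℝ ι) : ℝ :=
  (‖x‖ ^ 2) ^ a * polyFun p x

theorem contDiffAt_normRpowMul (a : ℝ) (p : MvPolynomial ι ℝ) {x : EuclideanSpace ℝ ι}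
    (hx : x ≠ 0) {m : ℕ∞ω} : ContDiffAt ℝ m (normRpowMul a p) x :=
  ((contDiff_norm_sq ℝ).contDiffAt.rpow_const_of_ne (by positivity)).mul
    (contDiff_polyFun p).contDiffAt

theorem fderiv_normRpowMul (a : ℝ) (p : MvPolynomial ι ℝ) {x : EuclideanSpace ℝ ι} (hx : x ≠ 0)
    (i : ι) :
    fderiv ℝ (normRpowMul a p) x (EuclideanSpace.basisFun ι ℝ i) =
      normRpowMul a (pderiv i p) x +
        2 * a * normRpowMul (a - 1) (MvPolynomial.X i * p) x := by
  have h1 : HasFDerivAt (fun y : EuclideanSpace ℝ ι => ‖y‖ ^ 2) (2 • (innerSL ℝ x)) x :=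
    (hasStrictFDerivAt_norm_sq x).hasFDerivAt
  have h2 := h1.rpow_const (p := a) (Or.inl (by positivity : ‖x‖ ^ 2 ≠ 0))
  have h3 := h2.mul ((contDiff_polyFun p (m := 1)).differentiable one_ne_zero x).hasFDerivAt
  have h4 : HasFDerivAt (normRpowMul a p) _ x := h3
  rw [h4.fderiv]
  simp only [add_apply, smul_apply, fderiv_polyFun,
    innerSL_apply_apply, EuclideanSpace.inner_basisFun_real, normRpowMul]
  simp [polyFun]
  ring

/-- Restricting to unit vectors removes all powers of the norm that differentiation creates. Only
the sums `∑ xᵢ ∂ᵢ p = k p` and `∑ xᵢ² = 1` are then needed. -/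
theorem laplacian_normRpowMul (a : ℝ) {p : MvPolynomial ι ℝ} {k : ℕ} (hp : p.IsHomogeneous k)
    {x : EuclideanSpace ℝ ι} (hx : ‖x‖ = 1) :
    Laplacian.laplacian (normRpowMul a p) x = polyFun (polyLaplacian p) x +
      (4 * a * k + 2 * a * Fintype.card ι + 4 * a * (a - 1)) * polyFun p x := by
  classical
  have hx0 : x ≠ 0 := by rintro rfl; simp at hx
  rw [laplacian_eq_sum_fderiv (contDiffAt_normRpowMul a p hx0)]
  have key : ∀ i, fderiv ℝ (fun y => fderiv ℝ (normRpowMul a p) y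
      (EuclideanSpace.basisFun ι ℝ i)) x (EuclideanSpace.basisFun ι ℝ i) =
      polyFun (pderiv i (pderiv i p)) x + (4 * a * polyFun (MvPolynomial.X i * pderiv i p) x) +
        2 * a * polyFun p x + 4 * a * (a - 1) * (x i ^ 2 * polyFun p x) := by
    intro i
    have e : (fun y => fderiv ℝ (normRpowMul a p) y (EuclideanSpace.basisFun ι ℝ i)) =ᶠ[nhds x]
        fun y => normRpowMul a (pderiv i p) y +
          2 * a * normRpowMul (a - 1) (MvPolynomial.X i * p) y := by
      filter_upwards [isOpen_ne.mem_nhds hx0] with y hy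
      exact fderiv_normRpowMul a p hy i
    have d : ∀ b q, DifferentiableAt ℝ (normRpowMul (ι := ι) b q) x := fun b q =>
      (contDiffAt_normRpowMul b q hx0 (m := 1)).differentiableAt one_ne_zero
    rw [e.fderiv_eq, fderiv_fun_add (d _ _) ((d _ _).const_mul _), fderiv_const_mul (d _ _)]
    simp only [add_apply, smul_apply,
      fderiv_normRpowMul _ _ hx0]
    simp [normRpowMul, hx, polyFun]
    ring
  simp only [key, Finset.sum_add_distrib, ← Finset.mul_sum, ← Finset.sum_mul]
  have e1 : ∑ i, polyFun (MvPolynomial.X i * pderiv i p) x = k * polyFun p x := by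
    have := congrArg (MvPolynomial.eval (fun i => x i)) hp.sum_X_mul_pderiv
    simpa [polyFun] using this
  have e2 : ∑ i, x i ^ 2 = 1 := by
    rw [← EuclideanSpace.real_norm_sq_eq, hx, one_pow]
  have e3 : ∑ i, polyFun (pderiv i (pderiv i p)) x = polyFun (polyLaplacian p) x := by
    simp [polyFun, MvPolynomial.polyLaplacian_apply]
  rw [e1, e2, e3]
  simp
  ring

end Euclidean

/-! ### Spherical harmonics as eigenfunctions. -/

variable {n : ℕ}

/-- The restriction of a polynomial to the unit sphere. -/
def polySphere (n : ℕ) : MvPolynomial (Fin (n + 1)) ℝ →ₗ[ℝ] SmoothSphereFun n where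
  toFun p :=
    { val := fun x => polyFun p (x : EuclideanSpace ℝ (Fin (n + 1)))
      property := by
        have : Fact (finrank ℝ (EuclideanSpace ℝ (Fin (n + 1))) = n + 1) :=
          ⟨finrank_euclideanSpace_fin⟩
        exact (contDiff_polyFun p).contMDiff.comp contMDiff_coe_sphere }
  map_add' p q := by
    ext x
    change polyFun (p + q) _ = polyFun p _ + polyFun q _
    simp [polyFun]
  map_smul' c p := by
    ext x
    change polyFun (c • p) _ = c * polyFun p _
    simp [polyFun]

theorem polySphere_apply (p : MvPolynomial (Fin (n + 1)) ℝ) (x : UnitSphere n) :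
    polySphere n p x = polyFun p x := rfl

theorem radialExtension_polySphere {p : MvPolynomial (Fin (n + 1)) ℝ} {k : ℕ}
    (hp : p.IsHomogeneous k) {y : EuclideanSpace ℝ (Fin (n + 1))} (hy : y ≠ 0) :
    radialExtension (polySphere n p) y = normRpowMul (-(k / 2)) p y := by
  rw [radialExtension, dif_neg hy, polySphere_apply, normRpowMul]
  have := hp.eval_const_mul ‖y‖⁻¹ (fun i => y i)
  have h2 : polyFun p (‖y‖⁻¹ • y) = ‖y‖⁻¹ ^ k * polyFun p y := this
  rw [h2]
  congr 1
  have hy' : 0 < ‖y‖ := norm_pos_iff.2 hy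
  rw [← Real.rpow_natCast_mul hy'.le, inv_pow, ← Real.rpow_natCast ‖y‖ k, ← Real.rpow_neg hy'.le]
  congr 1
  push_cast
  ring

/-- The eigenvalue `k (k + n - 1)` of the Laplacian of `𝕊ⁿ`. -/
def sphereEigenvalue (n k : ℕ) : ℝ := k * (k + n - 1)

/-- The extension constant along rays is `|x|^(-k) p`. With `a = -k/2` in `n + 1` variables, the
factor in `laplacian_normRpowMul` equals `-k (k + n - 1)`. -/
theorem sphereLaplacian_polySphere {p : MvPolynomial (Fin (n + 1)) ℝ} {k : ℕ}
    (hp : p ∈ harmonicSubmodule (Fin (n + 1)) k) :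
    sphereLaplacian n (polySphere n p) = sphereEigenvalue n k • polySphere n p := by
  rw [MvPolynomial.mem_harmonicSubmodule] at hp
  ext x
  have hx : ‖(x : EuclideanSpace ℝ (Fin (n + 1)))‖ = 1 := norm_eq_of_mem_sphere x
  have hx0 : (x : EuclideanSpace ℝ (Fin (n + 1))) ≠ 0 := ne_zero_of_mem_unit_sphere x
  change -Laplacian.laplacian (radialExtension (polySphere n p)) _ = _ * polyFun p x
  have e : radialExtension (polySphere n p) =ᶠ[nhds (x : EuclideanSpace ℝ (Fin (n + 1)))]
      normRpowMul (-(k / 2)) p := by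
    filter_upwards [isOpen_ne.mem_nhds hx0] with y hy
    exact radialExtension_polySphere hp.1 hy
  rw [InnerProductSpace.laplacian_congr_nhds e |>.eq_of_nhds, laplacian_normRpowMul _ hp.1 hx, hp.2]
  simp [polyFun, sphereEigenvalue]
  ring

theorem polySphere_eq_zero {p : MvPolynomial (Fin (n + 1)) ℝ} {k : ℕ} (hp : p.IsHomogeneous k)
    (h : polySphere n p = 0) : p = 0 := by
  have h1 : ∀ y : EuclideanSpace ℝ (Fin (n + 1)), y ≠ 0 → polyFun p y = 0 := by
    intro y hy
    have e := radialExtension_polySphere hp hy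
    rw [h, radialExtension, dif_neg hy, normRpowMul] at e
    have hy' : 0 < ‖y‖ := norm_pos_iff.2 hy
    have h0 : (‖y‖ ^ 2) ^ (-(k / 2 : ℝ)) ≠ 0 := by positivity
    exact (mul_eq_zero.1 e.symm).resolve_left h0
  refine hp.eq_zero_of_forall_eval_eq_zero fun x => ?_
  by_cases hx : x = 0
  -- At the origin, homogeneity along the ray through `(1, …, 1)` gives the value `0 ^ k * p(1, …,
  -- 1)`. This is 0 even for `k = 0`, because the second factor vanishes.
  · have := hp.eval_const_mul 0 (fun _ => 1)
    have h2 : MvPolynomial.eval (fun _ => 1) p = 0 :=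
      h1 (WithLp.toLp 2 fun _ => 1) (by
        intro h
        have := congrFun (congrArg WithLp.ofLp h) 0
        simp at this)
    rw [h2] at this
    simpa [hx, Pi.zero_def] using this
  · exact h1 (WithLp.toLp 2 x) (by simpa using hx)

/-! ### Homogeneity of the radial extension and of its Laplacian. -/

section RadialExtension

variable {n : ℕ}

theorem radialExtension_smul (f : UnitSphere n → ℝ) {c : ℝ} (hc : 0 < c)
    (y : EuclideanSpace ℝ (Fin (n + 1))) : radialExtension f (c • y) = radialExtension f y := by
  by_cases hy : y = 0
  · simp [hy]
  · have hcy : c • y ≠ 0 := smul_ne_zero hc.ne' hy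
    rw [radialExtension, dif_neg hcy, radialExtension, dif_neg hy]
    congr 2
    rw [norm_smul, Real.norm_of_nonneg hc.le, smul_smul, mul_inv, mul_right_comm,
      inv_mul_cancel₀ hc.ne', one_mul]

theorem radialExtension_coe (f : UnitSphere n → ℝ) (x : UnitSphere n) :
    radialExtension f (x : EuclideanSpace ℝ (Fin (n + 1))) = f x := by
  rw [radialExtension, dif_neg (ne_zero_of_mem_unit_sphere x)]
  congr 1
  ext1
  simp [norm_eq_of_mem_sphere x]

theorem exists_radialExtension_eq {y : EuclideanSpace ℝ (Fin (n + 1))} (hy : y ≠ 0) :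
    ∃ x : UnitSphere n, (x : EuclideanSpace ℝ (Fin (n + 1))) = ‖y‖⁻¹ • y ∧
      ∀ f : UnitSphere n → ℝ, radialExtension f y = f x :=
  ⟨⟨‖y‖⁻¹ • y, by simp [norm_smul, hy]⟩, rfl, fun f => by rw [radialExtension, dif_neg hy]⟩

/-- Euler's identity in degree 0: the gradient of the extension is tangential. This is what removes
the cut-off function from Green's formula below. -/
theorem fderiv_radialExtension_self (f : SmoothSphereFun n)
    {y : EuclideanSpace ℝ (Fin (n + 1))} (hy : y ≠ 0) : fderiv ℝ (radialExtension f) y y = 0 := by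
  have h1 : HasFDerivAt (radialExtension f) (fderiv ℝ (radialExtension f) y) ((1 : ℝ) • y) := by
    rw [one_smul]
    exact ((radialExtension_contDiffAt f hy).differentiableAt (by simp)).hasFDerivAt
  have h2 : HasDerivAt (fun t : ℝ => t • y) y 1 := by
    simpa using (hasDerivAt_id (1 : ℝ)).smul_const y
  have h3 := h1.comp_hasDerivAt (1 : ℝ) h2
  have h4 : (radialExtension f ∘ fun t : ℝ => t • y) =ᶠ[nhds 1] fun _ => radialExtension f y := by
    filter_upwards [lt_mem_nhds one_pos] with t ht
    exact radialExtension_smul f ht y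
  exact h3.unique ((hasDerivAt_const _ _).congr_of_eventuallyEq h4)

/-- The Laplacian of a function of degree 0 is homogeneous of degree `-2`, so its value at `y` is
determined by the value at `y / ‖y‖`, where the spherical Laplacian is defined. -/
theorem laplacian_radialExtension (f : SmoothSphereFun n)
    {y : EuclideanSpace ℝ (Fin (n + 1))} (hy : y ≠ 0) :
    Laplacian.laplacian (radialExtension f) y =
      -((‖y‖ ^ 2)⁻¹ * radialExtension (sphereLaplacian n f) y) := by
  obtain ⟨x, hx, hfx⟩ := exists_radialExtension_eq hy
  have hy' : 0 < ‖y‖⁻¹ := inv_pos.2 (norm_pos_iff.2 hy)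
  set c := ‖y‖⁻¹ with hc
  have hx0 : c • y ≠ 0 := smul_ne_zero hy'.ne' hy
  have e : radialExtension f = fun z => radialExtension f (c • z) :=
    funext fun z => (radialExtension_smul f hy' z).symm
  have e1 : ∀ v, (fun z => fderiv ℝ (radialExtension f) z v) =
      fun z => c * fderiv ℝ (radialExtension f) (c • z) v := by
    intro v
    funext z
    conv_lhs => rw [e, fderiv_comp_smul]
    rfl
  have e2 : ∀ v, fderiv ℝ (fun z => fderiv ℝ (radialExtension f) z v) y v =
      c ^ 2 * fderiv ℝ (fun z => fderiv ℝ (radialExtension f) z v) (c • y) v := by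
    intro v
    have hd : DifferentiableAt ℝ (fun z => fderiv ℝ (radialExtension f) (c • z) v) y := by
      have h1 : DifferentiableAt ℝ (fderiv ℝ (radialExtension f)) (c • y) :=
        ((radialExtension_contDiffAt f hx0).fderiv_right (m := 1)
          two_le_infty).differentiableAt one_ne_zero
      exact (h1.comp y (differentiableAt_id.const_smul c)).clm_apply (differentiableAt_const v)
    conv_lhs => rw [e1, fderiv_const_mul hd,
      fderiv_comp_smul (f := fun z => fderiv ℝ (radialExtension f) z v)]
    simp only [smul_apply, smul_eq_mul]
    ring
  rw [hfx, laplacian_eq_sum_fderiv ((radialExtension_contDiffAt f hy).of_le two_le_infty)]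
  simp only [e2, ← Finset.mul_sum]
  rw [← laplacian_eq_sum_fderiv ((radialExtension_contDiffAt f hx0).of_le two_le_infty), ← hx]
  change _ = -(_ * -_)
  rw [hc, inv_pow]
  ring

end RadialExtension

/-! ### An inner product for which the Laplacian is symmetric, and density of polynomials. -/

section InnerProduct

variable {n : ℕ}

/-- A smooth function on the line, supported in `[1/2, 3/2]`. -/
def lineBump : ContDiffBump (1 : ℝ) := ⟨1 / 4, 1 / 2, by norm_num, by norm_num⟩

/-- A smooth radial function supported in an annulus. -/
def annulusBump (x : EuclideanSpace ℝ (Fin (n + 1))) : ℝ := lineBump (‖x‖ ^ 2)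

theorem annulusBump_contDiff : ContDiff ℝ ∞ (annulusBump (n := n)) :=
  lineBump.contDiff.comp (contDiff_norm_sq ℝ)

theorem annulusBump_nonneg (x : EuclideanSpace ℝ (Fin (n + 1))) : 0 ≤ annulusBump x :=
  lineBump.nonneg

theorem annulusBump_eq_zero {x : EuclideanSpace ℝ (Fin (n + 1))}
    (hx : ‖x‖ ^ 2 ≤ 1 / 2 ∨ 3 / 2 ≤ ‖x‖ ^ 2) : annulusBump x = 0 := by
  refine lineBump.zero_of_le_dist ?_
  rw [Real.dist_eq, le_abs, show lineBump.rOut = 1 / 2 from rfl]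
  rcases hx with h | h
  · right; linarith
  · left; linarith

theorem annulusBump_eventually_eq_zero :
    ∀ᶠ x in nhds (0 : EuclideanSpace ℝ (Fin (n + 1))), annulusBump x = 0 := by
  have : ContinuousAt (fun x : EuclideanSpace ℝ (Fin (n + 1)) => ‖x‖ ^ 2) 0 := by fun_prop
  have h : Filter.Tendsto (fun x : EuclideanSpace ℝ (Fin (n + 1)) => ‖x‖ ^ 2) (nhds 0)
      (nhds 0) := by
    simpa [ContinuousAt] using this
  filter_upwards [h.eventually_lt_const (show (0 : ℝ) < 1 / 2 by norm_num)] with x hx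
  exact annulusBump_eq_zero (Or.inl hx.le)

theorem annulusBump_eq_one {x : EuclideanSpace ℝ (Fin (n + 1))} (hx : ‖x‖ = 1) :
    annulusBump x = 1 :=
  lineBump.one_of_mem_closedBall (by simp [hx, lineBump])

theorem hasCompactSupport_annulusBump_mul (H : EuclideanSpace ℝ (Fin (n + 1)) → ℝ) :
    HasCompactSupport fun x => annulusBump x * H x := by
  refine HasCompactSupport.intro (isCompact_closedBall 0 2) fun x hx => ?_
  rw [mem_closedBall_zero_iff, not_le] at hx
  rw [annulusBump_eq_zero (Or.inr (by nlinarith)), zero_mul]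

/-- The cut-off vanishes near the origin, the only point where radial extensions may be singular. -/
theorem contDiff_annulusBump_mul {m : ℕ∞ω} (hm : m ≤ ∞) {H : EuclideanSpace ℝ (Fin (n + 1)) → ℝ}
    (hH : ∀ x ≠ 0, ContDiffAt ℝ m H x) : ContDiff ℝ m fun x => annulusBump x * H x := by
  refine contDiff_iff_contDiffAt.2 fun x => ?_
  by_cases hx : x = 0
  · subst hx
    refine (contDiffAt_const (c := 0)).congr_of_eventuallyEq ?_
    filter_upwards [annulusBump_eventually_eq_zero] with y hy
    rw [hy, zero_mul]
  · exact (annulusBump_contDiff.of_le hm).contDiffAt.mul (hH x hx)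

theorem integrable_annulusBump_mul {H : EuclideanSpace ℝ (Fin (n + 1)) → ℝ}
    (hH : ∀ x ≠ 0, ContDiffAt ℝ 0 H x) :
    MeasureTheory.Integrable fun x => annulusBump x * H x :=
  (contDiff_annulusBump_mul (by simp) hH).continuous.integrable_of_hasCompactSupport
    (hasCompactSupport_annulusBump_mul H)

theorem integral_fderiv_annulusBump_mul {H : EuclideanSpace ℝ (Fin (n + 1)) → ℝ}
    (hH : ∀ x ≠ 0, ContDiffAt ℝ 1 H x) (v : EuclideanSpace ℝ (Fin (n + 1))) :
    MeasureTheory.Integrable (fun x => fderiv ℝ (fun x => annulusBump x * H x) x v) ∧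
    ∫ x, fderiv ℝ (fun x => annulusBump x * H x) x v = 0 := by
  have hc := contDiff_annulusBump_mul (by exact_mod_cast le_top) hH
  have hs := hasCompactSupport_annulusBump_mul H
  have hi : MeasureTheory.Integrable (fun x => fderiv ℝ (fun x => annulusBump x * H x) x v) :=
    ((hc.continuous_fderiv one_ne_zero).clm_apply continuous_const).integrable_of_hasCompactSupport
      (hs.fderiv_apply ℝ v)
  refine ⟨hi, ?_⟩
  have := integral_mul_fderiv_eq_neg_fderiv_mul_of_integrable (𝕜 := ℝ) (μ := MeasureTheory.volume)
    (f := fun _ : EuclideanSpace ℝ (Fin (n + 1)) => (1 : ℝ))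
    (g := fun x => annulusBump x * H x) (v := v) (by simp) (by simpa using hi)
    (by simpa using hc.continuous.integrable_of_hasCompactSupport hs)
    (fun x _ => differentiableAt_const _) (fun x _ => hc.differentiable one_ne_zero x)
  simpa using this

theorem contDiffAt_weight (f g : SmoothSphereFun n) {x : EuclideanSpace ℝ (Fin (n + 1))}
    (hx : x ≠ 0) : ContDiffAt ℝ ∞
      (fun x => (‖x‖ ^ 2)⁻¹ * (radialExtension f x * radialExtension g x)) x :=
  ((contDiff_norm_sq ℝ).contDiffAt.inv (by positivity)).mul
    ((radialExtension_contDiffAt f hx).mul (radialExtension_contDiffAt g hx))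

theorem integrable_weight (f g : SmoothSphereFun n) : MeasureTheory.Integrable fun x =>
    annulusBump x * ((‖x‖ ^ 2)⁻¹ * (radialExtension f x * radialExtension g x)) :=
  integrable_annulusBump_mul fun _ hx => (contDiffAt_weight f g hx).of_le (by simp)

theorem radialExtension_add (f g : SmoothSphereFun n) (x : EuclideanSpace ℝ (Fin (n + 1))) :
    radialExtension ⇑(f + g) x = radialExtension f x + radialExtension g x := by
  by_cases hx : x = 0 <;> simp [radialExtension, hx]

theorem radialExtension_const_smul (c : ℝ) (f : SmoothSphereFun n)
    (x : EuclideanSpace ℝ (Fin (n + 1))) :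
    radialExtension ⇑(c • f) x = c * radialExtension f x := by
  by_cases hx : x = 0 <;> simp [radialExtension, hx]

/-- The inner product of functions on the sphere, as an integral over an annulus of their
extensions. -/
def sphereInner (n : ℕ) : LinearMap.BilinForm ℝ (SmoothSphereFun n) :=
  LinearMap.mk₂ ℝ (fun f g => ∫ x, annulusBump x *
      ((‖x‖ ^ 2)⁻¹ * (radialExtension f x * radialExtension g x)))
    (fun f f' g => by
      rw [← MeasureTheory.integral_add (integrable_weight f g) (integrable_weight f' g)]
      congr 1; ext x; rw [radialExtension_add]; ring)
    (fun c f g => by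
      rw [smul_eq_mul, ← MeasureTheory.integral_const_mul]
      congr 1; ext x; rw [radialExtension_const_smul]; ring)
    (fun f g g' => by
      rw [← MeasureTheory.integral_add (integrable_weight f g) (integrable_weight f g')]
      congr 1; ext x; rw [radialExtension_add]; ring)
    (fun c f g => by
      rw [smul_eq_mul, ← MeasureTheory.integral_const_mul]
      congr 1; ext x; rw [radialExtension_const_smul]; ring)

theorem sphereInner_apply (f g : SmoothSphereFun n) : sphereInner n f g = ∫ x, annulusBump x *
    ((‖x‖ ^ 2)⁻¹ * (radialExtension f x * radialExtension g x)) := rfl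

theorem sphereInner_comm (f g : SmoothSphereFun n) : sphereInner n f g = sphereInner n g f := by
  rw [sphereInner_apply, sphereInner_apply]
  congr 1; ext x; ring

theorem eq_zero_of_sphereInner_self {f : SmoothSphereFun n} (h : sphereInner n f f ≤ 0) :
    f = 0 := by
  by_contra hf
  obtain ⟨x, hx⟩ : ∃ x, f x ≠ 0 := by
    by_contra! h
    exact hf (by ext x; exact h x)
  have hx1 : ‖(x : EuclideanSpace ℝ (Fin (n + 1)))‖ = 1 := norm_eq_of_mem_sphere x
  refine h.not_gt ?_
  rw [sphereInner_apply]
  have hc := contDiff_annulusBump_mul le_rfl fun _ hx => contDiffAt_weight f f hx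
  refine hc.continuous.integral_pos_of_hasCompactSupport_nonneg_nonzero
    (hasCompactSupport_annulusBump_mul _) (fun y => ?_) (x := x) ?_
  · exact mul_nonneg (annulusBump_nonneg y)
      (mul_nonneg (by positivity) (mul_self_nonneg _))
  · simp [annulusBump_eq_one hx1, hx1, radialExtension_coe, hx]

/-- Green's formula carried out in the ambient space. The field `χ (G ∇F - F ∇G)`, with `χ` the
cut-off, has compact support, so its divergence integrates to 0. The gradient of `χ` is radial while
those of `F` and `G` are tangential, so the divergence is `χ (G ΔF - F ΔG)`. The weight `|x|⁻²` in
the inner product matches the degree of `ΔF`. -/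
theorem sphereInner_sphereLaplacian (f g : SmoothSphereFun n) :
    sphereInner n (sphereLaplacian n f) g = sphereInner n f (sphereLaplacian n g) := by
  let e := EuclideanSpace.basisFun (Fin (n + 1)) ℝ
  let F := radialExtension f
  let G := radialExtension g
  have hF : ∀ x ≠ 0, ContDiffAt ℝ ∞ F x := fun x hx => radialExtension_contDiffAt f hx
  have hG : ∀ x ≠ 0, ContDiffAt ℝ ∞ G x := fun x hx => radialExtension_contDiffAt g hx
  have hd : ∀ {K : EuclideanSpace ℝ (Fin (n + 1)) → ℝ} {x} (v), ContDiffAt ℝ ∞ K x →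
      ContDiffAt ℝ ∞ (fun y => fderiv ℝ K y v) x := fun v h =>
    (h.fderiv_right (m := ∞) le_rfl).clm_apply contDiffAt_const
  let A : Fin (n + 1) → EuclideanSpace ℝ (Fin (n + 1)) → ℝ := fun i x =>
    G x * fderiv ℝ F x (e i) - F x * fderiv ℝ G x (e i)
  have hA : ∀ i, ∀ x ≠ 0, ContDiffAt ℝ ∞ (A i) x := fun i x hx =>
    ((hG x hx).mul (hd _ (hF x hx))).sub ((hF x hx).mul (hd _ (hG x hx)))
  have hA1 : ∀ i, ∀ x ≠ 0, ContDiffAt ℝ 1 (A i) x := fun i x hx =>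
    (hA i x hx).of_le (by exact_mod_cast le_top)
  have key : ∀ x, ∑ i, fderiv ℝ (fun x => annulusBump x * A i x) x (e i) =
      annulusBump x * ((‖x‖ ^ 2)⁻¹ * (F x * radialExtension (sphereLaplacian n g) x)) -
      annulusBump x * ((‖x‖ ^ 2)⁻¹ * (radialExtension (sphereLaplacian n f) x * G x)) := by
    intro x
    by_cases hx : x = 0
    · have h0 : ∀ i, (fun x => annulusBump x * A i x) =ᶠ[nhds x] fun _ => 0 := by
        intro i
        subst hx
        filter_upwards [annulusBump_eventually_eq_zero] with y hy
        rw [hy, zero_mul]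
      simp only [(h0 _).fderiv_eq]
      simp [hx]
    · have dF := (hF x hx).differentiableAt (by simp)
      have dG := (hG x hx).differentiableAt (by simp)
      have ddF : ∀ v, DifferentiableAt ℝ (fun y => fderiv ℝ F y v) x := fun v =>
        (hd v (hF x hx)).differentiableAt (by simp)
      have ddG : ∀ v, DifferentiableAt ℝ (fun y => fderiv ℝ G y v) x := fun v =>
        (hd v (hG x hx)).differentiableAt (by simp)
      have hb : HasFDerivAt (annulusBump (n := n))
          (deriv lineBump (‖x‖ ^ 2) • (2 • innerSL ℝ x)) x :=
        (((lineBump.contDiff (n := 1)).differentiable one_ne_zero _).hasDerivAt).comp_hasFDerivAt x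
          (hasStrictFDerivAt_norm_sq x).hasFDerivAt
      have hsum : ∀ K : EuclideanSpace ℝ (Fin (n + 1)) →L[ℝ] ℝ,
          ∑ i, x i * K (e i) = K x := by
        intro K
        conv_rhs => rw [← (EuclideanSpace.basisFun (Fin (n + 1)) ℝ).sum_repr x, map_sum]
        simp [e]
      have hi : ∀ i, fderiv ℝ (fun x => annulusBump x * A i x) x (e i) =
          annulusBump x * (G x * fderiv ℝ (fun y => fderiv ℝ F y (e i)) x (e i)) -
          annulusBump x * (F x * fderiv ℝ (fun y => fderiv ℝ G y (e i)) x (e i)) +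
          2 * deriv lineBump (‖x‖ ^ 2) * G x * (x i * fderiv ℝ F x (e i)) -
          2 * deriv lineBump (‖x‖ ^ 2) * F x * (x i * fderiv ℝ G x (e i)) := by
        intro i
        rw [fderiv_fun_mul hb.differentiableAt ((hA1 i x hx).differentiableAt one_ne_zero),
          hb.fderiv]
        simp only [A]
        rw [fderiv_fun_sub (dG.fun_mul (ddF _)) (dF.fun_mul (ddG _)), fderiv_fun_mul dG (ddF _),
          fderiv_fun_mul dF (ddG _)]
        have hxi : inner ℝ x (e i) = x i := EuclideanSpace.inner_basisFun_real _ x i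
        simp only [add_apply, smul_apply, sub_apply, innerSL_apply_apply, hxi, smul_eq_mul]
        simp
        ring
      -- After summation, the terms containing the derivative of the bump contain the derivatives of
      -- `F` and `G` in the direction `x`, which vanish.
      simp only [hi, Finset.sum_add_distrib, Finset.sum_sub_distrib, ← Finset.mul_sum, hsum]
      rw [fderiv_radialExtension_self f hx, fderiv_radialExtension_self g hx,
        ← laplacian_eq_sum_fderiv ((hF x hx).of_le two_le_infty),
        ← laplacian_eq_sum_fderiv ((hG x hx).of_le two_le_infty),
        laplacian_radialExtension f hx, laplacian_radialExtension g hx]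
      ring
  have h0 : ∫ x, ∑ i, fderiv ℝ (fun x => annulusBump x * A i x) x (e i) = 0 := by
    rw [MeasureTheory.integral_finsetSum _ fun i _ =>
      (integral_fderiv_annulusBump_mul (hA1 i) (e i)).1]
    exact Finset.sum_eq_zero fun i _ => (integral_fderiv_annulusBump_mul (hA1 i) (e i)).2
  simp only [key] at h0
  rw [MeasureTheory.integral_sub (integrable_weight f _) (integrable_weight _ g)] at h0
  rw [sphereInner_apply, sphereInner_apply]
  linarith

/-- Stone–Weierstrass: the coordinate functions separate the points of the sphere. -/
theorem exists_polySphere_near (f : SmoothSphereFun n) {ε : ℝ} (hε : 0 < ε) :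
    ∃ p, ∀ x, |f x - polySphere n p x| < ε := by
  let c : Fin (n + 1) → C(UnitSphere n, ℝ) := fun i =>
    ⟨fun x => (x : EuclideanSpace ℝ (Fin (n + 1))) i, by fun_prop⟩
  let Φ : MvPolynomial (Fin (n + 1)) ℝ →ₐ[ℝ] C(UnitSphere n, ℝ) := MvPolynomial.aeval c
  have hΦ : ∀ p x, Φ p x = polySphere n p x := by
    intro p x
    rw [polySphere_apply, polyFun]
    induction p using MvPolynomial.induction_on with
    | C a => simp [Φ]
    | add p q hp hq => simp [hp, hq]
    | mul_X p i hp => simp [hp]; simp [Φ, c]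
  have hsep : Φ.range.SeparatesPoints := by
    intro x y hxy
    by_contra! h
    refine hxy (Subtype.ext (PiLp.ext fun i => ?_))
    simpa [Φ, c] using h _ ⟨Φ (MvPolynomial.X i), ⟨MvPolynomial.X i, rfl⟩, rfl⟩
  obtain ⟨⟨_, p, rfl⟩, hg⟩ :=
    ContinuousMap.exists_mem_subalgebra_near_continuous_of_separatesPoints Φ.range hsep f
      f.contMDiff.continuous ε hε
  refine ⟨p, fun x => ?_⟩
  rw [abs_sub_comm, ← hΦ]
  exact hg x

/-- With a polynomial `p` uniformly close to `f`, `⟨f, f⟩ = ⟨f, f - p⟩` is as small as desired. -/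
theorem eq_zero_of_sphereInner_polySphere {f : SmoothSphereFun n}
    (h : ∀ p, sphereInner n f (polySphere n p) = 0) : f = 0 := by
  refine eq_zero_of_sphereInner_self (le_of_forall_pos_le_add fun ε hε => ?_)
  let one : SmoothSphereFun n := polySphere n 1
  have hone : ∀ z, one z = 1 := fun z => by simp [one, polySphere_apply, polyFun]
  set K := sphereInner n one one + sphereInner n f f with hK
  have hi := (integrable_weight one one).add (integrable_weight f f)
  have hnn : ∀ g, 0 ≤ sphereInner n g g := fun g => MeasureTheory.integral_nonneg fun x =>
    mul_nonneg (annulusBump_nonneg x) (mul_nonneg (by positivity) (mul_self_nonneg _))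
  have hK0 : 0 ≤ K := add_nonneg (hnn _) (hnn _)
  obtain ⟨p, hp⟩ := exists_polySphere_near f (ε := ε / (K + 1)) (by positivity)
  have e : sphereInner n f f = sphereInner n f (f - polySphere n p) := by
    rw [map_sub, h, sub_zero]
  rw [e, zero_add, sphereInner_apply]
  calc _ ≤ ∫ x, (ε / (K + 1)) * _ := by
        refine MeasureTheory.integral_mono (integrable_weight _ _) (hi.const_mul _) fun x => ?_
        by_cases hx : x = 0
        · simp [hx, annulusBump_eq_zero]
        · obtain ⟨z, -, hz⟩ := exists_radialExtension_eq hx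
          simp only [Pi.add_apply, hz, hone]
          -- The bound `|f| ≤ 1 + f²` replaces the Cauchy–Schwarz inequality and explains the choice
          -- `K = ⟨1, 1⟩ + ⟨f, f⟩`.
          have h1 : f z * (f - polySphere n p) z ≤ (1 + f z * f z) * (ε / (K + 1)) := by
            refine (le_abs_self _).trans ?_
            rw [abs_mul]
            refine mul_le_mul ?_ (hp z).le (abs_nonneg _) (by nlinarith [sq_nonneg (f z)])
            nlinarith [sq_nonneg (|f z| - 1), abs_mul_abs_self (f z), sq_nonneg (f z)]
          have h2 : 0 ≤ annulusBump x * (‖x‖ ^ 2)⁻¹ :=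
            mul_nonneg (annulusBump_nonneg x) (by positivity)
          nlinarith [mul_le_mul_of_nonneg_left h1 h2]
    _ = ε / (K + 1) * K := by
        rw [MeasureTheory.integral_const_mul]
        simp only [Pi.add_apply]
        rw [MeasureTheory.integral_add (integrable_weight one one) (integrable_weight f f),
          hK, sphereInner_apply, sphereInner_apply]
    _ ≤ ε := by
        rw [div_mul_eq_mul_div, div_le_iff₀ (by positivity)]
        nlinarith

end InnerProduct

/-! ### The eigenspaces of the spherical Laplacian. -/

section Spectrum

variable {n : ℕ}

theorem polySphere_sumSq_pow_mul (m : ℕ) (h : MvPolynomial (Fin (n + 1)) ℝ) :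
    polySphere n (sumSq ^ m * h) = polySphere n h := by
  ext x
  have hx : ‖(x : EuclideanSpace ℝ (Fin (n + 1)))‖ = 1 := norm_eq_of_mem_sphere x
  have e : ∑ i, (x : EuclideanSpace ℝ (Fin (n + 1))) i ^ 2 = 1 := by
    rw [← EuclideanSpace.real_norm_sq_eq, hx, one_pow]
  simp [polySphere_apply, polyFun, sumSq, e]

/-- Since `|x|² = 1` on the sphere, the decomposition of each homogeneous component shows that every
polynomial restricts to a sum of spherical harmonics. -/
theorem eq_zero_of_sphereInner_harmonic {f : SmoothSphereFun n}
    (h : ∀ k, ∀ p ∈ harmonicSubmodule (Fin (n + 1)) k, sphereInner n f (polySphere n p) = 0) :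
    f = 0 := by
  refine eq_zero_of_sphereInner_polySphere fun p => ?_
  rw [← MvPolynomial.sum_homogeneousComponent p, map_sum, map_sum]
  refine Finset.sum_eq_zero fun k _ => ?_
  have hk : MvPolynomial.homogeneousComponent k p ∈ harmonicSpan (Fin (n + 1)) k := by
    rw [MvPolynomial.harmonicSpan_eq]
    exact MvPolynomial.homogeneousComponent_isHomogeneous k p
  generalize MvPolynomial.homogeneousComponent k p = q at hk
  induction hk using Submodule.span_induction with
  | mem q hq =>
    obtain ⟨m, j, q, hq, -, rfl⟩ := hq
    rw [polySphere_sumSq_pow_mul, h j q hq]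
  | zero => simp
  | add x y _ _ hx hy => rw [map_add, map_add, hx, hy, add_zero]
  | smul a x _ hx => rw [map_smul, map_smul, hx, smul_zero]

theorem sphereInner_eq_zero_of_ne {f : SmoothSphereFun n} {μ : ℝ}
    (hf : f ∈ (sphereLaplacian n).eigenspace μ) {k : ℕ} (hμ : μ ≠ sphereEigenvalue n k)
    {p : MvPolynomial (Fin (n + 1)) ℝ} (hp : p ∈ harmonicSubmodule (Fin (n + 1)) k) :
    sphereInner n f (polySphere n p) = 0 := by
  have h := sphereInner_sphereLaplacian f (polySphere n p)
  rw [Module.End.mem_eigenspace_iff.1 hf, sphereLaplacian_polySphere hp, map_smul, map_smul,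
    LinearMap.smul_apply, smul_eq_mul, smul_eq_mul] at h
  have h2 : (μ - sphereEigenvalue n k) * sphereInner n f (polySphere n p) = 0 := by linarith
  exact (mul_eq_zero.1 h2).resolve_left (sub_ne_zero.2 hμ)

theorem eigenspace_sphereLaplacian_eq_bot {μ : ℝ} (hμ : ∀ k, μ ≠ sphereEigenvalue n k) :
    (sphereLaplacian n).eigenspace μ = ⊥ :=
  (Submodule.eq_bot_iff _).2 fun _ hf =>
    eq_zero_of_sphereInner_harmonic fun k _ hp => sphereInner_eq_zero_of_ne hf (hμ k) hp

theorem sphereEigenvalue_strictMono (hn : 1 ≤ n) : StrictMono (sphereEigenvalue n) := by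
  refine strictMono_nat_of_lt_succ fun k => ?_
  have h1 : (1 : ℝ) ≤ n := by exact_mod_cast hn
  simp only [sphereEigenvalue, Nat.cast_add, Nat.cast_one]
  have : (0 : ℝ) ≤ k := Nat.cast_nonneg k
  nlinarith

/-- An eigenfunction minus its orthogonal projection to the harmonics of degree `k` is still an
eigenfunction. It is orthogonal to the harmonics of degree `k` by construction and to the others
because their eigenvalues differ, hence it is 0 by completeness. -/
theorem eigenspace_sphereLaplacian (hn : 1 ≤ n) (k : ℕ) :
    (sphereLaplacian n).eigenspace (sphereEigenvalue n k) =
      (harmonicSubmodule (Fin (n + 1)) k).map (polySphere n) := by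
  set W := (harmonicSubmodule (Fin (n + 1)) k).map (polySphere n)
  have hW : W ≤ (sphereLaplacian n).eigenspace (sphereEigenvalue n k) := by
    rintro _ ⟨p, hp, rfl⟩
    exact Module.End.mem_eigenspace_iff.2 (sphereLaplacian_polySphere hp)
  refine le_antisymm (fun f hf => ?_) hW
  have hnd : ((sphereInner n).restrict W).Nondegenerate := by
    have : ∀ f : W, (∀ g : W, (sphereInner n).restrict W f g = 0) → f = 0 := fun f hf =>
      Subtype.ext (eq_zero_of_sphereInner_self (hf f).le)
    exact ⟨this, fun f hf => this f fun g => by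
      rw [← hf g]; exact sphereInner_comm _ _⟩
  -- The orthogonal projection of `f` to `W`: the vector of `W` representing `⟨f, ·⟩` on `W`. It
  -- exists because `W` is finite-dimensional and the form is definite on it.
  let w : W := ((sphereInner n).restrict W).toDual hnd |>.symm ((sphereInner n f).domRestrict W)
  have hw : ∀ g ∈ W, sphereInner n w g = sphereInner n f g := fun g hg =>
    LinearMap.BilinForm.apply_toDual_symm_apply (hB := hnd) ((sphereInner n f).domRestrict W)
      ⟨g, hg⟩
  have hu0 : f - w = 0 := by
    refine eq_zero_of_sphereInner_harmonic fun j p hp => ?_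
    by_cases hj : j = k
    · subst hj
      rw [map_sub, LinearMap.sub_apply, hw _ ⟨p, hp, rfl⟩, sub_self]
    · exact sphereInner_eq_zero_of_ne (sub_mem hf (hW w.2))
        (fun h => hj ((sphereEigenvalue_strictMono hn).injective h).symm) hp
  rw [sub_eq_zero.1 hu0]
  exact w.2

theorem finrank_eigenspace_sphereLaplacian (hn : 1 ≤ n) (k : ℕ) :
    finrank ℝ ((sphereLaplacian n).eigenspace (sphereEigenvalue n k)) =
      finrank ℝ (harmonicSubmodule (Fin (n + 1)) k) := by
  rw [eigenspace_sphereLaplacian hn, ← LinearMap.range_domRestrict]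
  refine LinearMap.finrank_range_of_inj ((injective_iff_map_eq_zero _).2 fun p hp => ?_)
  exact Subtype.ext (polySphere_eq_zero p.2.1 hp)

theorem finiteDimensional_eigenspace_sphereLaplacian (hn : 1 ≤ n) (μ : ℝ) :
    FiniteDimensional ℝ ((sphereLaplacian n).eigenspace μ) := by
  by_cases h : ∃ k, μ = sphereEigenvalue n k
  · obtain ⟨k, rfl⟩ := h
    rw [eigenspace_sphereLaplacian hn]
    infer_instance
  · rw [eigenspace_sphereLaplacian_eq_bot (not_exists.1 h)]
    infer_instance

/-- A sum over all nonzero reals becomes a sum over degrees: reals that are not eigenvalues have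
trivial eigenspace and contribute 0, and degree 0 drops out because its eigenvalue is 0. -/
theorem isSpectralZeta_sphereLaplacian (hn : 1 ≤ n) {Z : ℂ → ℂ} (hm : Meromorphic Z)
    (ha : AnalyticAt ℂ Z 0) {σ : ℝ} (hs : ∀ s : ℂ, σ < s.re → HasSum (fun k : ℕ =>
      (finrank ℝ (harmonicSubmodule (Fin (n + 1)) (k + 1)) : ℂ) *
        ((sphereEigenvalue n (k + 1) : ℝ) : ℂ) ^ (-s)) (Z s)) :
    IsSpectralZeta (sphereLaplacian n) Z where
  meromorphic := hm
  analyticAt_zero := ha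
  finite_multiplicity μ _ := finiteDimensional_eigenspace_sphereLaplacian hn μ
  hasSum := by
    refine ⟨σ, fun s h => ?_⟩
    have hpos : ∀ k, sphereEigenvalue n (k + 1) ≠ 0 := fun k => by
      have := sphereEigenvalue_strictMono hn k.succ_pos
      rw [sphereEigenvalue, Nat.cast_zero, zero_mul] at this
      exact this.ne'
    let ι : ℕ → {μ : ℝ // μ ≠ 0} := fun k => ⟨sphereEigenvalue n (k + 1), hpos k⟩
    have hι : Function.Injective ι := fun j k e => by
      have := (sphereEigenvalue_strictMono hn).injective (Subtype.ext_iff.1 e)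
      omega
    refine (hι.hasSum_iff fun μ hμ => ?_).1 ?_
    · have : ∀ k, (μ : ℝ) ≠ sphereEigenvalue n k := by
        intro k e
        rcases k with _ | k
        · exact μ.2 (by rw [e, sphereEigenvalue, Nat.cast_zero, zero_mul])
        · exact hμ ⟨k, Subtype.ext e.symm⟩
      rw [eigenspace_sphereLaplacian_eq_bot this]
      simp
    · simpa only [Function.comp_def, ι, finrank_eigenspace_sphereLaplacian hn] using hs s h

end Spectrum

/-! ### The binomial expansion of `(1 + x)^(-s)` with a remainder uniform in `s`. -/

section Binomial

open Finset

/-- The coefficient of `xᵐ` in the binomial series of `(1 + x)^(-s)`. -/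
def negBinom : ℕ → ℂ → ℂ
  | 0, _ => 1
  | m + 1, s => negBinom m s * (-s - m) / (m + 1)

theorem negBinom_zero (s : ℂ) : negBinom 0 s = 1 := rfl

theorem negBinom_succ (m : ℕ) (s : ℂ) :
    negBinom (m + 1) s = negBinom m s * (-s - m) / (m + 1) := rfl

theorem differentiable_negBinom (m : ℕ) : Differentiable ℂ (negBinom m) := by
  induction m with
  | zero => exact differentiable_const 1
  | succ m ih =>
    exact (ih.mul (differentiable_id.neg.sub_const (m : ℂ))).div_const _

/-- This makes the zero at `s = 0` of all coefficients but the first explicit; later that zero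
cancels the pole of `ζ` at 1. It also governs the derivative of the remainder in `x`. -/
theorem succ_mul_negBinom_succ (m : ℕ) (s : ℂ) :
    (m + 1) * negBinom (m + 1) s = -s * negBinom m (s + 1) := by
  induction m with
  | zero => simp [negBinom]
  | succ m ih =>
    have h1 : (m + 1 : ℂ) ≠ 0 := by exact_mod_cast m.succ_ne_zero
    have h2 : (m + 1 + 1 : ℂ) ≠ 0 := by exact_mod_cast (m + 1).succ_ne_zero
    rw [negBinom_succ (m + 1), negBinom_succ m (s + 1)]
    push_cast
    field_simp
    linear_combination (-s - (m + 1)) * ih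

theorem negBinom_succ_zero (m : ℕ) : negBinom (m + 1) 0 = 0 := by
  have h := succ_mul_negBinom_succ m 0
  have h1 : (m + 1 : ℂ) ≠ 0 := by exact_mod_cast m.succ_ne_zero
  simpa [h1] using h

theorem negBinom_one (m : ℕ) : negBinom m 1 = (-1) ^ m := by
  induction m with
  | zero => rfl
  | succ m ih =>
    have h1 : (m + 1 : ℂ) ≠ 0 := by exact_mod_cast m.succ_ne_zero
    rw [negBinom_succ, ih, pow_succ]
    field_simp
    ring

/-- The coefficient is the product of the factors `-(s + i) / (i + 1)` for `i < m`. At `s = 1` each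
factor is `-1`, and the logarithmic derivative is `∑ 1 / (i + 1)`. -/
theorem hasDerivAt_negBinom_one (m : ℕ) :
    HasDerivAt (negBinom m) ((-1) ^ m * (harmonic m : ℚ)) 1 := by
  induction m with
  | zero =>
    rw [harmonic_zero, Rat.cast_zero, mul_zero]
    exact hasDerivAt_const (1 : ℂ) (1 : ℂ)
  | succ m ih =>
    have h1 : (m + 1 : ℂ) ≠ 0 := by exact_mod_cast m.succ_ne_zero
    have h2 := (ih.mul ((hasDerivAt_id (1 : ℂ)).neg.sub_const (m : ℂ))).div_const (m + 1 : ℂ)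
    refine HasDerivAt.congr_deriv (f := negBinom (m + 1)) h2 ?_
    rw [negBinom_one, harmonic_succ, pow_succ]
    simp only [Pi.neg_apply, id_eq]
    push_cast
    field_simp
    ring

/-- The remainder of the binomial series of `(1 + x)^(-s)` after `M` terms. -/
def binomRem (M : ℕ) (s : ℂ) (x : ℝ) : ℂ :=
  ((1 + x : ℝ) : ℂ) ^ (-s) - ∑ m ∈ range M, negBinom m s * (x : ℂ) ^ m

theorem binomRem_succ (M : ℕ) (s : ℂ) (x : ℝ) :
    binomRem (M + 1) s x = binomRem M s x - negBinom M s * (x : ℂ) ^ M := by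
  rw [binomRem, binomRem, sum_range_succ]
  ring

theorem binomRem_succ_zero_right (M : ℕ) (s : ℂ) : binomRem (M + 1) s 0 = 0 := by
  rw [binomRem, sum_range_succ']
  simp [negBinom]

theorem binomRem_succ_zero_left (M : ℕ) (x : ℝ) : binomRem (M + 1) 0 x = 0 := by
  rw [binomRem, sum_range_succ']
  simp [negBinom_succ_zero, negBinom_zero]

theorem differentiable_binomRem (M : ℕ) {x : ℝ} (hx : 0 ≤ x) :
    Differentiable ℂ fun s => binomRem M s x := by
  have h : ((1 + x : ℝ) : ℂ) ≠ 0 := by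
    rw [Complex.ofReal_ne_zero]; positivity
  refine Differentiable.sub ?_ (Differentiable.fun_sum fun m _ => ?_)
  · exact differentiable_id.neg.const_cpow (Or.inl h)
  · exact (differentiable_negBinom m).mul_const _

theorem hasDerivAt_binomRem (M : ℕ) (s : ℂ) {x : ℝ} (hx : 0 ≤ x) :
    HasDerivAt (fun x : ℝ => binomRem (M + 1) s x) (-s * binomRem M (s + 1) x) x := by
  have h1 : HasDerivAt (fun x : ℝ => ((1 + x : ℝ) : ℂ)) 1 x := by
    simpa using ((hasDerivAt_id x).const_add 1).ofReal_comp
  have h2 : HasDerivAt (fun x : ℝ => ((1 + x : ℝ) : ℂ) ^ (-s))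
      (-s * ((1 + x : ℝ) : ℂ) ^ (-s - 1) * 1) x :=
    HasDerivAt.comp_of_eq x (hasDerivAt_id _ |>.cpow_const (by
      rw [id, Complex.ofReal_mem_slitPlane]; positivity)) h1 rfl |>.congr_deriv (by simp)
  have h3 : ∀ m : ℕ, HasDerivAt (fun x : ℝ => negBinom m s * (x : ℂ) ^ m)
      (negBinom m s * (m * (x : ℂ) ^ (m - 1))) x := by
    intro m
    have := ((hasDerivAt_id x).ofReal_comp.pow m).const_mul (negBinom m s)
    simpa using this
  have h4 := h2.sub (HasDerivAt.fun_sum (u := range (M + 1)) fun m _ => h3 m)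
  refine HasDerivAt.congr_deriv (f := fun x : ℝ => binomRem (M + 1) s x) h4 ?_
  rw [sum_range_succ', binomRem, mul_sub, mul_sum, neg_add', mul_one]
  simp only [Nat.cast_zero, zero_mul, mul_zero, add_zero, Nat.add_sub_cancel]
  congr 1
  refine sum_congr rfl fun m _ => ?_
  rw [← mul_assoc (-s), ← succ_mul_negBinom_succ]
  push_cast
  ring

/-- Induction on `M` by the mean value inequality, since the `x`-derivative of the remainder is `-s`
times the previous remainder at `s + 1`; hence the radius `R + 1` in the induction hypothesis. The
bound holds on any bounded interval: convergence of the binomial series is not needed, which matters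
because `x = b/k` may exceed 1. -/
theorem exists_norm_binomRem_le (M : ℕ) (R B : ℝ) (hB : 0 ≤ B) :
    ∃ C, 0 ≤ C ∧ ∀ s : ℂ, ‖s‖ ≤ R → ∀ x : ℝ, 0 ≤ x → x ≤ B → ‖binomRem M s x‖ ≤ C * x ^ M := by
  induction M generalizing R with
  | zero =>
    refine ⟨(1 + B) ^ R, by positivity, fun s hs x hx hxB => ?_⟩
    rw [binomRem, range_zero, sum_empty, sub_zero, pow_zero, mul_one,
      Complex.norm_cpow_eq_rpow_re_of_pos (by positivity)]
    calc (1 + x) ^ (-s).re ≤ (1 + x) ^ R := by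
          refine Real.rpow_le_rpow_of_exponent_le (by linarith) ?_
          exact (Complex.re_le_norm _).trans (by rwa [norm_neg])
      _ ≤ (1 + B) ^ R := by
          by_cases hR : 0 ≤ R
          · exact Real.rpow_le_rpow (by positivity) (by linarith) hR
          · exact absurd ((norm_nonneg s).trans hs) hR
  | succ M ih =>
    obtain ⟨C, hC, h⟩ := ih (R + 1)
    refine ⟨|R| * C, by positivity, fun s hs x hx hxB => ?_⟩
    have h1 := norm_image_sub_le_of_norm_deriv_le_segment' (a := 0) (b := x)
      (f := fun x : ℝ => binomRem (M + 1) s x) (C := |R| * (C * x ^ M))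
      (fun t ht => (hasDerivAt_binomRem M s ht.1).hasDerivWithinAt) (fun t ht => ?_) x
      ⟨hx, le_rfl⟩
    · simp only [binomRem_succ_zero_right, sub_zero] at h1
      exact h1.trans (by rw [pow_succ]; apply le_of_eq; ring)
    · have hs1 : ‖s + 1‖ ≤ R + 1 := (norm_add_le _ _).trans (by simpa using hs)
      rw [norm_mul, norm_neg]
      refine mul_le_mul (hs.trans (le_abs_self R)) ?_ (norm_nonneg _) (abs_nonneg R)
      refine (h _ hs1 t ht.1 (ht.2.le.trans hxB)).trans ?_
      gcongr
      exacts [ht.1, ht.2.le]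

end Binomial

/-! ### Continuation of `∑ d(k) k^(-2s) (1 + b/k)^(-βs)`. -/

section Continuation

open Finset

/-- The polynomial with coefficients `d j`, `j < N`. -/
def coeffSum (N : ℕ) (d : ℕ → ℂ) (x : ℂ) : ℂ := ∑ j ∈ range N, d j * x ^ j

/-- The Dirichlet series `∑ d(k) k^(-w)` of the polynomial with coefficients `d j`. -/
def zetaSum (N : ℕ) (d : ℕ → ℂ) (w : ℂ) : ℂ := ∑ j ∈ range N, d j * riemannZeta (w - j)

theorem exists_norm_coeffSum_le (N : ℕ) (d : ℕ → ℂ) :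
    ∃ C, 0 ≤ C ∧ ∀ k : ℕ, ‖coeffSum N d (k + 1)‖ ≤ C * (k + 1 : ℝ) ^ (N - 1 : ℝ) := by
  refine ⟨∑ j ∈ range N, ‖d j‖, sum_nonneg fun _ _ => norm_nonneg _, fun k => ?_⟩
  rw [coeffSum, sum_mul]
  refine (norm_sum_le _ _).trans (sum_le_sum fun j hj => ?_)
  rw [norm_mul, norm_pow]
  refine mul_le_mul_of_nonneg_left ?_ (norm_nonneg _)
  have h1 : ‖(k + 1 : ℂ)‖ = (k + 1 : ℝ) := by
    rw [← Nat.cast_succ, Complex.norm_natCast, Nat.cast_succ]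
  rw [h1, ← Real.rpow_natCast]
  refine Real.rpow_le_rpow_of_exponent_le (by linarith [(Nat.cast_nonneg k : (0 : ℝ) ≤ k)]) ?_
  have : j + 1 ≤ N := mem_range.1 hj
  have : (j + 1 : ℝ) ≤ N := by exact_mod_cast this
  linarith

theorem natCast_add_one_ne_zero (k : ℕ) : (k + 1 : ℂ) ≠ 0 := by exact_mod_cast k.succ_ne_zero

theorem norm_natCast_add_one_cpow (k : ℕ) (w : ℂ) :
    ‖(k + 1 : ℂ) ^ w‖ = (k + 1 : ℝ) ^ w.re := by
  rw [← Nat.cast_succ, Complex.norm_natCast_cpow_of_pos k.succ_pos, Nat.cast_succ]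

theorem hasSum_zetaSum (N : ℕ) (d : ℕ → ℂ) {w : ℂ} (hw : N < w.re) :
    HasSum (fun k : ℕ => coeffSum N d (k + 1) * (k + 1 : ℂ) ^ (-w)) (zetaSum N d w) := by
  have h : ∀ j ∈ range N, HasSum (fun k : ℕ => d j * (k + 1 : ℂ) ^ (j - w))
      (d j * riemannZeta (w - j)) := by
    intro j hj
    have : j + 1 ≤ N := mem_range.1 hj
    have : (j + 1 : ℝ) ≤ N := by exact_mod_cast this
    have hre : 1 < (w - j).re := by simp; linarith
    have hs : Summable fun k : ℕ => (k + 1 : ℂ) ^ (j - w) := by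
      have := (summable_nat_add_iff 1).2 (Complex.summable_one_div_nat_cpow.2 hre)
      refine this.congr fun k => ?_
      rw [one_div, ← Complex.cpow_neg, neg_sub]
      push_cast
      rfl
    refine (hs.hasSum_iff.2 ?_).mul_left _
    rw [zeta_eq_tsum_one_div_nat_add_one_cpow hre]
    refine tsum_congr fun k => ?_
    rw [one_div, ← Complex.cpow_neg, neg_sub]
  have e : (fun k : ℕ => coeffSum N d (k + 1) * (k + 1 : ℂ) ^ (-w)) =
      fun k : ℕ => ∑ j ∈ range N, d j * (k + 1 : ℂ) ^ (j - w) := by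
    funext k
    rw [coeffSum, sum_mul]
    refine sum_congr rfl fun j _ => ?_
    rw [sub_eq_add_neg, Complex.cpow_add _ _ (by exact_mod_cast k.succ_ne_zero),
      Complex.cpow_natCast, mul_assoc]
  rw [e]
  exact hasSum_sum h

/-- The terms of the remainder series in the continuation of
`∑ d(k) k^(-2s) (1 + b/k)^(-βs)`. -/
def tailTerm (N : ℕ) (d : ℕ → ℂ) (b : ℕ) (β : ℂ) (M k : ℕ) (s : ℂ) : ℂ :=
  coeffSum N d (k + 1) * (k + 1 : ℂ) ^ (-(2 * s)) * binomRem M (β * s) (b / (k + 1))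

/-- The continuation of `∑ d(k) k^(-2s) (1 + b/k)^(-βs)` to the half-plane `2 Re s > N - M`. -/
def contin (N : ℕ) (d : ℕ → ℂ) (b : ℕ) (β : ℂ) (M : ℕ) (s : ℂ) : ℂ :=
  ∑ m ∈ range M, negBinom m (β * s) * b ^ m * zetaSum N d (2 * s + m) +
    ∑' k, tailTerm N d b β M k s

variable (N : ℕ) (d : ℕ → ℂ) (b : ℕ) (β : ℂ)

theorem differentiable_tailTerm (M k : ℕ) : Differentiable ℂ (tailTerm N d b β M k) := by
  refine Differentiable.mul (Differentiable.const_mul ?_ _) ?_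
  · exact (differentiable_id.const_mul 2).neg.const_cpow (Or.inl (natCast_add_one_ne_zero k))
  · exact (differentiable_binomRem M (by positivity)).comp (differentiable_id.const_mul β)

/-- The polynomial contributes `k^(N-1)`, the power `k^(-2σ)` and the remainder `k^(-M)`. The
resulting exponent is below `-1` exactly when `N - M < 2 σ`. -/
theorem exists_norm_tailTerm_le (M : ℕ) (R σ : ℝ) (hσ : N - M < 2 * σ) :
    ∃ u : ℕ → ℝ, Summable u ∧
      ∀ k, ∀ s : ℂ, ‖s‖ < R → σ < s.re → ‖tailTerm N d b β M k s‖ ≤ u k := by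
  obtain ⟨C, hC, h⟩ := exists_norm_coeffSum_le N d
  obtain ⟨C', hC', h'⟩ := exists_norm_binomRem_le M (‖β‖ * R) b (Nat.cast_nonneg b)
  refine ⟨fun k => C * C' * b ^ M * (k + 1 : ℝ) ^ (N - 1 - 2 * σ - M : ℝ), ?_, fun k s hs hs' => ?_⟩
  · refine Summable.mul_left _ ?_
    have := (summable_nat_add_iff 1).2
      (Real.summable_nat_rpow (p := N - 1 - 2 * σ - M).2 (by linarith))
    exact_mod_cast this
  · have hk : (0 : ℝ) < k + 1 := by positivity
    have h1 : ‖(k + 1 : ℂ) ^ (-(2 * s))‖ ≤ (k + 1 : ℝ) ^ (-2 * σ) := by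
      rw [norm_natCast_add_one_cpow]
      refine Real.rpow_le_rpow_of_exponent_le (by linarith [(Nat.cast_nonneg k : (0 : ℝ) ≤ k)]) ?_
      simp
      linarith
    have h2 : ‖binomRem M (β * s) (b / (k + 1))‖ ≤ C' * (b / (k + 1)) ^ M := by
      refine h' _ ?_ _ (by positivity) ?_
      · rw [norm_mul]; gcongr
      · exact div_le_self (Nat.cast_nonneg b) (by linarith [(Nat.cast_nonneg k : (0 : ℝ) ≤ k)])
    rw [tailTerm, norm_mul, norm_mul]
    calc _ ≤ C * (k + 1 : ℝ) ^ (N - 1 : ℝ) * (k + 1 : ℝ) ^ (-2 * σ) * (C' * (b / (k + 1)) ^ M) := by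
          gcongr
          exact h k
      _ = _ := by
          simp only [sub_eq_add_neg _ (2 * σ), sub_eq_add_neg _ (M : ℝ)]
          rw [div_pow, ← Real.rpow_natCast (k + 1 : ℝ) M, Real.rpow_add hk _ (-(M : ℝ)),
            Real.rpow_add hk _ (-(2 * σ)), neg_mul, Real.rpow_neg hk.le M]
          field_simp

theorem differentiableAt_tsum_tailTerm {M : ℕ} {s : ℂ} (hs : N - M < 2 * s.re) :
    DifferentiableAt ℂ (fun s => ∑' k, tailTerm N d b β M k s) s := by
  obtain ⟨σ, h1, h2⟩ := exists_between (show ((N - M) / 2 : ℝ) < s.re by linarith)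
  obtain ⟨u, hu, h⟩ := exists_norm_tailTerm_le N d b β M (‖s‖ + 1) σ (by linarith)
  have hU : IsOpen {z : ℂ | ‖z‖ < ‖s‖ + 1 ∧ σ < z.re} :=
    (isOpen_lt continuous_norm continuous_const).inter
      (isOpen_lt continuous_const Complex.continuous_re)
  refine (Complex.differentiableOn_tsum_of_summable_norm hu
    (fun k => (differentiable_tailTerm N d b β M k).differentiableOn) hU
    (fun k z hz => h k z hz.1 hz.2)).differentiableAt (hU.mem_nhds ⟨by simp, h2⟩)

theorem summable_tailTerm {M : ℕ} {s : ℂ} (hs : N - M < 2 * s.re) :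
    Summable fun k => tailTerm N d b β M k s := by
  obtain ⟨σ, h1, h2⟩ := exists_between (show ((N - M) / 2 : ℝ) < s.re by linarith)
  obtain ⟨u, hu, h⟩ := exists_norm_tailTerm_le N d b β M (‖s‖ + 1) σ (by linarith)
  exact Summable.of_norm_bounded hu fun k => h k s (by simp) h2

/-- Moving one term of the expansion out of the convergent tail produces the next term of the finite
sum, so the continuations for different `M` agree where both are valid. -/
theorem contin_succ {M : ℕ} {s : ℂ} (hs : N - M < 2 * s.re) :
    contin N d b β (M + 1) s = contin N d b β M s := by
  have h := (hasSum_zetaSum N d (w := 2 * s + M) (by simp; linarith)).mul_left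
    (negBinom M (β * s) * b ^ M)
  have h2 : ∀ k : ℕ, negBinom M (β * s) * b ^ M *
      (coeffSum N d (k + 1) * (k + 1 : ℂ) ^ (-(2 * s + M))) =
      tailTerm N d b β M k s - tailTerm N d b β (M + 1) k s := by
    intro k
    have hk := natCast_add_one_ne_zero k
    rw [tailTerm, tailTerm, binomRem_succ, neg_add, Complex.cpow_add _ _ hk, Complex.cpow_neg _ M,
      Complex.cpow_natCast]
    push_cast
    rw [div_pow, div_eq_mul_inv]
    ring
  simp only [h2] at h
  have h3 := h.unique ((summable_tailTerm N d b β hs).hasSum.sub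
    (summable_tailTerm N d b β (M := M + 1) (by push_cast; linarith)).hasSum)
  rw [contin, contin, sum_range_succ, h3]
  ring

theorem contin_eq_of_le {M M' : ℕ} (hM : M ≤ M') {s : ℂ} (hs : N - M < 2 * s.re) :
    contin N d b β M' s = contin N d b β M s := by
  induction M', hM using Nat.le_induction with
  | base => rfl
  | succ m hm ih =>
    have : (M : ℝ) ≤ m := by exact_mod_cast hm
    rw [contin_succ N d b β (by linarith), ih]

/-- In this half-plane `M` can be lowered to 0, where the remainder is the full factor `(1 +
b/k)^(-βs)`. -/
theorem hasSum_contin (M : ℕ) {s : ℂ} (hs : N < 2 * s.re) :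
    HasSum (fun k : ℕ => coeffSum N d (k + 1) * (k + 1 : ℂ) ^ (-(2 * s)) *
      ((1 + b / (k + 1) : ℝ) : ℂ) ^ (-(β * s))) (contin N d b β M s) := by
  rw [contin_eq_of_le N d b β (Nat.zero_le M) (by simpa using hs), contin, range_zero, sum_empty,
    zero_add]
  have := (summable_tailTerm N d b β (M := 0) (s := s) (by simpa using hs)).hasSum
  simpa only [tailTerm, binomRem, range_zero, sum_empty, sub_zero] using this

end Continuation

/-! ### Removal of the singularity at 0, and the derivative there. -/

section Regular

open Finset Filter Topology

variable (N : ℕ) (d : ℕ → ℂ) (b : ℕ) (β : ℂ)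

theorem meromorphic_riemannZeta_affine (a : ℂ) :
    Meromorphic fun s => riemannZeta (2 * s + a) := by
  intro x
  have h : MeromorphicAt (fun s => (2 * s + a - 1)⁻¹ * riemannZeta₁ (2 * s + a)) x := by
    have h1 : AnalyticAt ℂ (fun s : ℂ => 2 * s + a - 1) x := by fun_prop
    have h2 : AnalyticAt ℂ (fun s => riemannZeta₁ (2 * s + a)) x :=
      (differentiable_riemannZeta₁.comp
        ((differentiable_id.const_mul 2).add_const a)).analyticAt x
    exact h1.meromorphicAt.inv.mul h2.meromorphicAt
  refine h.congr ?_
  have hne : ∀ᶠ s in 𝓝[≠] x, s ≠ (1 - a) / 2 := by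
    rcases eq_or_ne x ((1 - a) / 2) with h | h
    · rw [← h]
      exact self_mem_nhdsWithin
    · exact eventually_nhdsWithin_of_eventually_nhds (eventually_ne_nhds h)
  filter_upwards [hne] with s hs
  rw [riemannZeta_eq_inv_sub_mul]
  intro h
  exact hs (by linear_combination h / 2)

theorem meromorphicAt_contin {M : ℕ} {s : ℂ} (hs : N - M < 2 * s.re) :
    MeromorphicAt (contin N d b β M) s := by
  have hz : ∀ m : ℕ, MeromorphicAt (fun s => zetaSum N d (2 * s + m)) s := fun m => by
    unfold zetaSum
    refine MeromorphicAt.fun_sum fun j _ => (MeromorphicAt.const (d j) s).mul ?_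
    simpa only [add_sub_assoc] using meromorphic_riemannZeta_affine (m - j) s
  refine MeromorphicAt.add (MeromorphicAt.fun_sum fun m _ => (MeromorphicAt.mul ?_
    (MeromorphicAt.const _ s)).mul (hz m)) ?_
  · exact (((differentiable_negBinom m).comp (differentiable_id.const_mul β)).analyticAt
      s).meromorphicAt
  · refine AnalyticAt.meromorphicAt (Complex.analyticAt_iff_eventually_differentiableAt.2 ?_)
    have ho : IsOpen {s : ℂ | N - M < 2 * s.re} :=
      isOpen_lt continuous_const (continuous_const.mul Complex.continuous_re)
    filter_upwards [ho.mem_nhds hs] with z hz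
    exact differentiableAt_tsum_tailTerm N d b β hz

/-- The function `negBinom m (β s) * ζ(2 s + m - j)` with its singularity at `0` removed. -/
def regTerm (β : ℂ) (m j : ℕ) (s : ℂ) : ℂ :=
  if m = j + 1 then -(β / (2 * (j + 1))) * negBinom j (β * s + 1) * riemannZeta₁ (2 * s + 1)
  else negBinom m (β * s) * riemannZeta (2 * s + m - j)

/-- The pole of `ζ(2s + m - j)` at `s = 0` occurs only for `m = j + 1`; there the factor `s` in the
binomial coefficient cancels it. -/
theorem regTerm_eq (m j : ℕ) {s : ℂ} (hs : s ≠ 0) :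
    negBinom m (β * s) * riemannZeta (2 * s + m - j) = regTerm β m j s := by
  rw [regTerm]
  split_ifs with h
  · subst h
    have h1 := succ_mul_negBinom_succ j (β * s)
    have hj := natCast_add_one_ne_zero j
    have e : 2 * s + ((j + 1 : ℕ) : ℂ) - j = 2 * s + 1 := by push_cast; ring
    rw [e, riemannZeta_eq_inv_sub_mul (by simpa using hs)]
    have h2 : negBinom (j + 1) (β * s) = -(β * s) * negBinom j (β * s + 1) / (j + 1) := by
      rw [eq_div_iff hj, mul_comm, h1]
    rw [h2, add_sub_cancel_right]
    field_simp
  · rfl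

theorem two_mul_add_sub_ne_one {m j : ℕ} (h : m ≠ j + 1) :
    (2 * 0 + m - j : ℂ) ≠ 1 := by
  intro e
  refine h ?_
  have : (m : ℂ) = (j + 1 : ℕ) := by push_cast; linear_combination e
  exact_mod_cast this

theorem analyticAt_regTerm (m j : ℕ) : AnalyticAt ℂ (regTerm β m j) 0 := by
  rw [Complex.analyticAt_iff_eventually_differentiableAt]
  unfold regTerm
  split_ifs with h
  · refine Eventually.of_forall fun s => ?_
    have h1 := (differentiable_negBinom j).comp ((differentiable_id.const_mul β).add_const 1)
    have h2 := differentiable_riemannZeta₁.comp ((differentiable_id.const_mul 2).add_const 1)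
    exact ((h1 s).const_mul _).mul (h2 s)
  · have hc : ContinuousAt (fun s : ℂ => 2 * s + m - j) 0 := by fun_prop
    filter_upwards [hc.eventually_ne (two_mul_add_sub_ne_one h)] with s hs
    have h1 := (differentiable_negBinom m).comp (differentiable_id.const_mul β)
    exact (h1 s).mul ((differentiableAt_riemannZeta hs).comp s (by fun_prop))

/-- The value at `0` of the derivative of `regTerm 1 m j - regTerm 2 m j / 2`. -/
def regTermDeriv (m j : ℕ) : ℂ :=
  if m = 0 then deriv riemannZeta (-j)
  else if m = j + 1 then (-1) ^ j * (harmonic j : ℚ) / (2 * (j + 1)) else 0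

/-- For `m = 0` the two functions coincide, and half of `ζ(2s - j)` remains. For other `m ≠ j + 1`
the coefficient vanishes at 0, the derivative is linear in `β`, and the combination `1 - (1/2) 2` is
0. For `m = j + 1` the derivative also has a term proportional to `β²`, with combination `1 - (1/2)
4 = -1`; it carries the harmonic number, while the part with the derivative of `riemannZeta₁` is
linear in `β` and cancels. -/
theorem hasDerivAt_regTerm_sub (m j : ℕ) :
    HasDerivAt (fun s => regTerm 1 m j s - 1 / 2 * regTerm 2 m j s) (regTermDeriv m j) 0 := by
  have hmul : ∀ a : ℂ, HasDerivAt (fun s : ℂ => a * s) a 0 := fun a => by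
    simpa using (hasDerivAt_id (0 : ℂ)).const_mul a
  unfold regTerm regTermDeriv
  by_cases h : m = j + 1
  · have hm : m ≠ 0 := by omega
    simp only [h, if_true, Nat.succ_ne_zero, if_false]
    have h1 : ∀ a : ℂ, HasDerivAt (fun s => negBinom j (a * s + 1))
        ((-1) ^ j * (harmonic j : ℚ) * a) 0 := fun a =>
      HasDerivAt.comp_of_eq (0 : ℂ) (hasDerivAt_negBinom_one j) ((hmul a).add_const 1) (by simp)
    have h2 : HasDerivAt (fun s => riemannZeta₁ (2 * s + 1))
        (deriv riemannZeta₁ (2 * 0 + 1) * 2) 0 :=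
      HasDerivAt.comp (0 : ℂ) (h₂ := riemannZeta₁) (differentiable_riemannZeta₁ _).hasDerivAt
        ((hmul 2).add_const 1)
    have h3 := fun a : ℂ => ((h1 a).const_mul (-(a / (2 * (j + 1))))).mul h2
    refine ((h3 1).sub ((h3 2).const_mul (1 / 2))).congr_deriv ?_
    have hj := natCast_add_one_ne_zero j
    simp only [mul_zero, zero_add, riemannZeta₁_one]
    field_simp
    ring
  · simp only [h, if_false]
    have hne := two_mul_add_sub_ne_one h
    have h1 : ∀ a : ℂ, HasDerivAt (fun s => negBinom m (a * s)) (deriv (negBinom m) 0 * a) 0 :=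
      fun a => HasDerivAt.comp_of_eq (0 : ℂ) (differentiable_negBinom m 0).hasDerivAt (hmul a)
        (by simp)
    have h2 : HasDerivAt (fun s : ℂ => riemannZeta (2 * s + m - j))
        (deriv riemannZeta (m - j) * 2) 0 :=
      HasDerivAt.comp_of_eq (0 : ℂ)
        (differentiableAt_riemannZeta (by simpa using hne)).hasDerivAt
        (((hmul 2).add_const (m : ℂ)).sub_const (j : ℂ)) (by simp)
    have h3 := fun a : ℂ => (h1 a).mul h2
    refine ((h3 1).sub ((h3 2).const_mul (1 / 2))).congr_deriv ?_
    rcases m with _ | m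
    · simp [negBinom_zero]
      ring
    · simp [negBinom_succ_zero]
      ring

/-- The function `contin` with its singularity at `0` removed. -/
def continReg (M : ℕ) (s : ℂ) : ℂ :=
  ∑ m ∈ range M, ∑ j ∈ range N, b ^ m * d j * regTerm β m j s + ∑' k, tailTerm N d b β M k s

theorem continReg_eq (M : ℕ) {s : ℂ} (hs : s ≠ 0) :
    contin N d b β M s = continReg N d b β M s := by
  rw [contin, continReg]
  congr 1
  refine sum_congr rfl fun m _ => ?_
  rw [zetaSum, mul_sum]
  refine sum_congr rfl fun j _ => ?_
  rw [← regTerm_eq _ _ _ hs]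
  ring

theorem analyticAt_continReg {M : ℕ} (hM : N < M) : AnalyticAt ℂ (continReg N d b β M) 0 := by
  refine AnalyticAt.add (Finset.analyticAt_fun_sum _ fun m _ => Finset.analyticAt_fun_sum _
    fun j _ => analyticAt_const.mul (analyticAt_regTerm β m j)) ?_
  refine Complex.analyticAt_iff_eventually_differentiableAt.2 ?_
  have ho : IsOpen {s : ℂ | N - M < 2 * s.re} :=
    isOpen_lt continuous_const (continuous_const.mul Complex.continuous_re)
  have hM' : (N : ℝ) < M := by exact_mod_cast hM
  filter_upwards [ho.mem_nhds (show (N - M : ℝ) < 2 * (0 : ℂ).re by simpa using hM')] with z hz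
  exact differentiableAt_tsum_tailTerm N d b β hz

/-- The remainder vanishes at `s = 0`, so the power of `k` is not differentiated, and the chain rule
leaves `β` times a series that does not depend on `β`. The value of that series is never needed. -/
theorem hasDerivAt_tsum_tailTerm {M : ℕ} (hM : N < M) :
    HasDerivAt (fun s => ∑' k, tailTerm N d b β M k s)
      (β * ∑' k : ℕ, coeffSum N d (k + 1) * deriv (fun s => binomRem M s (b / (k + 1))) 0) 0 := by
  have hM' : (N : ℝ) < M := by exact_mod_cast hM
  obtain ⟨σ, h1, h2⟩ := exists_between (show ((N - M) / 2 : ℝ) < 0 by linarith)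
  obtain ⟨u, hu, h⟩ := exists_norm_tailTerm_le N d b β M 1 σ (by linarith)
  have hU : IsOpen {z : ℂ | ‖z‖ < 1 ∧ σ < z.re} :=
    (isOpen_lt continuous_norm continuous_const).inter
      (isOpen_lt continuous_const Complex.continuous_re)
  have h3 := Complex.hasSum_deriv_of_summable_norm (z := 0) hu
    (fun k => (differentiable_tailTerm N d b β M k).differentiableOn) hU
    (fun k z hz => h k z hz.1 hz.2) (by simpa using h2)
  have h4 : ∀ k : ℕ, deriv (tailTerm N d b β M k) 0 =
      β * (coeffSum N d (k + 1) * deriv (fun s => binomRem M s (b / (k + 1))) 0) := by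
    intro k
    obtain ⟨M, rfl⟩ : ∃ M', M = M' + 1 := ⟨M - 1, by omega⟩
    have hk := natCast_add_one_ne_zero k
    have g1 : HasDerivAt (fun s : ℂ => coeffSum N d (k + 1) * (k + 1 : ℂ) ^ (-(2 * s)))
        _ 0 := (((differentiable_id.const_mul (2 : ℂ)).neg.const_cpow
          (Or.inl hk)).const_mul (coeffSum N d (k + 1)) (0 : ℂ)).hasDerivAt
    have g2 : HasDerivAt (fun s => binomRem (M + 1) (β * s) (b / (k + 1)))
        (deriv (fun s => binomRem (M + 1) s (b / (k + 1))) 0 * β) 0 :=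
      HasDerivAt.comp_of_eq (0 : ℂ)
        (differentiable_binomRem (M + 1) (x := b / (k + 1)) (by positivity) 0).hasDerivAt
        (by simpa using (hasDerivAt_id (0 : ℂ)).const_mul β) (by simp)
    refine HasDerivAt.deriv (f := tailTerm N d b β (M + 1) k) ((g1.mul g2).congr_deriv ?_)
    simp [binomRem_succ_zero_left]
    ring
  simp only [h4] at h3
  rw [← tsum_mul_left, h3.tsum_eq]
  exact (differentiableAt_tsum_tailTerm N d b β (by simpa using hM')).hasDerivAt

/-- The remainder series cancel. In the double sum, each `j` contributes through `m = 0` and `m = j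
+ 1` only, and both indices occur because `M > N`. -/
theorem hasDerivAt_continReg_sub {M : ℕ} (hM : N < M) :
    HasDerivAt (fun s => continReg N d b 1 M s - 1 / 2 * continReg N d b 2 M s)
      (∑ j ∈ range N, d j * deriv riemannZeta (-j) +
        ∑ j ∈ range N, d j * b ^ (j + 1) * ((-1) ^ j * (harmonic j : ℚ) / (2 * (j + 1)))) 0 := by
  have h1 : HasDerivAt (fun s => ∑ m ∈ range M, ∑ j ∈ range N,
      b ^ m * d j * (regTerm 1 m j s - 1 / 2 * regTerm 2 m j s))
      (∑ m ∈ range M, ∑ j ∈ range N, b ^ m * d j * regTermDeriv m j) 0 :=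
    HasDerivAt.fun_sum fun m _ => HasDerivAt.fun_sum fun j _ =>
      (hasDerivAt_regTerm_sub m j).const_mul _
  have h2 := (hasDerivAt_tsum_tailTerm N d b 1 hM).sub
    ((hasDerivAt_tsum_tailTerm N d b 2 hM).const_mul (1 / 2))
  refine ((h1.add h2).congr_deriv ?_).congr_of_eventuallyEq (Eventually.of_forall fun s => ?_)
  · rw [sum_comm, ← sum_add_distrib]
    have e : ∀ j ∈ range N, ∑ m ∈ range M, b ^ m * d j * regTermDeriv m j =
        d j * deriv riemannZeta (-j) +
          d j * b ^ (j + 1) * ((-1) ^ j * (harmonic j : ℚ) / (2 * (j + 1))) := by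
      intro j hj
      have hjM : j + 1 ∈ range M := mem_range.2 (by have := mem_range.1 hj; omega)
      have h0M : 0 ∈ range M := mem_range.2 (by omega)
      have hs : ∀ m, (b : ℂ) ^ m * d j * regTermDeriv m j =
          (if m = 0 then d j * deriv riemannZeta (-j) else 0) +
          (if m = j + 1 then
            d j * b ^ (j + 1) * ((-1) ^ j * (harmonic j : ℚ) / (2 * (j + 1))) else 0) := by
        intro m
        unfold regTermDeriv
        by_cases h0 : m = 0
        · subst h0; simp
        · by_cases h1 : m = j + 1
          · subst h1
            rw [if_neg h0, if_pos rfl, if_neg h0, if_pos rfl]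
            ring
          · simp [h0, h1]
      simp only [hs, sum_add_distrib, sum_ite_eq', h0M, hjM, if_true]
    rw [sum_congr rfl e]
    ring
  · simp only [continReg, Pi.add_apply, Pi.sub_apply, mul_sub, mul_add, sum_sub_distrib, mul_sum]
    have e : ∀ m j, (b : ℂ) ^ m * d j * (1 / 2 * regTerm 2 m j s) =
      1 / 2 * (b ^ m * d j * regTerm 2 m j s) := fun m j => by ring
    simp only [e]
    ring

end Regular

/-! ### The zeta function of the eigenvalues `k (k + b)` and its derivative at 0. -/

section SphereZeta

open Finset Filter Topology

variable {N : ℕ} {d e : ℕ → ℂ} {b : ℕ}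

theorem meromorphicAt_zetaSum (N : ℕ) (d : ℕ → ℂ) (s : ℂ) :
    MeromorphicAt (fun s => zetaSum N d (2 * s)) s := by
  unfold zetaSum
  refine MeromorphicAt.fun_sum fun j _ => (MeromorphicAt.const (d j) s).mul ?_
  simpa only [← sub_eq_add_neg] using meromorphic_riemannZeta_affine (-j) s

/-- For `β = 2` the summand is `d(k) (k + b)^(-2s) = e(l) l^(-2s)` with `l = k + b`. The missing
indices `l ≤ b` contribute only `l = b`, where `e(b) = d(0) = 1` is the multiplicity of the
constants. -/
theorem contin_two_eq (hb : 1 ≤ b) (hshift : ∀ x, coeffSum N d x = coeffSum N e (x + b))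
    (hval : ∀ l < b, coeffSum N e (l + 1) = if l + 1 = b then 1 else 0) (M : ℕ) {s : ℂ}
    (hs : N < 2 * s.re) :
    contin N d b 2 M s = zetaSum N e (2 * s) - (b : ℂ) ^ (-(2 * s)) := by
  have h1 := (hasSum_nat_add_iff' b).2 (hasSum_zetaSum N e (w := 2 * s) (by simpa using hs))
  have h2 : ∑ l ∈ range b, coeffSum N e (l + 1) * (l + 1 : ℂ) ^ (-(2 * s)) =
      (b : ℂ) ^ (-(2 * s)) := by
    rw [sum_eq_single_of_mem (b - 1) (mem_range.2 (by omega))]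
    · rw [hval _ (by omega), if_pos (by omega), one_mul, ← Nat.cast_succ]
      congr 2
      omega
    · intro l hl hne
      rw [hval l (mem_range.1 hl), if_neg (by omega), zero_mul]
  rw [h2] at h1
  refine (hasSum_contin N d b 2 M hs).unique (h1.congr_fun fun k => ?_)
  have hk : (0 : ℝ) < k + 1 := by positivity
  have h3 : ((k + 1 : ℝ) : ℂ) ^ (-(2 * s)) * ((1 + b / (k + 1) : ℝ) : ℂ) ^ (-(2 * s)) =
      (((k + b : ℕ) + 1 : ℝ) : ℂ) ^ (-(2 * s)) := by
    rw [← Complex.mul_cpow_ofReal_nonneg hk.le (by positivity), ← Complex.ofReal_mul]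
    congr 2
    push_cast
    field_simp
    ring
  rw [hshift, mul_assoc]
  congr 1
  · congr 1
    push_cast
    ring
  · push_cast at h3 ⊢
    exact h3

/-- The spectral zeta function of the eigenvalues `k (k + b)` with multiplicities
`∑ d j * k ^ j`. -/
def shiftZeta (N : ℕ) (d : ℕ → ℂ) (b : ℕ) (s : ℂ) : ℂ :=
  if s = 0 then continReg N d b 1 (N + 1) 0 else contin N d b 1 (⌊N + 2 * ‖s‖⌋₊ + 1) s

/-- The number of terms in `shiftZeta` exceeds `N + 2 ‖s‖`, and `-‖s‖ ≤ Re s`, so `s` lies in the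
half-plane where the expansion is valid and where further terms change nothing. -/
theorem shiftZeta_eq {M : ℕ} {s : ℂ} (hs : s ≠ 0) (hM : N + 2 * ‖s‖ < M) :
    shiftZeta N d b s = contin N d b 1 M s := by
  rw [shiftZeta, if_neg hs]
  refine (contin_eq_of_le N d b 1 ?_ ?_).symm
  · exact (Nat.floor_lt (by positivity)).2 hM
  · have h1 := Nat.lt_floor_add_one (N + 2 * ‖s‖)
    have h2 : -‖s‖ ≤ s.re := (abs_le.1 (Complex.abs_re_le_norm s)).1
    push_cast
    linarith

theorem meromorphic_shiftZeta (N : ℕ) (d : ℕ → ℂ) (b : ℕ) : Meromorphic (shiftZeta N d b) := by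
  intro x
  set M := ⌊N + 2 * (‖x‖ + 1)⌋₊ + 1
  have hM : N + 2 * (‖x‖ + 1) < M := by
    simpa [M] using Nat.lt_floor_add_one (N + 2 * (‖x‖ + 1))
  have h2 : -‖x‖ ≤ x.re := (abs_le.1 (Complex.abs_re_le_norm x)).1
  refine (meromorphicAt_contin N d b 1 (M := M) (s := x) (by linarith)).congr ?_
  have h0 : ∀ᶠ s in 𝓝[≠] x, s ≠ 0 := by
    rcases eq_or_ne x 0 with h | h
    · rw [h]
      exact self_mem_nhdsWithin
    · exact eventually_nhdsWithin_of_eventually_nhds (eventually_ne_nhds h)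
  have h1 : ∀ᶠ s in 𝓝[≠] x, ‖s‖ < ‖x‖ + 1 :=
    eventually_nhdsWithin_of_eventually_nhds
      (continuous_norm.continuousAt.eventually_lt_const (by simp))
  filter_upwards [h0, h1] with s hs0 hs1
  exact (shiftZeta_eq hs0 (by linarith)).symm

theorem shiftZeta_eventuallyEq (N : ℕ) (d : ℕ → ℂ) (b : ℕ) :
    shiftZeta N d b =ᶠ[𝓝 0] continReg N d b 1 (N + 1) := by
  have h1 : ∀ᶠ s : ℂ in 𝓝 0, ‖s‖ < 1 / 2 :=
    continuous_norm.continuousAt.eventually_lt_const (by simp)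
  filter_upwards [h1] with s hs
  by_cases h0 : s = 0
  · rw [h0, shiftZeta, if_pos rfl]
  · rw [← continReg_eq N d b 1 _ h0]
    refine shiftZeta_eq h0 ?_
    push_cast
    linarith

theorem analyticAt_shiftZeta (N : ℕ) (d : ℕ → ℂ) (b : ℕ) : AnalyticAt ℂ (shiftZeta N d b) 0 :=
  (analyticAt_continReg N d b 1 N.lt_succ_self).congr (shiftZeta_eventuallyEq N d b).symm

theorem hasSum_shiftZeta (N : ℕ) (d : ℕ → ℂ) (b : ℕ) {s : ℂ} (hs : N < 2 * s.re) :
    HasSum (fun k : ℕ => coeffSum N d (k + 1) * (((k + 1) * (k + 1 + b) : ℝ) : ℂ) ^ (-s))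
      (shiftZeta N d b s) := by
  have h0 : s ≠ 0 := by
    rintro rfl
    have : (0 : ℝ) ≤ N := Nat.cast_nonneg N
    simp at hs
    linarith
  rw [shiftZeta, if_neg h0]
  have h := hasSum_contin N d b 1 (⌊N + 2 * ‖s‖⌋₊ + 1) hs
  refine h.congr_fun fun k => ?_
  have hk : (0 : ℝ) < k + 1 := by positivity
  have h1 : (k + 1) * (k + 1 + b) = (k + 1) * ((k + 1) * (1 + b / (k + 1)) : ℝ) := by
    field_simp
  have h2 : ((k + 1 : ℝ) : ℂ) = (k + 1 : ℂ) := by push_cast; rfl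
  rw [h1, Complex.ofReal_mul, Complex.ofReal_mul, ← Complex.ofReal_mul (k + 1 : ℝ),
    Complex.mul_cpow_ofReal_nonneg hk.le (by positivity), Complex.ofReal_mul,
    Complex.mul_cpow_ofReal_nonneg hk.le (by positivity), h2, ← mul_assoc, mul_assoc, one_mul,
    ← mul_assoc ((k + 1 : ℂ) ^ (-s)), ← Complex.cpow_add _ _ (natCast_add_one_ne_zero k), mul_assoc]
  congr 3
  ring

/-- The identity theorem for meromorphic functions carries `contin_two_eq` from the half-plane of
convergence to a punctured neighbourhood of 0; continuity of both sides covers 0 itself. -/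
theorem continReg_two_eventuallyEq (hb : 1 ≤ b)
    (hshift : ∀ x, coeffSum N d x = coeffSum N e (x + b))
    (hval : ∀ l < b, coeffSum N e (l + 1) = if l + 1 = b then 1 else 0) :
    continReg N d b 2 (N + 1) =ᶠ[𝓝 0] fun s => zetaSum N e (2 * s) - (b : ℂ) ^ (-(2 * s)) := by
  have hb0 : (b : ℂ) ≠ 0 := by exact_mod_cast (by omega : b ≠ 0)
  have hbd : Differentiable ℂ fun s : ℂ => (b : ℂ) ^ (-(2 * s)) :=
    (differentiable_id.const_mul 2).neg.const_cpow (Or.inl hb0)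
  -- With `M = N + 1` the continuation is valid for `2 Re s > N - M = -1`, a connected set
  -- containing both 0 and a half-plane of convergence.
  let U : Set ℂ := {s | (-1 : ℝ) < 2 * s.re}
  have hU : IsPreconnected U := by
    have : U = {s : ℂ | (-1 / 2 : ℝ) < s.re} := by
      ext s
      change (-1 : ℝ) < 2 * s.re ↔ (-1 / 2 : ℝ) < s.re
      constructor <;> intro h <;> linarith
    rw [this]
    exact (convex_halfSpace_re_gt _).isPreconnected
  let D : ℂ → ℂ := contin N d b 2 (N + 1) - fun s => zetaSum N e (2 * s) - (b : ℂ) ^ (-(2 * s))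
  have hD : MeromorphicOn D U := fun s hs => by
    refine (meromorphicAt_contin N d b 2 (M := N + 1) (s := s) ?_).sub
      ((meromorphicAt_zetaSum N e s).sub (hbd.analyticAt s).meromorphicAt)
    push_cast
    have : (-1 : ℝ) < 2 * s.re := hs
    linarith
  have hN : (0 : ℝ) ≤ N := Nat.cast_nonneg N
  have h1 : meromorphicOrderAt D ((N + 1 : ℝ) : ℂ) = ⊤ := by
    rw [meromorphicOrderAt_eq_top_iff]
    have ho : IsOpen {s : ℂ | (N : ℝ) < 2 * s.re} :=
      isOpen_lt continuous_const (continuous_const.mul Complex.continuous_re)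
    have hm : ((N + 1 : ℝ) : ℂ) ∈ {s : ℂ | (N : ℝ) < 2 * s.re} := by
      change (N : ℝ) < 2 * ((N + 1 : ℝ) : ℂ).re
      rw [Complex.ofReal_re]
      linarith
    filter_upwards [mem_nhdsWithin_of_mem_nhds (ho.mem_nhds hm)] with s hs
    exact sub_eq_zero.2 (contin_two_eq hb hshift hval _ hs)
  have h2 : meromorphicOrderAt D 0 = ⊤ := by
    by_contra h
    refine hD.meromorphicOrderAt_ne_top_of_isPreconnected hU (x := 0) ?_
      (y := ((N + 1 : ℝ) : ℂ)) ?_ h h1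
    · change (-1 : ℝ) < 2 * (0 : ℂ).re
      simp
    · change (-1 : ℝ) < 2 * ((N + 1 : ℝ) : ℂ).re
      rw [Complex.ofReal_re]
      linarith
  rw [meromorphicOrderAt_eq_top_iff] at h2
  have hz : DifferentiableAt ℂ (fun s => zetaSum N e (2 * s)) 0 := by
    unfold zetaSum
    refine DifferentiableAt.fun_sum fun j _ => ((differentiableAt_riemannZeta ?_).comp (0 : ℂ)
      (by fun_prop)).const_mul _
    intro h
    have : ((j + 1 : ℕ) : ℂ) = 0 := by push_cast; linear_combination -h
    exact absurd this (by exact_mod_cast j.succ_ne_zero)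
  refine (ContinuousAt.eventuallyEq_nhds_iff_eventuallyEq_nhdsNE
    (analyticAt_continReg N d b 2 N.lt_succ_self).continuousAt
    (hz.sub (hbd 0)).continuousAt).1 ?_
  filter_upwards [h2, self_mem_nhdsWithin] with s hs hs0
  rw [← continReg_eq N d b 2 _ hs0]
  exact sub_eq_zero.1 hs

/-- The case `β = 1` equals (case 1 minus half of case 2) plus half of case 2. The last summand is
explicit: it yields `∑ e_j ζ'(-j)` and, from `-b^(-2s) / 2`, the term `log b`. -/
theorem deriv_shiftZeta (hb : 1 ≤ b)
    (hshift : ∀ x, coeffSum N d x = coeffSum N e (x + b))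
    (hval : ∀ l < b, coeffSum N e (l + 1) = if l + 1 = b then 1 else 0) :
    deriv (shiftZeta N d b) 0 = ∑ j ∈ range N, (d j + e j) * deriv riemannZeta (-j) +
      Complex.log b +
      ∑ j ∈ range N, d j * b ^ (j + 1) * ((-1) ^ j * (harmonic j : ℚ) / (2 * (j + 1))) := by
  have hb0 : (b : ℂ) ≠ 0 := by exact_mod_cast (by omega : b ≠ 0)
  have hmul : HasDerivAt (fun s : ℂ => 2 * s) 2 0 := by
    simpa using (hasDerivAt_id (0 : ℂ)).const_mul 2
  have h1 : HasDerivAt (fun s => zetaSum N e (2 * s) - (b : ℂ) ^ (-(2 * s)))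
      (∑ j ∈ range N, e j * (deriv riemannZeta (-j) * 2) - -(2 * Complex.log b)) 0 := by
    refine HasDerivAt.sub (HasDerivAt.fun_sum fun j _ => HasDerivAt.const_mul _ ?_) ?_
    · refine HasDerivAt.comp_of_eq (0 : ℂ) (h₂ := riemannZeta) (y := -j)
        (differentiableAt_riemannZeta ?_).hasDerivAt (hmul.sub_const (j : ℂ)) (by simp)
      intro h
      have : ((j + 1 : ℕ) : ℂ) = 0 := by push_cast; linear_combination -h
      exact absurd this (by exact_mod_cast j.succ_ne_zero)
    · refine (hmul.neg.const_cpow (Or.inl hb0)).congr_deriv ?_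
      simp
      ring
  have h2 := h1.congr_of_eventuallyEq (continReg_two_eventuallyEq hb hshift hval)
  have h3 := (hasDerivAt_continReg_sub N d b N.lt_succ_self).add (h2.const_mul (1 / 2))
  have h4 : HasDerivAt (continReg N d b 1 (N + 1)) _ 0 :=
    h3.congr_of_eventuallyEq (Eventually.of_forall fun s => by simp)
  rw [(shiftZeta_eventuallyEq N d b).deriv_eq, h4.deriv]
  simp only [add_mul, sum_add_distrib, ← mul_assoc, ← sum_mul]
  ring

end SphereZeta

/-! ### From the multiplicity polynomial to the determinant. -/

section Determinant

open Finset MvPolynomial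

theorem factorial_mul_multichoose (b j : ℕ) :
    (b + 1).factorial * (b + 2).multichoose j = (j + 1).ascFactorial (b + 1) := by
  rw [Nat.ascFactorial_eq_factorial_mul_choose, Nat.multichoose_eq]
  congr 1
  rw [show b + 2 + j - 1 = b + 1 + j by omega, add_comm j, Nat.choose_symm_add]

theorem finrank_harmonicSubmodule_fin_one (b : ℕ) :
    finrank ℝ (harmonicSubmodule (Fin (b + 2)) 1) = b + 2 := by
  rw [finrank_harmonicSubmodule_of_lt_two one_lt_two, Fintype.card_fin, Nat.multichoose_one_right]

theorem factorial_mul_finrank_harmonicSubmodule_fin (b j : ℕ) :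
    (b + 1).factorial * finrank ℝ (harmonicSubmodule (Fin (b + 2)) (j + 2)) +
      (j + 1).ascFactorial (b + 1) = (j + 3).ascFactorial (b + 1) := by
  rw [← factorial_mul_multichoose, ← factorial_mul_multichoose, ← mul_add]
  have := finrank_harmonicSubmodule_add_two (σ := Fin (b + 2)) j
  rw [Fintype.card_fin] at this
  rw [this]

/-- The complex sequence with the given first terms, continued by `0`. -/
def listCoeff (l : List ℚ) (j : ℕ) : ℂ := (l.getD j 0 : ℚ)

/-- Clearing the factor `(b + 1)!` reduces the dimension formula to a polynomial identity in `j`.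
Degree 1 is separate because the recursion for dimensions starts at degree 2. -/
theorem finrank_harmonicSubmodule_fin_eq {b : ℕ} {d : ℕ → ℂ} (h1 : coeffSum (b + 1) d 1 = b + 2)
    (h2 : ∀ j : ℕ, (b + 1).factorial * coeffSum (b + 1) d (j + 2) +
      ((j + 1).ascFactorial (b + 1) : ℕ) = ((j + 3).ascFactorial (b + 1) : ℕ)) (k : ℕ) :
    (finrank ℝ (harmonicSubmodule (Fin (b + 2)) (k + 1)) : ℂ) = coeffSum (b + 1) d (k + 1) := by
  rcases k with _ | j
  · simp [finrank_harmonicSubmodule_fin_one, h1]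
  · have h3 := congrArg (Nat.cast (R := ℂ)) (factorial_mul_finrank_harmonicSubmodule_fin b j)
    have h4 : ((b + 1).factorial : ℂ) ≠ 0 := by exact_mod_cast (b + 1).factorial_ne_zero
    push_cast at h3
    have h5 := h2 j
    push_cast at h5 ⊢
    refine mul_left_cancel₀ h4 ?_
    rw [add_assoc (j : ℂ), one_add_one_eq_two]
    linear_combination h3 - h5

theorem isSpectralZeta_shiftZeta {b : ℕ} (d : ℕ → ℂ)
    (hd : ∀ k : ℕ, (finrank ℝ (harmonicSubmodule (Fin (b + 2)) (k + 1)) : ℂ) =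
      coeffSum (b + 1) d (k + 1)) :
    IsSpectralZeta (sphereLaplacian (b + 1)) (shiftZeta (b + 1) d b) := by
  refine isSpectralZeta_sphereLaplacian (by omega) (meromorphic_shiftZeta _ _ _)
    (analyticAt_shiftZeta _ _ _) (σ := b + 1) fun s hs => ?_
  have hb : (0 : ℝ) ≤ b := Nat.cast_nonneg b
  have h := hasSum_shiftZeta (b + 1) d b (s := s) (by push_cast; linarith)
  refine h.congr_fun fun k => ?_
  rw [hd, sphereEigenvalue]
  congr 4
  all_goals push_cast; ring

/-- The term `log b` in the derivative becomes the factor `1 / b`. -/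
theorem sphereDet_eq {b : ℕ} (hb : 1 ≤ b) {d e : ℕ → ℂ}
    (hd : ∀ k : ℕ, (finrank ℝ (harmonicSubmodule (Fin (b + 2)) (k + 1)) : ℂ) =
      coeffSum (b + 1) d (k + 1))
    (hshift : ∀ x, coeffSum (b + 1) d x = coeffSum (b + 1) e (x + b))
    (hval : ∀ l < b, coeffSum (b + 1) e (l + 1) = if l + 1 = b then 1 else 0) :
    sphereDet (b + 1) = (b : ℂ)⁻¹ *
      Complex.exp (-(∑ j ∈ range (b + 1), (d j + e j) * deriv riemannZeta (-j)) -
      ∑ j ∈ range (b + 1), d j * b ^ (j + 1) * ((-1) ^ j * (harmonic j : ℚ) / (2 * (j + 1)))) := by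
  have hb0 : (b : ℂ) ≠ 0 := by exact_mod_cast (by omega : b ≠ 0)
  rw [sphereDet, zetaDet_eq (isSpectralZeta_shiftZeta d hd), deriv_shiftZeta hb hshift hval]
  conv_rhs => rw [← Complex.exp_log hb0, ← Complex.exp_neg, ← Complex.exp_add, Complex.exp_log hb0]
  congr 1
  ring

end Determinant

/-! ### Multiplicity polynomials and determinants for `n = 2, …, 9`. -/

section Dimensions

open Finset MvPolynomial

theorem finrank_harmonicSubmodule_fin_3 (k : ℕ) :
    (finrank ℝ (harmonicSubmodule (Fin 3) (k + 1)) : ℂ) =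
      coeffSum 2 (listCoeff [1, 2]) (k + 1) := by
  refine finrank_harmonicSubmodule_fin_eq (b := 1) ?_ (fun j => ?_) k
  · norm_num [coeffSum, listCoeff, sum_range_succ]
  · simp only [coeffSum, listCoeff, sum_range_succ, sum_range_zero, Nat.ascFactorial, Nat.factorial,
      List.getD_cons_succ, List.getD_cons_zero]
    push_cast
    ring

/-- Here and for the other spheres, `d(-x)` and `d(x - b)` agree up to the sign `(-1)^b`, so the
witness has `e_j = (-1)^(b + j) d_j`. Hence `d_j + e_j` is 0 or `2 d_j`, and only the `ζ'(-j)` with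
`j` of the parity of `b` remain. The last summand of the exponent is the part with harmonic numbers;
it is 0 for the odd-dimensional spheres treated here. -/
theorem sphereDet_2 : sphereDet 2 = 1 / 1 * Complex.exp
    (-(4 * deriv riemannZeta (-1)) - -1/2) := by
  have h := sphereDet_eq (b := 1) (by norm_num) (e := listCoeff [-1, 2])
    finrank_harmonicSubmodule_fin_3 (fun x => ?_) (fun l hl => ?_)
  · refine h.trans ?_
    congr 1
    · norm_num
    · congr 1
      simp only [listCoeff, sum_range_succ, sum_range_zero, harmonic,
        List.getD_cons_succ, List.getD_cons_zero]
      push_cast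
      ring
  · simp only [coeffSum, listCoeff, sum_range_succ, sum_range_zero,
      List.getD_cons_succ, List.getD_cons_zero]
    push_cast
    ring
  · interval_cases l <;> norm_num [coeffSum, listCoeff, sum_range_succ]

theorem finrank_harmonicSubmodule_fin_4 (k : ℕ) :
    (finrank ℝ (harmonicSubmodule (Fin 4) (k + 1)) : ℂ) =
      coeffSum 3 (listCoeff [1, 2, 1]) (k + 1) := by
  refine finrank_harmonicSubmodule_fin_eq (b := 2) ?_ (fun j => ?_) k
  · norm_num [coeffSum, listCoeff, sum_range_succ]
  · simp only [coeffSum, listCoeff, sum_range_succ, sum_range_zero, Nat.ascFactorial, Nat.factorial,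
      List.getD_cons_succ, List.getD_cons_zero]
    push_cast
    ring

theorem sphereDet_3 : sphereDet 3 = 1 / 2 * Complex.exp
    (-(2 * deriv riemannZeta (-0) + 2 * deriv riemannZeta (-2)) - 0) := by
  have h := sphereDet_eq (b := 2) (by norm_num) (e := listCoeff [1, -2, 1])
    finrank_harmonicSubmodule_fin_4 (fun x => ?_) (fun l hl => ?_)
  · refine h.trans ?_
    congr 1
    · norm_num
    · congr 1
      simp only [listCoeff, sum_range_succ, sum_range_zero, harmonic,
        List.getD_cons_succ, List.getD_cons_zero]
      push_cast
      ring
  · simp only [coeffSum, listCoeff, sum_range_succ, sum_range_zero,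
      List.getD_cons_succ, List.getD_cons_zero]
    push_cast
    ring
  · interval_cases l <;> norm_num [coeffSum, listCoeff, sum_range_succ]

theorem finrank_harmonicSubmodule_fin_5 (k : ℕ) :
    (finrank ℝ (harmonicSubmodule (Fin 5) (k + 1)) : ℂ) =
      coeffSum 4 (listCoeff [1, 13/6, 3/2, 1/3]) (k + 1) := by
  refine finrank_harmonicSubmodule_fin_eq (b := 3) ?_ (fun j => ?_) k
  · norm_num [coeffSum, listCoeff, sum_range_succ]
  · simp only [coeffSum, listCoeff, sum_range_succ, sum_range_zero, Nat.ascFactorial, Nat.factorial,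
      List.getD_cons_succ, List.getD_cons_zero]
    push_cast
    ring

theorem sphereDet_4 : sphereDet 4 = 1 / 3 * Complex.exp
    (-(13/3 * deriv riemannZeta (-1) + 2/3 * deriv riemannZeta (-3)) - -15/16) := by
  have h := sphereDet_eq (b := 3) (by norm_num) (e := listCoeff [-1, 13/6, -3/2, 1/3])
    finrank_harmonicSubmodule_fin_5 (fun x => ?_) (fun l hl => ?_)
  · refine h.trans ?_
    congr 1
    · norm_num
    · congr 1
      simp only [listCoeff, sum_range_succ, sum_range_zero, harmonic,
        List.getD_cons_succ, List.getD_cons_zero]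
      push_cast
      ring
  · simp only [coeffSum, listCoeff, sum_range_succ, sum_range_zero,
      List.getD_cons_succ, List.getD_cons_zero]
    push_cast
    ring
  · interval_cases l <;> norm_num [coeffSum, listCoeff, sum_range_succ]

theorem finrank_harmonicSubmodule_fin_6 (k : ℕ) :
    (finrank ℝ (harmonicSubmodule (Fin 6) (k + 1)) : ℂ) =
      coeffSum 5 (listCoeff [1, 7/3, 23/12, 2/3, 1/12]) (k + 1) := by
  refine finrank_harmonicSubmodule_fin_eq (b := 4) ?_ (fun j => ?_) k
  · norm_num [coeffSum, listCoeff, sum_range_succ]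
  · simp only [coeffSum, listCoeff, sum_range_succ, sum_range_zero, Nat.ascFactorial, Nat.factorial,
      List.getD_cons_succ, List.getD_cons_zero]
    push_cast
    ring

theorem sphereDet_5 : sphereDet 5 = 1 / 4 * Complex.exp
    (-(2 * deriv riemannZeta (-0) + 23/6 * deriv riemannZeta (-2) +
        1/6 * deriv riemannZeta (-4)) - 0) := by
  have h := sphereDet_eq (b := 4) (by norm_num) (e := listCoeff [1, -7/3, 23/12, -2/3, 1/12])
    finrank_harmonicSubmodule_fin_6 (fun x => ?_) (fun l hl => ?_)
  · refine h.trans ?_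
    congr 1
    · norm_num
    · congr 1
      simp only [listCoeff, sum_range_succ, sum_range_zero, harmonic,
        List.getD_cons_succ, List.getD_cons_zero]
      push_cast
      ring
  · simp only [coeffSum, listCoeff, sum_range_succ, sum_range_zero,
      List.getD_cons_succ, List.getD_cons_zero]
    push_cast
    ring
  · interval_cases l <;> norm_num [coeffSum, listCoeff, sum_range_succ]

theorem finrank_harmonicSubmodule_fin_7 (k : ℕ) :
    (finrank ℝ (harmonicSubmodule (Fin 7) (k + 1)) : ℂ) =
      coeffSum 6 (listCoeff [1, 149/60, 55/24, 1, 5/24, 1/60]) (k + 1) := by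
  refine finrank_harmonicSubmodule_fin_eq (b := 5) ?_ (fun j => ?_) k
  · norm_num [coeffSum, listCoeff, sum_range_succ]
  · simp only [coeffSum, listCoeff, sum_range_succ, sum_range_zero, Nat.ascFactorial, Nat.factorial,
      List.getD_cons_succ, List.getD_cons_zero]
    push_cast
    ring

theorem sphereDet_6 : sphereDet 6 = 1 / 5 * Complex.exp
    (-(149/30 * deriv riemannZeta (-1) + 2 * deriv riemannZeta (-3) +
        1/30 * deriv riemannZeta (-5)) - -455/432) := by
  have h := sphereDet_eq (b := 5) (by norm_num) (e := listCoeff [-1, 149/60, -55/24, 1, -5/24,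
      1/60])
    finrank_harmonicSubmodule_fin_7 (fun x => ?_) (fun l hl => ?_)
  · refine h.trans ?_
    congr 1
    · norm_num
    · congr 1
      simp only [listCoeff, sum_range_succ, sum_range_zero, harmonic,
        List.getD_cons_succ, List.getD_cons_zero]
      push_cast
      ring
  · simp only [coeffSum, listCoeff, sum_range_succ, sum_range_zero,
      List.getD_cons_succ, List.getD_cons_zero]
    push_cast
    ring
  · interval_cases l <;> norm_num [coeffSum, listCoeff, sum_range_succ]

theorem finrank_harmonicSubmodule_fin_8 (k : ℕ) :
    (finrank ℝ (harmonicSubmodule (Fin 8) (k + 1)) : ℂ) =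
      coeffSum 7 (listCoeff [1, 157/60, 949/360, 4/3, 13/36, 1/20, 1/360]) (k + 1) := by
  refine finrank_harmonicSubmodule_fin_eq (b := 6) ?_ (fun j => ?_) k
  · norm_num [coeffSum, listCoeff, sum_range_succ]
  · simp only [coeffSum, listCoeff, sum_range_succ, sum_range_zero, Nat.ascFactorial, Nat.factorial,
      List.getD_cons_succ, List.getD_cons_zero]
    push_cast
    ring

theorem sphereDet_7 : sphereDet 7 = 1 / 6 * Complex.exp
    (-(2 * deriv riemannZeta (-0) + 949/180 * deriv riemannZeta (-2) +
        13/18 * deriv riemannZeta (-4) + 1/180 * deriv riemannZeta (-6)) - 0) := by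
  have h := sphereDet_eq (b := 6) (by norm_num) (e := listCoeff [1, -157/60, 949/360, -4/3,
      13/36, -1/20, 1/360])
    finrank_harmonicSubmodule_fin_8 (fun x => ?_) (fun l hl => ?_)
  · refine h.trans ?_
    congr 1
    · norm_num
    · congr 1
      simp only [listCoeff, sum_range_succ, sum_range_zero, harmonic,
        List.getD_cons_succ, List.getD_cons_zero]
      push_cast
      ring
  · simp only [coeffSum, listCoeff, sum_range_succ, sum_range_zero,
      List.getD_cons_succ, List.getD_cons_zero]
    push_cast
    ring
  · interval_cases l <;> norm_num [coeffSum, listCoeff, sum_range_succ]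

theorem finrank_harmonicSubmodule_fin_9 (k : ℕ) :
    (finrank ℝ (harmonicSubmodule (Fin 9) (k + 1)) : ℂ) =
      coeffSum 8 (listCoeff [1, 383/140, 133/45, 1199/720, 77/144, 71/720, 7/720, 1/2520]) (k +
          1) := by
  refine finrank_harmonicSubmodule_fin_eq (b := 7) ?_ (fun j => ?_) k
  · norm_num [coeffSum, listCoeff, sum_range_succ]
  · simp only [coeffSum, listCoeff, sum_range_succ, sum_range_zero, Nat.ascFactorial, Nat.factorial,
      List.getD_cons_succ, List.getD_cons_zero]
    push_cast
    ring

theorem sphereDet_8 : sphereDet 8 = 1 / 7 * Complex.exp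
    (-(383/70 * deriv riemannZeta (-1) + 1199/360 * deriv riemannZeta (-3) +
        71/360 * deriv riemannZeta (-5) + 1/1260 * deriv riemannZeta (-7)) - -1148567/1036800) := by
  have h := sphereDet_eq (b := 7) (by norm_num) (e := listCoeff [-1, 383/140, -133/45, 1199/720,
      -77/144, 71/720, -7/720, 1/2520])
    finrank_harmonicSubmodule_fin_9 (fun x => ?_) (fun l hl => ?_)
  · refine h.trans ?_
    congr 1
    · norm_num
    · congr 1
      simp only [listCoeff, sum_range_succ, sum_range_zero, harmonic,
        List.getD_cons_succ, List.getD_cons_zero]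
      push_cast
      ring
  · simp only [coeffSum, listCoeff, sum_range_succ, sum_range_zero,
      List.getD_cons_succ, List.getD_cons_zero]
    push_cast
    ring
  · interval_cases l <;> norm_num [coeffSum, listCoeff, sum_range_succ]

theorem finrank_harmonicSubmodule_fin_10 (k : ℕ) :
    (finrank ℝ (harmonicSubmodule (Fin 10) (k + 1)) : ℂ) =
      coeffSum 9 (listCoeff [1, 199/70, 16399/5040, 359/180, 2087/2880, 29/180, 31/1440, 1/630,
          1/20160]) (k + 1) := by
  refine finrank_harmonicSubmodule_fin_eq (b := 8) ?_ (fun j => ?_) k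
  · norm_num [coeffSum, listCoeff, sum_range_succ]
  · simp only [coeffSum, listCoeff, sum_range_succ, sum_range_zero, Nat.ascFactorial, Nat.factorial,
      List.getD_cons_succ, List.getD_cons_zero]
    push_cast
    ring

theorem sphereDet_9 : sphereDet 9 = 1 / 8 * Complex.exp
    (-(2 * deriv riemannZeta (-0) + 16399/2520 * deriv riemannZeta (-2) +
        2087/1440 * deriv riemannZeta (-4) + 31/720 * deriv riemannZeta (-6) +
        1/10080 * deriv riemannZeta (-8)) - 0) := by
  have h := sphereDet_eq (b := 8) (by norm_num) (e := listCoeff [1, -199/70, 16399/5040,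
      -359/180, 2087/2880, -29/180, 31/1440, -1/630, 1/20160])
    finrank_harmonicSubmodule_fin_10 (fun x => ?_) (fun l hl => ?_)
  · refine h.trans ?_
    congr 1
    · norm_num
    · congr 1
      simp only [listCoeff, sum_range_succ, sum_range_zero, harmonic,
        List.getD_cons_succ, List.getD_cons_zero]
      push_cast
      ring
  · simp only [coeffSum, listCoeff, sum_range_succ, sum_range_zero,
      List.getD_cons_succ, List.getD_cons_zero]
    push_cast
    ring
  · interval_cases l <;> norm_num [coeffSum, listCoeff, sum_range_succ]

end Dimensions

/-! ### The derivative of zeta at negative integers. -/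

section ZetaDeriv

open Finset

/-- Differentiate the functional equation `ζ(1 - s) = 2 (2π)^(-s) Γ(s) cos(πs/2) ζ(s)` at `s = k +
1`; the logarithmic derivative of `Γ` there is `H_k - γ`. -/
theorem deriv_riemannZeta_neg_nat {k : ℕ} (hk : 1 ≤ k) :
    deriv riemannZeta (-k) = 2 * (2 * Real.pi : ℂ)⁻¹ ^ (k + 1) * k.factorial *
      (((Complex.log (2 * Real.pi) + Real.eulerMascheroniConstant - (harmonic k : ℚ)) *
          riemannZeta (k + 1) - deriv riemannZeta (k + 1)) * Complex.cos (Real.pi * (k + 1) / 2) +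
        Real.pi / 2 * riemannZeta (k + 1) * Complex.sin (Real.pi * (k + 1) / 2)) := by
  have hk1 : (k + 1 : ℂ) ≠ 1 := by simpa using (by omega : k ≠ 0)
  have hpi : (2 * Real.pi : ℂ) ≠ 0 := by simp [Real.pi_ne_zero]
  have h1 : HasDerivAt (fun s : ℂ => (2 * Real.pi : ℂ) ^ (-s)) _ (k + 1) :=
    (hasDerivAt_id (k + 1 : ℂ)).neg.const_cpow (Or.inl hpi)
  have h2 := Complex.hasDerivAt_Gamma_nat k
  have h3 : HasDerivAt (fun s : ℂ => Complex.cos (Real.pi * s / 2))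
      (-Complex.sin (Real.pi * (k + 1) / 2) * (Real.pi / 2)) (k + 1) := by
    refine (((hasDerivAt_id (k + 1 : ℂ)).const_mul (Real.pi : ℂ)).div_const 2).ccos.congr_deriv ?_
    simp
  have h4 := (differentiableAt_riemannZeta hk1).hasDerivAt
  have h5 := (((h1.const_mul 2).mul h2).mul h3).mul h4
  have h6 : HasDerivAt (fun s => riemannZeta (1 - s)) (-deriv riemannZeta (-k)) (k + 1) := by
    have h7 : HasDerivAt riemannZeta (deriv riemannZeta (-k)) (1 - (k + 1 : ℂ)) := by
      rw [show 1 - (k + 1 : ℂ) = -k by ring]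
      refine (differentiableAt_riemannZeta fun h => ?_).hasDerivAt
      have : ((k + 1 : ℕ) : ℂ) = 0 := by push_cast; linear_combination -h
      exact absurd this (by exact_mod_cast k.succ_ne_zero)
    simpa using h7.comp_const_sub 1 (k + 1 : ℂ)
  have h8 : (fun s => riemannZeta (1 - s)) =ᶠ[nhds (k + 1 : ℂ)] fun s : ℂ =>
      2 * (2 * Real.pi : ℂ) ^ (-s) * Complex.Gamma s * Complex.cos (Real.pi * s / 2) *
        riemannZeta s := by
    have ho : IsOpen {s : ℂ | 1 < s.re} := isOpen_lt continuous_const Complex.continuous_re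
    have hm : (k + 1 : ℂ) ∈ {s : ℂ | 1 < s.re} := by
      change (1 : ℝ) < (k + 1 : ℂ).re
      have : (1 : ℝ) ≤ k := by exact_mod_cast hk
      simp
      omega
    filter_upwards [ho.mem_nhds hm] with s hs
    have hs' : 1 < s.re := hs
    refine riemannZeta_one_sub (fun n h => ?_) (fun h => ?_)
    · rw [h] at hs'
      have : (0 : ℝ) ≤ n := Nat.cast_nonneg n
      simp at hs'
      linarith
    · simp [h] at hs'
  have h9 := (h6.congr_of_eventuallyEq h8.symm).unique h5
  have hcp : (2 * Real.pi : ℂ) ^ (-(k + 1 : ℂ)) = (2 * Real.pi : ℂ)⁻¹ ^ (k + 1) := by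
    rw [Complex.cpow_neg, inv_pow, ← Nat.cast_succ, Complex.cpow_natCast]
  simp only [Pi.neg_apply, id_eq, hcp, Pi.mul_apply, Complex.Gamma_nat_eq_factorial] at h9
  rw [neg_eq_iff_eq_neg.1 h9]
  ring

/-- The cosine vanishes, which removes `γ`, `log 2π` and `ζ'(2j + 1)`. -/
theorem deriv_riemannZeta_neg_even {j : ℕ} (hj : 1 ≤ j) :
    deriv riemannZeta (-(2 * j : ℕ)) = (-1) ^ j * (2 * j).factorial /
      (2 * (2 * Real.pi) ^ (2 * j)) * riemannZeta (2 * j + 1) := by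
  have hpi : (Real.pi : ℂ) ≠ 0 := by simp [Real.pi_ne_zero]
  have e : (Real.pi * ((2 * j : ℕ) + 1) / 2 : ℂ) = Real.pi / 2 + j * Real.pi := by push_cast; ring
  have hs : Complex.sin (Real.pi / 2 + j * Real.pi) = (-1) ^ j := by
    have := Real.sin_add_nat_mul_pi (Real.pi / 2) j
    rw [Real.sin_pi_div_two, mul_one] at this
    exact_mod_cast congrArg (fun x : ℝ => (x : ℂ)) this
  have hc : Complex.cos (Real.pi / 2 + j * Real.pi) = 0 := by
    have := Real.cos_add_nat_mul_pi (Real.pi / 2) j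
    rw [Real.cos_pi_div_two, mul_zero] at this
    exact_mod_cast congrArg (fun x : ℝ => (x : ℂ)) this
  rw [deriv_riemannZeta_neg_nat (by omega), e, hs, hc]
  push_cast
  rw [inv_pow, pow_succ]
  field_simp
  ring

/-- The sine vanishes and the cosine is `(-1)^m`. -/
theorem deriv_riemannZeta_neg_odd {m : ℕ} (hm : 1 ≤ m) :
    deriv riemannZeta (-(2 * m - 1 : ℕ)) = 2 * (-1) ^ m * (2 * m - 1).factorial /
      (2 * Real.pi) ^ (2 * m) *
      ((Complex.log (2 * Real.pi) + Real.eulerMascheroniConstant - (harmonic (2 * m - 1) : ℚ)) *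
          riemannZeta (2 * m) - deriv riemannZeta (2 * m)) := by
  have hpi : (Real.pi : ℂ) ≠ 0 := by simp [Real.pi_ne_zero]
  obtain ⟨k, hk⟩ : ∃ k, k = 2 * m - 1 := ⟨_, rfl⟩
  have h2 : (2 * m : ℂ) = k + 1 := by
    have : 2 * m = k + 1 := by omega
    exact_mod_cast this
  have e : (Real.pi * (k + 1) / 2 : ℂ) = m * Real.pi := by rw [← h2]; ring
  have hc : Complex.cos (m * Real.pi) = (-1) ^ m := by
    exact_mod_cast congrArg (fun x : ℝ => (x : ℂ)) (Real.cos_nat_mul_pi m)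
  rw [← hk, deriv_riemannZeta_neg_nat (by omega), e, Complex.sin_nat_mul_pi, h2,
    show 2 * m = k + 1 by omega, hc]
  rw [inv_pow, div_eq_mul_inv]
  ring

theorem riemannZeta_nat_eq {p : ℕ} (hp : 2 ≤ p) :
    riemannZeta p = ((∑' k : ℕ, 1 / (k : ℝ) ^ p : ℝ) : ℂ) := by
  rw [zeta_nat_eq_tsum_of_gt_one (by omega), Complex.ofReal_tsum]
  push_cast
  rfl

theorem deriv_riemannZeta_nat_eq {p : ℕ} (hp : 2 ≤ p) :
    deriv riemannZeta p = ((-∑' k : ℕ, Real.log k / (k : ℝ) ^ p : ℝ) : ℂ) := by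
  have hp' : (1 : ℝ) < (p : ℂ).re := by simpa using (by omega : 1 < p)
  have ho : IsOpen {s : ℂ | 1 < s.re} := isOpen_lt continuous_const Complex.continuous_re
  have h1 : riemannZeta =ᶠ[nhds (p : ℂ)] LSeries 1 := by
    filter_upwards [ho.mem_nhds hp'] with s hs using (LSeries_one_eq_riemannZeta hs).symm
  rw [h1.deriv_eq, LSeries_deriv (by rw [LSeries.abscissaOfAbsConv_one]; exact_mod_cast hp'),
    Complex.ofReal_neg, Complex.ofReal_tsum, LSeries]
  congr 1
  refine tsum_congr fun k => ?_
  rcases eq_or_ne k 0 with rfl | hk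
  · simp
  · rw [LSeries.term_of_ne_zero hk, LSeries.logMul]
    simp [Complex.natCast_log]

end ZetaDeriv

/-! ### An Euler–Maclaurin formula with a one-sided error. -/

section EulerMaclaurin

open Filter Set
open scoped Topology

theorem nonneg_of_hasDerivAt_nonneg {h h' : ℝ → ℝ} {a b : ℝ} (h0 : h a = 0)
    (hd : ∀ x ∈ Icc a b, HasDerivAt h (h' x) x) (hn : ∀ x ∈ Icc a b, 0 ≤ h' x) :
    ∀ x ∈ Icc a b, 0 ≤ h x := by
  intro x hx
  have hm : MonotoneOn h (Icc a b) := by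
    refine monotoneOn_of_hasDerivWithinAt_nonneg (f' := h') (convex_Icc a b)
      (fun x hx => (hd x hx).continuousAt.continuousWithinAt)
      (fun x hx => (hd x (interior_subset hx)).hasDerivWithinAt)
      fun x hx => hn x (interior_subset hx)
  rw [← h0]
  exact hm (left_mem_Icc.2 (hx.1.trans hx.2)) hx hx.1

/-- The trapezoidal rule with its first correction term, on an interval of length `1`. -/
theorem corrected_trapezoid {F : ℕ → ℝ → ℝ} {a C : ℝ}
    (hF : ∀ i, ∀ x ∈ Icc a (a + 1), HasDerivAt (F i) (F (i + 1) x) x)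
    (h5 : ∀ x ∈ Icc a (a + 1), 0 ≤ F 5 x) (h5' : ∀ x ∈ Icc a (a + 1), F 5 x ≤ C) :
    F 0 (a + 1) - F 0 a - (F 1 a + F 1 (a + 1)) / 2 + (F 2 (a + 1) - F 2 a) / 12 ∈
      Icc 0 (C / 720) := by
  have hl : ∀ x, HasDerivAt (fun x : ℝ => x - a) 1 x := fun x => (hasDerivAt_id x).sub_const a
  -- View the error on `[a, x]` as a function of `x`. The functions in `d0`, `d1`, `d2` are this
  -- error and its first two derivatives; all vanish at `a`, and the third derivative is `(x - a)²
  -- F⁽⁵⁾(x) / 12`.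
  have d2 : ∀ x ∈ Icc a (a + 1), HasDerivAt (fun x => (F 2 x - F 2 a) / 6 - (x - a) * F 3 x / 6 +
      (x - a) ^ 2 * F 4 x / 12) ((x - a) ^ 2 * F 5 x / 12) x := fun x hx => by
    refine (((((hF 2 x hx).sub_const _).div_const 6).sub
      (((hl x).mul (hF 3 x hx)).div_const 6)).add
      ((((hl x).pow 2).mul (hF 4 x hx)).div_const 12)).congr_deriv ?_
    simp
    ring
  have d1 : ∀ x ∈ Icc a (a + 1), HasDerivAt (fun x => (F 1 x - F 1 a) / 2 - (x - a) * F 2 x / 3 -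
      (x - a) * F 2 a / 6 + (x - a) ^ 2 * F 3 x / 12) ((F 2 x - F 2 a) / 6 - (x - a) * F 3 x / 6 +
      (x - a) ^ 2 * F 4 x / 12) x := fun x hx => by
    refine ((((((hF 1 x hx).sub_const _).div_const 2).sub
      (((hl x).mul (hF 2 x hx)).div_const 3)).sub (((hl x).mul_const _).div_const 6)).add
      ((((hl x).pow 2).mul (hF 3 x hx)).div_const 12)).congr_deriv ?_
    simp
    ring
  have d0 : ∀ x ∈ Icc a (a + 1), HasDerivAt (fun x => F 0 x - F 0 a - (x - a) * (F 1 a + F 1 x) / 2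
      + (x - a) ^ 2 * (F 2 x - F 2 a) / 12) ((F 1 x - F 1 a) / 2 - (x - a) * F 2 x / 3 -
      (x - a) * F 2 a / 6 + (x - a) ^ 2 * F 3 x / 12) x := fun x hx => by
    refine ((((hF 0 x hx).sub_const _).sub
      (((hl x).mul ((hF 1 x hx).const_add _)).div_const 2)).add
      ((((hl x).pow 2).mul ((hF 2 x hx).sub_const _)).div_const 12)).congr_deriv ?_
    simp
    ring
  have e : ∀ (n : ℕ) (c : ℝ) (x), HasDerivAt (fun x : ℝ => c * (x - a) ^ (n + 1))
      (c * (n + 1) * (x - a) ^ n) x := fun n c x => by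
    refine (((hl x).pow (n + 1)).const_mul c).congr_deriv ?_
    simp only [Nat.cast_add, Nat.cast_one, add_tsub_cancel_right, mul_one]
    ring
  have hmem : a + 1 ∈ Icc a (a + 1) := ⟨by linarith, le_rfl⟩
  constructor
  · have b2 := nonneg_of_hasDerivAt_nonneg (by simp) d2 fun x hx => by
      have := h5 x hx
      positivity
    have b0 := nonneg_of_hasDerivAt_nonneg (by simp) d0
      (nonneg_of_hasDerivAt_nonneg (by simp) d1 b2) (a + 1) hmem
    simp only [add_sub_cancel_left, one_pow, one_mul] at b0
    exact b0
  -- Integrating the bound `C (x - a)² / 12` three times gives the constants `C/36`, `C/144` and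
  -- `C/720`.
  · have b2 := nonneg_of_hasDerivAt_nonneg (by simp)
      (fun x hx => (e 2 (C / 36) x).sub (d2 x hx)) fun x hx => by
        have := mul_nonneg (sq_nonneg (x - a)) (sub_nonneg.2 (h5' x hx))
        push_cast
        linarith
    have b1 := nonneg_of_hasDerivAt_nonneg (by simp)
      (fun x hx => (e 3 (C / 144) x).sub (d1 x hx)) fun x hx => by
        have := b2 x hx
        simp only [Pi.sub_apply] at this
        push_cast
        linarith
    have b0 := nonneg_of_hasDerivAt_nonneg (by simp)
      (fun x hx => (e 4 (C / 720) x).sub (d0 x hx)) (fun x hx => by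
        have := b1 x hx
        simp only [Pi.sub_apply] at this
        push_cast
        linarith) (a + 1) hmem
    simp only [Pi.sub_apply, add_sub_cancel_left, one_pow, mul_one, one_mul] at b0
    linarith

/-- `F i` plays the role of the `i`-th derivative of `F 0`, and `F 1` is the summand. The errors on
unit intervals from `N + 1` on are nonnegative and dominated by a telescoping sum of differences of
`F 4`, whose total is at most `-F 4 N / 720`. The domination uses the interval to the left of each
step, hence hypotheses from `N` on. -/
theorem euler_maclaurin_bounds {F : ℕ → ℝ → ℝ} {N : ℕ} {c : ℝ}
    (hF : ∀ i, ∀ x : ℝ, (N : ℝ) ≤ x → HasDerivAt (F i) (F (i + 1) x) x)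
    (h4 : ∀ x : ℝ, (N : ℝ) ≤ x → F 4 x ≤ 0) (h5 : ∀ x : ℝ, (N : ℝ) ≤ x → 0 ≤ F 5 x)
    (h6 : ∀ x : ℝ, (N : ℝ) ≤ x → F 6 x ≤ 0) (hl1 : Tendsto (F 1) atTop (𝓝 0))
    (hl2 : Tendsto (F 2) atTop (𝓝 0))
    (hc : Tendsto (fun M : ℕ => ∑ k ∈ Finset.range M, F 1 k - F 0 M) atTop (𝓝 c)) :
    ∑ k ∈ Finset.range (N + 1), F 1 k - (F 0 (N + 1) - F 1 (N + 1) / 2 + F 2 (N + 1) / 12) - c ∈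
      Icc 0 (-F 4 N / 720) := by
  have anti : AntitoneOn (F 5) (Ici (N : ℝ)) :=
    antitoneOn_of_hasDerivWithinAt_nonpos (f' := F 6) (convex_Ici _)
      (fun x hx => (hF 5 x hx).continuousAt.continuousWithinAt)
      (fun x hx => (hF 5 x (interior_subset hx)).hasDerivWithinAt)
      fun x hx => h6 x (interior_subset hx)
  have step : ∀ a : ℝ, (N : ℝ) + 1 ≤ a →
      F 0 (a + 1) - F 0 a - (F 1 a + F 1 (a + 1)) / 2 + (F 2 (a + 1) - F 2 a) / 12 ∈
      Icc 0 ((F 4 a - F 4 (a - 1)) / 720) := by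
    intro a ha
    refine corrected_trapezoid (fun i x hx => hF i x (by linarith [hx.1]))
      (fun x hx => h5 x (by linarith [hx.1])) fun x hx => ?_
    have hNa : (N : ℝ) ≤ a - 1 := by linarith
    have h1 : F 5 x ≤ F 5 a := anti (by simp; linarith) (by simp; linarith [hx.1]) hx.1
    -- As `F 5` decreases, its value at `a` is at most its value at a mean value point of `[a - 1,
    -- a]`, which equals `F 4 a - F 4 (a - 1)`. This makes the error bounds telescope.
    obtain ⟨y, hy, hy'⟩ := exists_hasDerivAt_eq_slope (F 4) (F 5) (a := a - 1) (b := a)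
      (by linarith) (fun x hx => (hF 4 x (by linarith [hx.1])).continuousAt.continuousWithinAt)
      fun x hx => hF 4 x (by linarith [hx.1])
    have h2 : F 5 a ≤ F 5 y := anti (by simp; linarith [hy.1]) (by simp; linarith) hy.2.le
    rw [hy'] at h2
    simp at h2
    linarith
  have key : ∀ m : ℕ, ∑ k ∈ Finset.range (N + 1), F 1 k -
      (F 0 (N + 1) - F 1 (N + 1) / 2 + F 2 (N + 1) / 12) -
      (∑ k ∈ Finset.range (N + 1 + m), F 1 k - (F 0 (N + 1 + m : ℕ) - F 1 (N + 1 + m : ℕ) / 2 +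
        F 2 (N + 1 + m : ℕ) / 12)) ∈ Icc 0 ((F 4 (N + m : ℕ) - F 4 N) / 720) := by
    intro m
    induction m with
    | zero => simp
    | succ m ih =>
      have h := step (N + 1 + m : ℕ) (by push_cast; linarith [(Nat.cast_nonneg m : (0 : ℝ) ≤ m)])
      have e1 : ((N + 1 + m : ℕ) : ℝ) - 1 = (N + m : ℕ) := by push_cast; ring
      have e2 : ((N + 1 + m : ℕ) : ℝ) + 1 = (N + 1 + (m + 1) : ℕ) := by push_cast; ring
      have e3 : N + (m + 1) = N + 1 + m := by ring
      rw [e1, e2] at h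
      have hs : ∑ k ∈ Finset.range (N + 1 + (m + 1)), F 1 k =
          ∑ k ∈ Finset.range (N + 1 + m), F 1 k + F 1 (N + 1 + m : ℕ) := Finset.sum_range_succ _ _
      rw [e3, hs]
      constructor <;> linarith [ih.1, ih.2, h.1, h.2]
  have hn : Tendsto (fun m : ℕ => N + 1 + m) atTop atTop :=
    tendsto_atTop_mono (fun m => Nat.le_add_left m (N + 1)) tendsto_id
  have hr : Tendsto (fun m : ℕ => ((N + 1 + m : ℕ) : ℝ)) atTop atTop :=
    tendsto_natCast_atTop_atTop.comp hn
  have lim := ((hc.comp hn).add ((hl1.comp hr).div_const 2)).sub ((hl2.comp hr).div_const 12)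
  have lim' := lim.const_sub (∑ k ∈ Finset.range (N + 1), F 1 k -
      (F 0 (N + 1) - F 1 (N + 1) / 2 + F 2 (N + 1) / 12))
  simp only [zero_div, add_zero, sub_zero] at lim'
  refine isClosed_Icc.mem_of_tendsto lim' (Eventually.of_forall fun m => ?_)
  have h := key m
  have h4m := h4 (N + m : ℕ) (by push_cast; linarith [(Nat.cast_nonneg m : (0 : ℝ) ≤ m)])
  simp only [Function.comp]
  constructor <;> linarith [h.1, h.2]

end EulerMaclaurin

/-! ### The class of functions `(a + b log x) / x ^ p`, closed under differentiation. -/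

section LogPow

open Filter Set
open scoped Topology

/-- The function `x ↦ (a + b log x) / x ^ p`. -/
def logPow (c : ℝ × ℝ) (p : ℕ) (x : ℝ) : ℝ := (c.1 + c.2 * Real.log x) / x ^ p

/-- The coefficients of the `i`-th derivative of `logPow c p`. -/
def logPowCoeff (c : ℝ × ℝ) (p : ℕ) : ℕ → ℝ × ℝ
  | 0 => c
  | i + 1 => ((logPowCoeff c p i).2 - (p + i : ℕ) * (logPowCoeff c p i).1,
      -((p + i : ℕ) * (logPowCoeff c p i).2))

theorem hasDerivAt_logPow (c : ℝ × ℝ) (p : ℕ) {x : ℝ} (hx : 0 < x) :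
    HasDerivAt (logPow c p) (logPow (c.2 - p * c.1, -(p * c.2)) (p + 1) x) x := by
  have h := (((Real.hasDerivAt_log hx.ne').const_mul c.2).const_add c.1).div (hasDerivAt_pow p x)
    (by positivity)
  refine h.congr_deriv ?_
  rw [logPow]
  rcases p with _ | p
  · simp
    field_simp
  · field_simp
    simp
    ring

theorem tendsto_logPow (c : ℝ × ℝ) {p : ℕ} (hp : 1 ≤ p) :
    Tendsto (logPow c p) atTop (𝓝 0) := by
  have h1 : Tendsto (fun x : ℝ => x ^ p) atTop atTop := tendsto_pow_atTop (by omega)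
  have h2 : Tendsto (fun x : ℝ => Real.log x / x ^ p) atTop (𝓝 0) := by
    have := (isLittleO_log_rpow_atTop (r := p) (by positivity)).tendsto_div_nhds_zero
    simpa using this
  have h3 := (h1.inv_tendsto_atTop.const_mul c.1).add (h2.const_mul c.2)
  simp only [mul_zero, add_zero] at h3
  refine h3.congr fun x => ?_
  simp [logPow]
  ring

/-- The signs of the derivatives are those of affine functions of `y = log x`, so they only have to
be checked on the half-line `y ≥ log N`. -/
theorem logPow_bounds {c : ℝ × ℝ} {p N : ℕ} {l : ℝ} (hN : 1 ≤ N)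
    (h4 : ∀ y, Real.log N ≤ y → (logPowCoeff c p 4).1 + (logPowCoeff c p 4).2 * y ≤ 0)
    (h5 : ∀ y, Real.log N ≤ y → 0 ≤ (logPowCoeff c p 5).1 + (logPowCoeff c p 5).2 * y)
    (h6 : ∀ y, Real.log N ≤ y → (logPowCoeff c p 6).1 + (logPowCoeff c p 6).2 * y ≤ 0)
    (hl : Tendsto (fun M : ℕ => ∑ k ∈ Finset.range M, logPow (logPowCoeff c p 1) (p + 1) k -
      logPow c p M) atTop (𝓝 l)) :
    ∑ k ∈ Finset.range (N + 1), logPow (logPowCoeff c p 1) (p + 1) k -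
      (logPow c p (N + 1) - logPow (logPowCoeff c p 1) (p + 1) (N + 1) / 2 +
        logPow (logPowCoeff c p 2) (p + 2) (N + 1) / 12) - l ∈
      Icc 0 (-logPow (logPowCoeff c p 4) (p + 4) N / 720) := by
  have hN' : (0 : ℝ) < N := by exact_mod_cast hN
  have hlog : ∀ x : ℝ, (N : ℝ) ≤ x → Real.log N ≤ Real.log x := fun x hx =>
    Real.log_le_log hN' hx
  refine euler_maclaurin_bounds (F := fun i => logPow (logPowCoeff c p i) (p + i))
    (fun i x hx => hasDerivAt_logPow _ _ (hN'.trans_le hx)) (fun x hx => ?_) (fun x hx => ?_)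
    (fun x hx => ?_) (tendsto_logPow _ (by omega)) (tendsto_logPow _ (by omega)) hl
  · exact div_nonpos_of_nonpos_of_nonneg (h4 _ (hlog x hx)) (pow_nonneg (hN'.le.trans hx) _)
  · exact div_nonneg (h5 _ (hlog x hx)) (pow_nonneg (hN'.le.trans hx) _)
  · exact div_nonpos_of_nonpos_of_nonneg (h6 _ (hlog x hx)) (pow_nonneg (hN'.le.trans hx) _)

end LogPow

/-! ### Enclosures of logarithms and of Euler's constant, and the general bounds for power sums. -/

section Numerics

open Filter Set Finset
open scoped Topology

/-- `50 / 49 = (1 + 1/99) / (1 - 1/99)`, so two terms of the series for `log ((1 + x) / (1 - x))`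
reduce `log 7` to `log 2` and `log 5`. -/
theorem log_seven_bounds : 1.945910148 < Real.log 7 ∧ Real.log 7 < 1.9459101495 := by
  have h : Real.log ((1 + 1 / 99) / (1 - 1 / 99)) = Real.log 2 + 2 * Real.log 5 -
      2 * Real.log 7 := by
    rw [show ((1 + 1 / 99) / (1 - 1 / 99) : ℝ) = 2 * 5 ^ 2 / 7 ^ 2 by norm_num,
      Real.log_div (by norm_num) (by norm_num), Real.log_mul (by norm_num) (by norm_num),
      Real.log_pow, Real.log_pow]
    norm_num
  have h1 := Real.sum_range_le_log_div (x := 1 / 99) (by norm_num) (by norm_num) 2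
  have h2 := Real.log_div_le_sum_range_add (x := 1 / 99) (by norm_num) (by norm_num) 2
  rw [h] at h1 h2
  norm_num [Finset.sum_range_succ] at h1 h2
  have := Real.log_two_gt_d9
  have := Real.log_two_lt_d9
  have := Real.log_five_gt_d9
  have := Real.log_five_lt_d9
  constructor <;> linarith

/-- The rational number `25 / 4` is close to `2π`, so the series for the logarithm of the quotient
converges fast, and `log (25 / 4)` involves only `log 2` and `log 5`. -/
theorem log_two_pi_bounds :
    1.837877065 < Real.log (2 * Real.pi) ∧ Real.log (2 * Real.pi) < 1.837877068 := by
  have hl : Real.log (25 / 4) = 2 * Real.log 5 - 2 * Real.log 2 := by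
    rw [show (25 / 4 : ℝ) = 5 ^ 2 / 2 ^ 2 by norm_num, Real.log_div (by norm_num) (by norm_num),
      Real.log_pow, Real.log_pow]
    norm_num
  have hp := Real.pi_gt_d20
  have hp' := Real.pi_lt_d20
  have hx : ∀ q : ℝ, 25 / 4 < q → Real.log q =
      Real.log ((1 + (q - 25 / 4) / (q + 25 / 4)) / (1 - (q - 25 / 4) / (q + 25 / 4))) +
        Real.log (25 / 4) := fun q hq => by
    rw [← Real.log_mul _ (by norm_num)]
    · congr 1
      have : q + 25 / 4 ≠ 0 := by linarith
      field_simp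
      ring_nf
    · have : 0 < q + 25 / 4 := by linarith
      have e : (1 + (q - 25 / 4) / (q + 25 / 4)) / (1 - (q - 25 / 4) / (q + 25 / 4)) =
        q / (25 / 4) := by
          field_simp
          ring
      rw [e]
      have : 0 < q := by linarith
      positivity
  have a1 : Real.log 6.28318530717 ≤ Real.log (2 * Real.pi) :=
    Real.log_le_log (by norm_num) (by linarith)
  have a2 : Real.log (2 * Real.pi) ≤ Real.log 6.28318530718 :=
    Real.log_le_log (by linarith) (by linarith)
  rw [hx 6.28318530717 (by norm_num), hl] at a1
  rw [hx 6.28318530718 (by norm_num), hl] at a2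
  have h1 := Real.sum_range_le_log_div (x := (6.28318530717 - 25 / 4) / (6.28318530717 + 25 / 4))
    (by norm_num) (by norm_num) 2
  have h2 := Real.log_div_le_sum_range_add
    (x := (6.28318530718 - 25 / 4) / (6.28318530718 + 25 / 4)) (by norm_num) (by norm_num) 2
  norm_num [Finset.sum_range_succ] at h1 h2 a1 a2
  have := Real.log_two_gt_d9
  have := Real.log_two_lt_d9
  have := Real.log_five_gt_d9
  have := Real.log_five_lt_d9
  constructor <;> linarith

theorem eulerMascheroniConstant_bounds :
    0.57721562 < Real.eulerMascheroniConstant ∧ Real.eulerMascheroniConstant < 0.5772158 := by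
  have hl : Tendsto (fun M : ℕ => ∑ k ∈ range M, logPow (logPowCoeff (0, 1) 0 1) (0 + 1) k -
      logPow (0, 1) 0 M) atTop (𝓝 Real.eulerMascheroniConstant) := by
    -- The sum stops before `1 / M`, and its term at index 0 is `1 / 0 = 0`; it is thus the `M`-th
    -- harmonic number minus `1 / M`, and subtracting this null sequence does not change the limit.
    have h0 := tendsto_inv_atTop_zero.comp (tendsto_natCast_atTop_atTop (R := ℝ))
    have h := Real.tendsto_harmonic_sub_log.sub h0
    rw [sub_zero] at h
    refine h.congr' ?_
    filter_upwards [eventually_ge_atTop 1] with M hM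
    obtain ⟨m, rfl⟩ := Nat.exists_eq_add_of_le' hM
    rw [sum_range_succ', harmonic, sum_range_succ]
    simp [logPow, logPowCoeff]
    ring
  -- The correction terms are evaluated at `N + 1 = 16`, whose logarithm is `4 log 2`.
  have h := logPow_bounds (N := 15) (by norm_num) (fun y hy => by norm_num [logPowCoeff])
    (fun y hy => by norm_num [logPowCoeff]) (fun y hy => by norm_num [logPowCoeff]) hl
  have h16 : Real.log 16 = 4 * Real.log 2 := by
    rw [show (16 : ℝ) = 2 ^ 4 by norm_num, Real.log_pow]
    norm_num
  norm_num [logPow, logPowCoeff, sum_range_succ, h16] at h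
  have := Real.log_two_gt_d9
  have := Real.log_two_lt_d9
  constructor <;> linarith [h.1, h.2]

theorem tendsto_sum_sub_logPow {c : ℝ × ℝ} {p : ℕ} (hp : 1 ≤ p) {f : ℕ → ℝ} (hf : Summable f)
    (h : ∀ k : ℕ, logPow (logPowCoeff c p 1) (p + 1) k = f k) :
    Tendsto (fun M : ℕ => ∑ k ∈ range M, logPow (logPowCoeff c p 1) (p + 1) k -
      logPow c p M) atTop (𝓝 (∑' k, f k)) := by
  simp only [h]
  simpa using hf.hasSum.tendsto_sum_nat.sub
    ((tendsto_logPow c hp).comp tendsto_natCast_atTop_atTop)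

/-- Euler–Maclaurin for the antiderivative `-1 / (p x^p)`, whose derivatives alternate in sign. -/
theorem tsum_one_div_pow_bounds {p : ℕ} (hp : 1 ≤ p) {N : ℕ} (hN : 1 ≤ N) :
    ∑ k ∈ range (N + 1), 1 / (k : ℝ) ^ (p + 1) + 1 / (p * (N + 1) ^ p) +
      1 / (2 * (N + 1) ^ (p + 1)) + (p + 1) / (12 * (N + 1) ^ (p + 2)) -
      ∑' k : ℕ, 1 / (k : ℝ) ^ (p + 1) ∈
      Set.Icc 0 ((p + 1) * (p + 2) * (p + 3) / (720 * (N : ℝ) ^ (p + 4))) := by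
  have hp0 : (p : ℝ) ≠ 0 := by exact_mod_cast (by omega : p ≠ 0)
  have c1 : logPowCoeff (-1 / p, 0) p 1 = (1, 0) := by
    simp [logPowCoeff]
    field_simp
  have c2 : logPowCoeff (-1 / p, 0) p 2 = (-(p + 1 : ℝ), 0) := by
    rw [logPowCoeff, c1]
    simp
  have c3 : logPowCoeff (-1 / p, 0) p 3 = ((p + 1) * (p + 2 : ℝ), 0) := by
    rw [logPowCoeff, c2]
    simp
    ring
  have c4 : logPowCoeff (-1 / p, 0) p 4 = (-((p + 1) * (p + 2) * (p + 3 : ℝ)), 0) := by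
    rw [logPowCoeff, c3]
    simp
    ring
  have c5 : logPowCoeff (-1 / p, 0) p 5 = ((p + 1) * (p + 2) * (p + 3) * (p + 4 : ℝ), 0) := by
    rw [logPowCoeff, c4]
    simp
    ring
  have c6 : logPowCoeff (-1 / p, 0) p 6 =
      (-((p + 1) * (p + 2) * (p + 3) * (p + 4) * (p + 5 : ℝ)), 0) := by
    rw [logPowCoeff, c5]
    simp
    ring
  have hl := tendsto_sum_sub_logPow (c := (-1 / p, 0)) hp
    (Real.summable_one_div_nat_pow.2 (by omega : 1 < p + 1)) (fun k => by simp [c1, logPow])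
  have h := logPow_bounds hN (fun y hy => by rw [c4]; simp; positivity)
    (fun y hy => by rw [c5]; simp; positivity) (fun y hy => by rw [c6]; simp; positivity) hl
  rw [c1, c2, c4] at h
  simp only [logPow, zero_mul, add_zero] at h
  have alg : ∀ S T x y z : ℝ, S + 1 / (p * x) + 1 / (2 * y) + (p + 1) / (12 * z) - T =
      S - (-1 / p / x - 1 / y / 2 + -(p + 1) / z / 12) - T := fun S T x y z => by ring
  rw [alg]
  convert h using 2
  ring

/-- Comparison with `k^(-3/2)`, using `log k ≤ 2 √k`. -/
theorem summable_log_div_pow {p : ℕ} (hp : 1 ≤ p) :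
    Summable fun k : ℕ => Real.log k / (k : ℝ) ^ (p + 1) := by
  have h := (Real.summable_nat_rpow_inv (p := 3 / 2)).2 (by norm_num)
  refine Summable.of_nonneg_of_le (fun k => ?_) (fun k => ?_) (h.mul_left 2)
  · exact div_nonneg (Real.log_natCast_nonneg k) (by positivity)
  · rcases Nat.eq_zero_or_pos k with rfl | hk
    · simp
    · have hk' : (1 : ℝ) ≤ k := by exact_mod_cast hk
      have h1 := Real.log_le_rpow_div (ε := 1 / 2) (zero_le_one.trans hk') (by norm_num)
      have h2 : (k : ℝ) ^ 2 ≤ (k : ℝ) ^ (p + 1) := pow_le_pow_right₀ hk' (by omega)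
      calc Real.log k / (k : ℝ) ^ (p + 1) ≤ ((k : ℝ) ^ (1 / 2 : ℝ) / (1 / 2)) / (k : ℝ) ^ 2 := by
            gcongr
        _ = 2 * ((k : ℝ) ^ (3 / 2 : ℝ))⁻¹ := by
            rw [← Real.rpow_natCast, ← Real.rpow_neg (by positivity), div_div_eq_mul_div, div_one,
              mul_div_right_comm, ← Real.rpow_sub (by positivity)]
            norm_num
            ring

end Numerics

/-! ### Numerical values of `ζ` and `ζ'` at positive integers. -/

section ZetaNumerics

open Finset

theorem exists_riemannZeta_bounds {p : ℕ} (hp : 1 ≤ p) {N : ℕ} (hN : 1 ≤ N) :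
    ∃ r : ℝ, riemannZeta (p + 1 : ℕ) = r ∧
    ∑ k ∈ range (N + 1), 1 / (k : ℝ) ^ (p + 1) + 1 / (p * (N + 1) ^ p) +
      1 / (2 * (N + 1) ^ (p + 1)) + (p + 1) / (12 * (N + 1) ^ (p + 2)) - r ∈
      Set.Icc 0 ((p + 1) * (p + 2) * (p + 3) / (720 * (N : ℝ) ^ (p + 4))) :=
  ⟨_, riemannZeta_nat_eq (by omega), tsum_one_div_pow_bounds hp hN⟩

theorem riemannZeta_three_bounds :
    ∃ r : ℝ, riemannZeta 3 = r ∧ 12020567/10000000 < r ∧ r < 12020571/10000000 := by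
  obtain ⟨r, hr, h⟩ := exists_riemannZeta_bounds (p := 2) (by norm_num) (N := 8) (by norm_num)
  refine ⟨r, by simpa using hr, ?_⟩
  norm_num [sum_range_succ] at h
  constructor <;> linarith [h.1, h.2]

theorem riemannZeta_five_bounds :
    ∃ r : ℝ, riemannZeta 5 = r ∧ 1036927/1000000 < r ∧ r < 1036928/1000000 := by
  obtain ⟨r, hr, h⟩ := exists_riemannZeta_bounds (p := 4) (by norm_num) (N := 5) (by norm_num)
  refine ⟨r, by simpa using hr, ?_⟩
  norm_num [sum_range_succ] at h
  constructor <;> linarith [h.1, h.2]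

theorem riemannZeta_six_bounds :
    ∃ r : ℝ, riemannZeta 6 = r ∧ 101734/100000 < r ∧ r < 101735/100000 := by
  obtain ⟨r, hr, h⟩ := exists_riemannZeta_bounds (p := 5) (by norm_num) (N := 4) (by norm_num)
  refine ⟨r, by simpa using hr, ?_⟩
  norm_num [sum_range_succ] at h
  constructor <;> linarith [h.1, h.2]

theorem riemannZeta_seven_bounds :
    ∃ r : ℝ, riemannZeta 7 = r ∧ 100834/100000 < r ∧ r < 100835/100000 := by
  obtain ⟨r, hr, h⟩ := exists_riemannZeta_bounds (p := 6) (by norm_num) (N := 4) (by norm_num)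
  refine ⟨r, by simpa using hr, ?_⟩
  norm_num [sum_range_succ] at h
  constructor <;> linarith [h.1, h.2]

theorem riemannZeta_eight_bounds :
    ∃ r : ℝ, riemannZeta 8 = r ∧ 10040/10000 < r ∧ r < 10041/10000 := by
  obtain ⟨r, hr, h⟩ := exists_riemannZeta_bounds (p := 7) (by norm_num) (N := 3) (by norm_num)
  refine ⟨r, by simpa using hr, ?_⟩
  norm_num [sum_range_succ] at h
  constructor <;> linarith [h.1, h.2]

theorem riemannZeta_nine_bounds :
    ∃ r : ℝ, riemannZeta 9 = r ∧ 10020/10000 < r ∧ r < 10021/10000 := by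
  obtain ⟨r, hr, h⟩ := exists_riemannZeta_bounds (p := 8) (by norm_num) (N := 3) (by norm_num)
  refine ⟨r, by simpa using hr, ?_⟩
  norm_num [sum_range_succ] at h
  constructor <;> linarith [h.1, h.2]

theorem log_eqs : Real.log 4 = 2 * Real.log 2 ∧ Real.log 6 = Real.log 2 + Real.log 3 ∧
    Real.log 8 = 3 * Real.log 2 ∧ Real.log 9 = 2 * Real.log 3 ∧
    Real.log 10 = Real.log 2 + Real.log 5 := by
  refine ⟨?_, ?_, ?_, ?_, ?_⟩
  · rw [show (4 : ℝ) = 2 ^ 2 by norm_num, Real.log_pow]; norm_num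
  · rw [← Real.log_mul (by norm_num) (by norm_num)]; norm_num
  · rw [show (8 : ℝ) = 2 ^ 3 by norm_num, Real.log_pow]; norm_num
  · rw [show (9 : ℝ) = 3 ^ 2 by norm_num, Real.log_pow]; norm_num
  · rw [← Real.log_mul (by norm_num) (by norm_num)]; norm_num

/-- Euler–Maclaurin for `log x / x^(p+1)`, with antiderivative `-(1/p² + log x / p) / x^p`. The
derivatives have constant sign only once `log x` is large enough, so the sign conditions stay as
hypotheses. -/
theorem exists_deriv_riemannZeta_bounds {p N : ℕ} (hp : 1 ≤ p) (hN : 1 ≤ N)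
    (h4 : ∀ y, Real.log N ≤ y → (logPowCoeff (-1 / (p : ℝ) ^ 2, -1 / p) p 4).1 +
      (logPowCoeff (-1 / (p : ℝ) ^ 2, -1 / p) p 4).2 * y ≤ 0)
    (h5 : ∀ y, Real.log N ≤ y → 0 ≤ (logPowCoeff (-1 / (p : ℝ) ^ 2, -1 / p) p 5).1 +
      (logPowCoeff (-1 / (p : ℝ) ^ 2, -1 / p) p 5).2 * y)
    (h6 : ∀ y, Real.log N ≤ y → (logPowCoeff (-1 / (p : ℝ) ^ 2, -1 / p) p 6).1 +
      (logPowCoeff (-1 / (p : ℝ) ^ 2, -1 / p) p 6).2 * y ≤ 0) :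
    ∃ r : ℝ, deriv riemannZeta (p + 1 : ℕ) = r ∧
    ∑ k ∈ range (N + 1), logPow (0, 1) (p + 1) k -
      (logPow (-1 / (p : ℝ) ^ 2, -1 / p) p (N + 1) - logPow (0, 1) (p + 1) (N + 1) / 2 +
        logPow ((1 : ℝ), -(p + 1 : ℝ)) (p + 2) (N + 1) / 12) + r ∈
      Set.Icc 0 (-logPow (logPowCoeff (-1 / (p : ℝ) ^ 2, -1 / p) p 4) (p + 4) N / 720) := by
  have hp0 : (p : ℝ) ≠ 0 := by exact_mod_cast (by omega : p ≠ 0)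
  have c1 : logPowCoeff (-1 / (p : ℝ) ^ 2, -1 / p) p 1 = (0, 1) := by
    simp only [logPowCoeff, Prod.mk.injEq]
    constructor <;> · push_cast; field_simp; norm_num
  have c2 : logPowCoeff (-1 / (p : ℝ) ^ 2, -1 / p) p 2 = (1, -(p + 1 : ℝ)) := by
    rw [logPowCoeff, c1]
    simp
  have hl := tendsto_sum_sub_logPow (c := (-1 / (p : ℝ) ^ 2, -1 / p)) hp
    (summable_log_div_pow hp) (fun k => by simp [c1, logPow])
  have h := logPow_bounds hN h4 h5 h6 hl
  refine ⟨_, deriv_riemannZeta_nat_eq (by omega), ?_⟩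
  rw [← sub_eq_add_neg, ← c2, ← c1]
  exact h

theorem deriv_riemannZeta_two_bounds :
    ∃ r : ℝ, deriv riemannZeta 2 = r ∧ -9375487/10000000 < r ∧ r < -9375480/10000000 := by
  obtain ⟨h4, h6, h8, h9, h10⟩ := log_eqs
  have := Real.log_two_gt_d9
  have := Real.log_two_lt_d9
  have := Real.log_three_gt_d9
  have := Real.log_three_lt_d9
  have := Real.log_five_gt_d9
  have := Real.log_five_lt_d9
  have := log_seven_bounds
  -- With `N + 1 = 10` only the logarithms of 2, 3, 5 and 7 occur.
  have h := exists_deriv_riemannZeta_bounds (p := 1) (N := 9) (by norm_num) (by norm_num)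
    (fun y hy => by
      norm_num [logPowCoeff, h4, h9] at hy ⊢
      linarith) (fun y hy => by
      norm_num [logPowCoeff, h4, h9] at hy ⊢
      linarith) (fun y hy => by
      norm_num [logPowCoeff, h4, h9] at hy ⊢
      linarith)
  obtain ⟨r, hr, h⟩ := h
  refine ⟨r, by simpa using hr, ?_⟩
  norm_num [logPow, logPowCoeff, sum_range_succ, h4, h6, h8, h9, h10] at h
  constructor <;> linarith [h.1, h.2]

theorem deriv_riemannZeta_four_bounds :
    ∃ r : ℝ, deriv riemannZeta 4 = r ∧ -68914/1000000 < r ∧ r < -68905/1000000 := by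
  obtain ⟨h4, h6, h8, h9, h10⟩ := log_eqs
  have := Real.log_two_gt_d9
  have := Real.log_two_lt_d9
  have := Real.log_three_gt_d9
  have := Real.log_three_lt_d9
  have := Real.log_five_gt_d9
  have := Real.log_five_lt_d9
  have := log_seven_bounds
  have h := exists_deriv_riemannZeta_bounds (p := 3) (N := 4) (by norm_num) (by norm_num)
    (fun y hy => by
      norm_num [logPowCoeff, h4, h9] at hy ⊢
      linarith) (fun y hy => by
      norm_num [logPowCoeff, h4, h9] at hy ⊢
      linarith) (fun y hy => by
      norm_num [logPowCoeff, h4, h9] at hy ⊢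
      linarith)
  obtain ⟨r, hr, h⟩ := h
  refine ⟨r, by simpa using hr, ?_⟩
  norm_num [logPow, logPowCoeff, sum_range_succ, h4, h6, h8, h9, h10] at h
  constructor <;> linarith [h.1, h.2]

theorem deriv_riemannZeta_six_bounds :
    ∃ r : ℝ, deriv riemannZeta 6 = r ∧ -1286/100000 < r ∧ r < -1283/100000 := by
  obtain ⟨h4, h6, h8, h9, h10⟩ := log_eqs
  have := Real.log_two_gt_d9
  have := Real.log_two_lt_d9
  have := Real.log_three_gt_d9
  have := Real.log_three_lt_d9
  have := Real.log_five_gt_d9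
  have := Real.log_five_lt_d9
  have := log_seven_bounds
  have h := exists_deriv_riemannZeta_bounds (p := 5) (N := 3) (by norm_num) (by norm_num)
    (fun y hy => by
      norm_num [logPowCoeff] at hy ⊢
      linarith) (fun y hy => by
      norm_num [logPowCoeff] at hy ⊢
      linarith) (fun y hy => by
      norm_num [logPowCoeff] at hy ⊢
      linarith)
  obtain ⟨r, hr, h⟩ := h
  refine ⟨r, by simpa using hr, ?_⟩
  norm_num [logPow, logPowCoeff, sum_range_succ, h4, h6, h8, h9, h10] at h
  constructor <;> linarith [h.1, h.2]

theorem deriv_riemannZeta_eight_bounds :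
    ∃ r : ℝ, deriv riemannZeta 8 = r ∧ -3/1000 < r ∧ r < -2/1000 := by
  obtain ⟨h4, h6, h8, h9, h10⟩ := log_eqs
  have := Real.log_two_gt_d9
  have := Real.log_two_lt_d9
  have := Real.log_three_gt_d9
  have := Real.log_three_lt_d9
  have := Real.log_five_gt_d9
  have := Real.log_five_lt_d9
  have := log_seven_bounds
  have h := exists_deriv_riemannZeta_bounds (p := 7) (N := 2) (by norm_num) (by norm_num)
    (fun y hy => by
      norm_num [logPowCoeff] at hy ⊢
      linarith) (fun y hy => by
      norm_num [logPowCoeff] at hy ⊢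
      linarith) (fun y hy => by
      norm_num [logPowCoeff] at hy ⊢
      linarith)
  obtain ⟨r, hr, h⟩ := h
  refine ⟨r, by simpa using hr, ?_⟩
  norm_num [logPow, logPowCoeff, sum_range_succ, h4, h6, h8, h9, h10] at h
  constructor <;> linarith [h.1, h.2]

end ZetaNumerics

/-! ### Numerical values of `ζ'` at `-1`, `-3`, `-5`, `-7`. -/

section NegativeIntegers

theorem inv_pi_sq_bounds : 0.1013211836 < 1 / Real.pi ^ 2 ∧ 1 / Real.pi ^ 2 < 0.1013211837 := by
  have h1 := Real.pi_gt_d20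
  have h2 := Real.pi_lt_d20
  constructor
  · rw [lt_one_div (by norm_num) (by positivity)]
    exact (pow_lt_pow_left₀ h2 Real.pi_pos.le two_ne_zero).trans (by norm_num)
  · rw [one_div_lt (by positivity) (by norm_num)]
    exact lt_trans (by norm_num) (pow_lt_pow_left₀ h1 (by norm_num) two_ne_zero)

theorem inv_pi_pow_bounds {k : ℕ} (hk : k ≠ 0) :
    0.1013211836 ^ k < (1 / Real.pi ^ 2) ^ k ∧ (1 / Real.pi ^ 2) ^ k < 0.1013211837 ^ k :=
  ⟨pow_lt_pow_left₀ inv_pi_sq_bounds.1 (by norm_num) hk,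
    pow_lt_pow_left₀ inv_pi_sq_bounds.2 (by positivity) hk⟩

theorem log_two_pi_eq : Complex.log (2 * Real.pi) = (Real.log (2 * Real.pi) : ℝ) := by
  rw [Complex.ofReal_log (by positivity)]
  push_cast
  rfl

/-- Since `ζ(2) = π²/6`, the functional equation gives `ζ'(-1) = (1 - log 2π - γ)/12 + ζ'(2)/(2π²)`.
-/
theorem deriv_riemannZeta_neg_one_bounds :
    ∃ r : ℝ, deriv riemannZeta (-1) = r ∧ -0.16542118 < r ∧ r < -0.16542112 := by
  obtain ⟨d, hd, h1, h2⟩ := deriv_riemannZeta_two_bounds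
  have hp := Real.pi_ne_zero
  have h := deriv_riemannZeta_neg_odd (m := 1) le_rfl
  norm_num [hd, log_two_pi_eq, riemannZeta_two, harmonic, Finset.sum_range_succ, Nat.factorial] at h
  refine ⟨(1 - Real.log (2 * Real.pi) - Real.eulerMascheroniConstant) / 12 +
    d * (1 / Real.pi ^ 2) / 2, ?_, ?_⟩
  · rw [h]
    push_cast
    field_simp
    ring
  · have hu := inv_pi_sq_bounds
    have hl := log_two_pi_bounds
    have hg := eulerMascheroniConstant_bounds
    have e1 := mul_lt_mul_of_pos_right h1 (by positivity : 0 < 1 / Real.pi ^ 2)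
    have e2 := mul_lt_mul_of_pos_right h2 (by positivity : 0 < 1 / Real.pi ^ 2)
    constructor <;> linarith

theorem deriv_riemannZeta_neg_three_bounds :
    ∃ r : ℝ, deriv riemannZeta (-3) = r ∧ 0.0053785 < r ∧ r < 0.0053786 := by
  obtain ⟨d, hd, h1, h2⟩ := deriv_riemannZeta_four_bounds
  have hp := Real.pi_ne_zero
  have h := deriv_riemannZeta_neg_odd (m := 2) (by norm_num)
  norm_num [hd, log_two_pi_eq, riemannZeta_four, harmonic, Finset.sum_range_succ,
    Nat.factorial] at h
  refine ⟨(Real.log (2 * Real.pi) + Real.eulerMascheroniConstant - 11 / 6) / 120 -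
    3 / 4 * (d * (1 / Real.pi ^ 2) ^ 2), ?_, ?_⟩
  · rw [h]
    push_cast
    field_simp
    ring
  · have hu := inv_pi_pow_bounds (k := 2) (by norm_num)
    have hl := log_two_pi_bounds
    have hg := eulerMascheroniConstant_bounds
    have e1 := mul_lt_mul_of_pos_right h1 (by positivity : 0 < (1 / Real.pi ^ 2) ^ 2)
    have e2 := mul_lt_mul_of_pos_right h2 (by positivity : 0 < (1 / Real.pi ^ 2) ^ 2)
    norm_num only at hu e1 e2 hl hg ⊢
    constructor <;> linarith

theorem deriv_riemannZeta_neg_five_bounds :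
    ∃ r : ℝ, deriv riemannZeta (-5) = r ∧ -0.00057303 < r ∧ r < -0.00057289 := by
  obtain ⟨d, hd, h1, h2⟩ := deriv_riemannZeta_six_bounds
  obtain ⟨w, hw, h3, h4⟩ := riemannZeta_six_bounds
  have hp := Real.pi_ne_zero
  have h := deriv_riemannZeta_neg_odd (m := 3) (by norm_num)
  norm_num [hd, hw, log_two_pi_eq, harmonic, Finset.sum_range_succ, Nat.factorial] at h
  -- The bracket of `deriv_riemannZeta_neg_odd`, with `137 / 60 = H_5`. Here `ζ(6)` enters through
  -- its enclosure, not as a multiple of `π⁶`, so the products of intervals are estimated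
  -- separately.
  set s : ℝ := (Real.log (2 * Real.pi) + Real.eulerMascheroniConstant - 137 / 60) * w - d with hs
  refine ⟨-(15 / 4) * (s * (1 / Real.pi ^ 2) ^ 3), ?_, ?_⟩
  · rw [h, hs]
    push_cast
    field_simp
    ring
  · have hu := inv_pi_pow_bounds (k := 3) (by norm_num)
    have hl := log_two_pi_bounds
    have hg := eulerMascheroniConstant_bounds
    have hs1 : 0.131759 * 1.01734 + 0.01283 < s := by
      nlinarith
    have hs2 : s < 0.13176 * 1.01735 + 0.01286 := by
      nlinarith
    have e1 := mul_lt_mul_of_pos_right hs1 (by positivity : 0 < (1 / Real.pi ^ 2) ^ 3)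
    have e2 := mul_lt_mul_of_pos_right hs2 (by positivity : 0 < (1 / Real.pi ^ 2) ^ 3)
    norm_num only at hu e1 e2 ⊢
    constructor <;> linarith

theorem deriv_riemannZeta_neg_seven_bounds :
    ∃ r : ℝ, deriv riemannZeta (-7) = r ∧ -0.000733 < r ∧ r < -0.000728 := by
  obtain ⟨d, hd, h1, h2⟩ := deriv_riemannZeta_eight_bounds
  obtain ⟨w, hw, h3, h4⟩ := riemannZeta_eight_bounds
  have hp := Real.pi_ne_zero
  have h := deriv_riemannZeta_neg_odd (m := 4) (by norm_num)
  norm_num [hd, hw, log_two_pi_eq, harmonic, Finset.sum_range_succ, Nat.factorial] at h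
  set s : ℝ := (Real.log (2 * Real.pi) + Real.eulerMascheroniConstant - 363 / 140) * w - d with hs
  refine ⟨315 / 8 * (s * (1 / Real.pi ^ 2) ^ 4), ?_, ?_⟩
  · rw [h, hs]
    push_cast
    field_simp
    ring
  · have hu := inv_pi_pow_bounds (k := 4) (by norm_num)
    have hl := log_two_pi_bounds
    have hg := eulerMascheroniConstant_bounds
    have hs1 : -0.17777 * 1.0041 + 0.002 < s := by
      nlinarith
    have hs2 : s < -0.17776 * 1.0040 + 0.003 := by
      nlinarith
    have e1 := mul_lt_mul_of_pos_right hs1 (by positivity : 0 < (1 / Real.pi ^ 2) ^ 4)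
    have e2 := mul_lt_mul_of_pos_right hs2 (by positivity : 0 < (1 / Real.pi ^ 2) ^ 4)
    norm_num only at hu e1 e2 ⊢
    constructor <;> linarith

end NegativeIntegers

/-! ### Closed forms and decimals of the determinants. -/

section Values

/-- Halving the argument brings it into `[0, 1]`, where the Taylor polynomial with its remainder
estimate applies; squaring recovers the exponential. -/
theorem exp_bounds {q : ℝ} (h0 : 0 ≤ q) (h2 : q ≤ 2) :
    (∑ m ∈ Finset.range 11, (q / 2) ^ m / m.factorial) ^ 2 ≤ Real.exp q ∧ Real.exp q ≤
      (∑ m ∈ Finset.range 11, (q / 2) ^ m / m.factorial +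
        (q / 2) ^ 11 * (11 + 1) / ((11 : ℕ).factorial * 11)) ^ 2 := by
  have h : Real.exp q = Real.exp (q / 2) ^ 2 := by
    rw [← Real.exp_nat_mul]
    congr 1
    push_cast
    ring
  rw [h]
  constructor
  · exact pow_le_pow_left₀ (Finset.sum_nonneg fun m _ => by positivity)
      (Real.sum_le_exp_of_nonneg (by linarith) _) 2
  · have h3 := Real.exp_bound' (x := q / 2) (by linarith) (by linarith) (n := 11) (by norm_num)
    exact pow_le_pow_left₀ (Real.exp_pos _).le (by simpa using h3) 2

theorem exp_mem_Icc {x a b l u : ℝ} (ha : 0 ≤ a) (hb : b ≤ 2) (hax : a ≤ x) (hxb : x ≤ b)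
    (hl : l ≤ (∑ m ∈ Finset.range 11, (a / 2) ^ m / m.factorial) ^ 2)
    (hu : (∑ m ∈ Finset.range 11, (b / 2) ^ m / m.factorial +
      (b / 2) ^ 11 * (11 + 1) / ((11 : ℕ).factorial * 11)) ^ 2 ≤ u) :
    l ≤ Real.exp x ∧ Real.exp x ≤ u :=
  ⟨(hl.trans (exp_bounds ha (hax.trans (hxb.trans hb))).1).trans
      (Real.exp_le_exp.2 hax),
    (Real.exp_le_exp.2 hxb).trans ((exp_bounds (ha.trans (hax.trans hxb)) hb).2.trans hu)⟩

theorem norm_ofReal_sub_lt {x v e : ℝ} (h1 : v - e < x) (h2 : x < v + e) :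
    ‖(x : ℂ) - v‖ < e := by
  rw [← Complex.ofReal_sub, Complex.norm_real, Real.norm_eq_abs, abs_lt]
  constructor <;> linarith

/-- The principal logarithm inverts the exponential here because `ζ'(-1)` is real; of the numerical
lemma only this reality is used. -/
theorem glaisherKinkelin_cpow (c : ℂ) :
    glaisherKinkelin ^ c = Complex.exp ((1 / 12 - deriv riemannZeta (-1)) * c) := by
  obtain ⟨r, hr, -, -⟩ := deriv_riemannZeta_neg_one_bounds
  have h : (1 / 12 - r : ℂ) = ((1 / 12 - r : ℝ) : ℂ) := by push_cast; ring
  rw [glaisherKinkelin, hr, h, Complex.cpow_def_of_ne_zero (Complex.exp_ne_zero _), Complex.log_exp]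
  · rw [Complex.ofReal_im]
    linarith [Real.pi_pos]
  · rw [Complex.ofReal_im]
    exact Real.pi_pos.le

theorem deriv_riemannZeta_neg_two :
    deriv riemannZeta (-2) = -(riemannZeta 3 / (4 * Real.pi ^ 2)) := by
  have hp : (Real.pi : ℂ) ≠ 0 := by simp [Real.pi_ne_zero]
  have h := deriv_riemannZeta_neg_even (j := 1) le_rfl
  norm_num [Nat.factorial] at h
  rw [h]
  field_simp
  ring

theorem deriv_riemannZeta_neg_four :
    deriv riemannZeta (-4) = 3 * riemannZeta 5 / (4 * Real.pi ^ 4) := by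
  have hp : (Real.pi : ℂ) ≠ 0 := by simp [Real.pi_ne_zero]
  have h := deriv_riemannZeta_neg_even (j := 2) (by norm_num)
  norm_num [Nat.factorial] at h
  rw [h]
  field_simp
  ring

theorem deriv_riemannZeta_neg_six :
    deriv riemannZeta (-6) = -(45 * riemannZeta 7 / (8 * Real.pi ^ 6)) := by
  have hp : (Real.pi : ℂ) ≠ 0 := by simp [Real.pi_ne_zero]
  have h := deriv_riemannZeta_neg_even (j := 3) (by norm_num)
  norm_num [Nat.factorial] at h
  rw [h]
  field_simp
  ring

theorem deriv_riemannZeta_neg_eight :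
    deriv riemannZeta (-8) = 315 * riemannZeta 9 / (4 * Real.pi ^ 8) := by
  have hp : (Real.pi : ℂ) ≠ 0 := by simp [Real.pi_ne_zero]
  have h := deriv_riemannZeta_neg_even (j := 4) (by norm_num)
  norm_num [Nat.factorial] at h
  rw [h]
  field_simp
  ring

/-- `ζ'(0) = -log(2π)/2`; this is the source of the factor `π` in odd dimensions. -/
theorem exp_neg_two_mul_deriv_riemannZeta_zero :
    Complex.exp (-(2 * deriv riemannZeta (-0))) = 2 * Real.pi := by
  have hp : (2 * Real.pi : ℂ) ≠ 0 := by simp [Real.pi_ne_zero]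
  rw [neg_zero, deriv_riemannZeta_zero, show -(2 * (-Complex.log (2 * Real.pi) / 2)) =
    Complex.log (2 * Real.pi) by ring, Complex.exp_log hp]

theorem sphereDet_two_eq : sphereDet 2 = Complex.exp (1 / 6) * glaisherKinkelin ^ 4 := by
  have h := glaisherKinkelin_cpow 4
  rw [← Nat.cast_ofNat, Complex.cpow_natCast] at h
  rw [sphereDet_2, h, ← Complex.exp_add, div_one, one_mul]
  congr 1
  push_cast
  ring

theorem norm_sphereDet_two_sub_lt : ‖sphereDet 2 - 3.19531‖ < 0.000005 := by
  obtain ⟨r1, hr1, a1, b1⟩ := deriv_riemannZeta_neg_one_bounds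
  have h : sphereDet 2 = ((1 / 1 * Real.exp (1 / 2 - 4 * r1) : ℝ) : ℂ) := by
    rw [sphereDet_2, hr1]
    push_cast
    congr 2
    ring
  -- The endpoints `a`, `b` enclose the exponent, computed from the enclosure of `ζ'(-1)` and
  -- rounded outwards; `l`, `u` enclose its exponential. The same pattern serves the other
  -- dimensions.
  have he := exp_mem_Icc (x := 1 / 2 - 4 * r1) (a := 1.16168447) (b := 1.16168472)
      (l := 3.19531115) (u := 3.19531196)
    (by norm_num) (by norm_num) (by linarith) (by linarith)
    (by norm_num [Finset.sum_range_succ, Nat.factorial])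
    (by norm_num [Finset.sum_range_succ, Nat.factorial])
  rw [h, show (3.19531 : ℂ) = ((3.19531 : ℝ) : ℂ) by norm_num]
  exact norm_ofReal_sub_lt (by linarith [he.1]) (by linarith [he.2])

theorem sphereDet_three_eq : sphereDet 3 =
    Real.pi * Complex.exp (riemannZeta 3 / (2 * Real.pi ^ 2)) := by
  rw [sphereDet_3, show -(2 * deriv riemannZeta (-0) + 2 * deriv riemannZeta (-2)) - 0 =
      -(2 * deriv riemannZeta (-0)) + (riemannZeta 3 / (2 * Real.pi ^ 2)) by
    rw [deriv_riemannZeta_neg_two]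
    ring, Complex.exp_add, exp_neg_two_mul_deriv_riemannZeta_zero]
  ring

theorem norm_sphereDet_three_sub_lt : ‖sphereDet 3 - 3.33885‖ < 0.000005 := by
  obtain ⟨r3, hr3, a3, b3⟩ := riemannZeta_three_bounds
  have u3 := inv_pi_pow_bounds (k := 1) (by norm_num)
  have c3 := mul_lt_mul_of_pos_right a3 (by positivity : 0 < (1 / Real.pi ^ 2) ^ 1)
  have d3 := mul_lt_mul_of_pos_right b3 (by positivity : 0 < (1 / Real.pi ^ 2) ^ 1)
  have h : sphereDet 3 = ((Real.pi / 1 *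
      Real.exp (1/2 * (r3 * (1 / Real.pi ^ 2) ^ 1)) : ℝ) : ℂ) := by
    rw [sphereDet_three_eq, hr3]
    push_cast
    rw [div_one]
    congr 2
    field_simp
  norm_num only at u3 c3 d3
  have he := exp_mem_Icc (x := 1/2 * (r3 * (1 / Real.pi ^ 2) ^ 1))
    (a := 0.06089690) (b := 0.06089693) (l := 1.06278933) (u := 1.06278937)
    (by norm_num) (by norm_num) (by linarith) (by linarith)
    (by norm_num [Finset.sum_range_succ, Nat.factorial])
    (by norm_num [Finset.sum_range_succ, Nat.factorial])
  rw [h, show (3.33885 : ℂ) = ((3.33885 : ℝ) : ℂ) by norm_num]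
  have hp1 := Real.pi_gt_d20
  have hp2 := Real.pi_lt_d20
  exact norm_ofReal_sub_lt (by nlinarith [he.1]) (by nlinarith [he.2])

theorem sphereDet_four_eq : sphereDet 4 = 1 / 3 * Complex.exp (83 / 144 -
    2 * deriv riemannZeta (-3) / 3) *
      glaisherKinkelin ^ (13 / 3 : ℂ) := by
  rw [sphereDet_4, glaisherKinkelin_cpow, mul_assoc, ← Complex.exp_add]
  congr 2
  ring

theorem norm_sphereDet_four_sub_lt : ‖sphereDet 4 - 1.73694‖ < 0.000005 := by
  obtain ⟨r1, hr1, a1, b1⟩ := deriv_riemannZeta_neg_one_bounds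
  obtain ⟨r3, hr3, a3, b3⟩ := deriv_riemannZeta_neg_three_bounds
  have h : sphereDet 4 = ((1 / 3 * Real.exp (15 / 16 - 13/3 * r1 - 2/3 * r3) : ℝ) : ℂ) := by
    rw [sphereDet_4, hr1, hr3]
    push_cast
    congr 2
    ring
  have he := exp_mem_Icc (x := 15 / 16 - 13/3 * r1 - 2/3 * r3) (a := 1.65073912)
      (b := 1.65073945) (l := 5.21082981) (u := 5.21083156)
    (by norm_num) (by norm_num) (by linarith) (by linarith)
    (by norm_num [Finset.sum_range_succ, Nat.factorial])
    (by norm_num [Finset.sum_range_succ, Nat.factorial])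
  rw [h, show (1.73694 : ℂ) = ((1.73694 : ℝ) : ℂ) by norm_num]
  exact norm_ofReal_sub_lt (by linarith [he.1]) (by linarith [he.2])

theorem sphereDet_five_eq : sphereDet 5 =
    Real.pi / 2 * Complex.exp (23 * riemannZeta 3 / (24 * Real.pi ^ 2) -
      riemannZeta 5 / (8 * Real.pi ^ 4)) := by
  rw [sphereDet_5, show -(2 * deriv riemannZeta (-0) + 23 / 6 * deriv riemannZeta (-2) +
      1 / 6 * deriv riemannZeta (-4)) - 0 =
      -(2 * deriv riemannZeta (-0)) + (23 * riemannZeta 3 / (24 * Real.pi ^ 2) -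
      riemannZeta 5 / (8 * Real.pi ^ 4)) by
    rw [deriv_riemannZeta_neg_two, deriv_riemannZeta_neg_four]
    ring, Complex.exp_add, exp_neg_two_mul_deriv_riemannZeta_zero]
  ring

theorem norm_sphereDet_five_sub_lt : ‖sphereDet 5 - 1.76292‖ < 0.000005 := by
  obtain ⟨r3, hr3, a3, b3⟩ := riemannZeta_three_bounds
  have u3 := inv_pi_pow_bounds (k := 1) (by norm_num)
  have c3 := mul_lt_mul_of_pos_right a3 (by positivity : 0 < (1 / Real.pi ^ 2) ^ 1)
  have d3 := mul_lt_mul_of_pos_right b3 (by positivity : 0 < (1 / Real.pi ^ 2) ^ 1)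
  obtain ⟨r5, hr5, a5, b5⟩ := riemannZeta_five_bounds
  have u5 := inv_pi_pow_bounds (k := 2) (by norm_num)
  have c5 := mul_lt_mul_of_pos_right a5 (by positivity : 0 < (1 / Real.pi ^ 2) ^ 2)
  have d5 := mul_lt_mul_of_pos_right b5 (by positivity : 0 < (1 / Real.pi ^ 2) ^ 2)
  have h : sphereDet 5 = ((Real.pi / 2 *
      Real.exp (23/24 * (r3 * (1 / Real.pi ^ 2) ^ 1) - 1/8 * (r5 * (1 / Real.pi ^ 2) ^ 2))
          : ℝ) : ℂ) := by
    rw [sphereDet_five_eq, hr3, hr5]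
    push_cast

    congr 2
    field_simp
  norm_num only at u3 c3 d3 u5 c5 d5
  have he := exp_mem_Icc (x := 23/24 * (r3 * (1 / Real.pi ^ 2) ^ 1) -
      1/8 * (r5 * (1 / Real.pi ^ 2) ^ 2))
    (a := 0.11538843) (b := 0.11538848) (l := 1.12230929) (u := 1.12230935)
    (by norm_num) (by norm_num) (by linarith) (by linarith)
    (by norm_num [Finset.sum_range_succ, Nat.factorial])
    (by norm_num [Finset.sum_range_succ, Nat.factorial])
  rw [h, show (1.76292 : ℂ) = ((1.76292 : ℝ) : ℂ) by norm_num]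
  have hp1 := Real.pi_gt_d20
  have hp2 := Real.pi_lt_d20
  exact norm_ofReal_sub_lt (by nlinarith [he.1]) (by nlinarith [he.2])

theorem sphereDet_six_eq : sphereDet 6 = 1 / 5 * Complex.exp (1381 / 2160 -
    2 * deriv riemannZeta (-3) -
      deriv riemannZeta (-5) / 30) * glaisherKinkelin ^ (149 / 30 : ℂ) := by
  rw [sphereDet_6, glaisherKinkelin_cpow, mul_assoc, ← Complex.exp_add]
  congr 2
  ring

theorem norm_sphereDet_six_sub_lt : ‖sphereDet 6 - 1.29002‖ < 0.000005 := by
  obtain ⟨r1, hr1, a1, b1⟩ := deriv_riemannZeta_neg_one_bounds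
  obtain ⟨r3, hr3, a3, b3⟩ := deriv_riemannZeta_neg_three_bounds
  obtain ⟨r5, hr5, a5, b5⟩ := deriv_riemannZeta_neg_five_bounds
  have h : sphereDet 6 = ((1 / 5 * Real.exp (455 / 432 - 149/30 * r1 - 2 * r3 - 1/30 * r5)
      : ℝ) : ℂ) := by
    rw [sphereDet_6, hr1, hr3, hr5]
    push_cast
    congr 2
    ring
  have he := exp_mem_Icc (x := 455 / 432 - 149/30 * r1 - 2 * r3 - 1/30 * r5) (a := 1.86409419)
      (b := 1.86409471) (l := 6.45009061) (u := 6.45009404)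
    (by norm_num) (by norm_num) (by linarith) (by linarith)
    (by norm_num [Finset.sum_range_succ, Nat.factorial])
    (by norm_num [Finset.sum_range_succ, Nat.factorial])
  rw [h, show (1.29002 : ℂ) = ((1.29002 : ℝ) : ℂ) by norm_num]
  exact norm_ofReal_sub_lt (by linarith [he.1]) (by linarith [he.2])

theorem sphereDet_seven_eq : sphereDet 7 =
    Real.pi / 3 * Complex.exp (949 * riemannZeta 3 / (720 * Real.pi ^ 2) -
      13 * riemannZeta 5 / (24 * Real.pi ^ 4) + riemannZeta 7 / (32 * Real.pi ^ 6)) := by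
  rw [sphereDet_7, show -(2 * deriv riemannZeta (-0) + 949 / 180 * deriv riemannZeta (-2) +
      13 / 18 * deriv riemannZeta (-4) + 1 / 180 * deriv riemannZeta (-6)) - 0 =
      -(2 * deriv riemannZeta (-0)) + (949 * riemannZeta 3 / (720 * Real.pi ^ 2) -
      13 * riemannZeta 5 / (24 * Real.pi ^ 4) + riemannZeta 7 / (32 * Real.pi ^ 6)) by
    rw [deriv_riemannZeta_neg_two, deriv_riemannZeta_neg_four, deriv_riemannZeta_neg_six]
    ring, Complex.exp_add, exp_neg_two_mul_deriv_riemannZeta_zero]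
  ring

theorem norm_sphereDet_seven_sub_lt : ‖sphereDet 7 - 1.22252‖ < 0.000005 := by
  obtain ⟨r3, hr3, a3, b3⟩ := riemannZeta_three_bounds
  have u3 := inv_pi_pow_bounds (k := 1) (by norm_num)
  have c3 := mul_lt_mul_of_pos_right a3 (by positivity : 0 < (1 / Real.pi ^ 2) ^ 1)
  have d3 := mul_lt_mul_of_pos_right b3 (by positivity : 0 < (1 / Real.pi ^ 2) ^ 1)
  obtain ⟨r5, hr5, a5, b5⟩ := riemannZeta_five_bounds
  have u5 := inv_pi_pow_bounds (k := 2) (by norm_num)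
  have c5 := mul_lt_mul_of_pos_right a5 (by positivity : 0 < (1 / Real.pi ^ 2) ^ 2)
  have d5 := mul_lt_mul_of_pos_right b5 (by positivity : 0 < (1 / Real.pi ^ 2) ^ 2)
  obtain ⟨r7, hr7, a7, b7⟩ := riemannZeta_seven_bounds
  have u7 := inv_pi_pow_bounds (k := 3) (by norm_num)
  have c7 := mul_lt_mul_of_pos_right a7 (by positivity : 0 < (1 / Real.pi ^ 2) ^ 3)
  have d7 := mul_lt_mul_of_pos_right b7 (by positivity : 0 < (1 / Real.pi ^ 2) ^ 3)
  have h : sphereDet 7 = ((Real.pi / 3 *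
      Real.exp (949/720 * (r3 * (1 / Real.pi ^ 2) ^ 1) - 13/24 * (r5 * (1 / Real.pi ^ 2) ^ 2) +
          1/32 * (r7 * (1 / Real.pi ^ 2) ^ 3)) : ℝ) : ℂ) := by
    rw [sphereDet_seven_eq, hr3, hr5, hr7]
    push_cast

    congr 2
    field_simp
  norm_num only at u3 c3 d3 u5 c5 d5 u7 c7 d7
  have he := exp_mem_Icc (x := 949/720 * (r3 * (1 / Real.pi ^ 2) ^ 1) -
      13/24 * (r5 * (1 / Real.pi ^ 2) ^ 2) + 1/32 * (r7 * (1 / Real.pi ^ 2) ^ 3))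
    (a := 0.15479769) (b := 0.15479776) (l := 1.16742175) (u := 1.16742184)
    (by norm_num) (by norm_num) (by linarith) (by linarith)
    (by norm_num [Finset.sum_range_succ, Nat.factorial])
    (by norm_num [Finset.sum_range_succ, Nat.factorial])
  rw [h, show (1.22252 : ℂ) = ((1.22252 : ℝ) : ℂ) by norm_num]
  have hp1 := Real.pi_gt_d20
  have hp2 := Real.pi_lt_d20
  exact norm_ofReal_sub_lt (by nlinarith [he.1]) (by nlinarith [he.2])

theorem sphereDet_eight_eq : sphereDet 8 = 1 / 7 * Complex.exp (4730849 / 7257600 -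
    1199 * deriv riemannZeta (-3) / 360 -
      71 * deriv riemannZeta (-5) / 360 - deriv riemannZeta (-7) / 1260) *
      glaisherKinkelin ^ (383 / 70 : ℂ) := by
  rw [sphereDet_8, glaisherKinkelin_cpow, mul_assoc, ← Complex.exp_add]
  congr 2
  ring

theorem norm_sphereDet_eight_sub_lt : ‖sphereDet 8 - 1.05041‖ < 0.000005 := by
  obtain ⟨r1, hr1, a1, b1⟩ := deriv_riemannZeta_neg_one_bounds
  obtain ⟨r3, hr3, a3, b3⟩ := deriv_riemannZeta_neg_three_bounds
  obtain ⟨r5, hr5, a5, b5⟩ := deriv_riemannZeta_neg_five_bounds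
  obtain ⟨r7, hr7, a7, b7⟩ := deriv_riemannZeta_neg_seven_bounds
  have h : sphereDet 8 = ((1 / 7 * Real.exp (1148567 / 1036800 - 383/70 * r1 - 1199/360 * r3 -
      71/360 * r5 - 1/1260 * r7) : ℝ) : ℂ) := by
    rw [sphereDet_8, hr1, hr3, hr5, hr7]
    push_cast
    congr 2
    ring
  have he := exp_mem_Icc (x := 1148567 / 1036800 - 383/70 * r1 - 1199/360 * r3 - 71/360 * r5 -
      1/1260 * r7) (a := 1.99508964) (b := 1.99509034) (l := 7.35286196) (u := 7.35286726)
    (by norm_num) (by norm_num) (by linarith) (by linarith)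
    (by norm_num [Finset.sum_range_succ, Nat.factorial])
    (by norm_num [Finset.sum_range_succ, Nat.factorial])
  rw [h, show (1.05041 : ℂ) = ((1.05041 : ℝ) : ℂ) by norm_num]
  exact norm_ofReal_sub_lt (by linarith [he.1]) (by linarith [he.2])

theorem sphereDet_nine_eq : sphereDet 9 =
    Real.pi / 4 * Complex.exp (16399 * riemannZeta 3 / (10080 * Real.pi ^ 2) -
      2087 * riemannZeta 5 / (1920 * Real.pi ^ 4) + 31 * riemannZeta 7 / (128 * Real.pi ^ 6) -
      riemannZeta 9 / (128 * Real.pi ^ 8)) := by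
  rw [sphereDet_9, show -(2 * deriv riemannZeta (-0) + 16399 / 2520 * deriv riemannZeta (-2) +
      2087 / 1440 * deriv riemannZeta (-4) + 31 / 720 * deriv riemannZeta (-6) +
      1 / 10080 * deriv riemannZeta (-8)) - 0 =
      -(2 * deriv riemannZeta (-0)) + (16399 * riemannZeta 3 / (10080 * Real.pi ^ 2) -
      2087 * riemannZeta 5 / (1920 * Real.pi ^ 4) + 31 * riemannZeta 7 / (128 * Real.pi ^ 6) -
      riemannZeta 9 / (128 * Real.pi ^ 8)) by
    rw [deriv_riemannZeta_neg_two, deriv_riemannZeta_neg_four, deriv_riemannZeta_neg_six,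
        deriv_riemannZeta_neg_eight]
    ring, Complex.exp_add, exp_neg_two_mul_deriv_riemannZeta_zero]
  ring

set_option maxHeartbeats 800000 in
theorem norm_sphereDet_nine_sub_lt : ‖sphereDet 9 - 0.94673‖ < 0.000005 := by
  obtain ⟨r3, hr3, a3, b3⟩ := riemannZeta_three_bounds
  have u3 := inv_pi_pow_bounds (k := 1) (by norm_num)
  have c3 := mul_lt_mul_of_pos_right a3 (by positivity : 0 < (1 / Real.pi ^ 2) ^ 1)
  have d3 := mul_lt_mul_of_pos_right b3 (by positivity : 0 < (1 / Real.pi ^ 2) ^ 1)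
  obtain ⟨r5, hr5, a5, b5⟩ := riemannZeta_five_bounds
  have u5 := inv_pi_pow_bounds (k := 2) (by norm_num)
  have c5 := mul_lt_mul_of_pos_right a5 (by positivity : 0 < (1 / Real.pi ^ 2) ^ 2)
  have d5 := mul_lt_mul_of_pos_right b5 (by positivity : 0 < (1 / Real.pi ^ 2) ^ 2)
  obtain ⟨r7, hr7, a7, b7⟩ := riemannZeta_seven_bounds
  have u7 := inv_pi_pow_bounds (k := 3) (by norm_num)
  have c7 := mul_lt_mul_of_pos_right a7 (by positivity : 0 < (1 / Real.pi ^ 2) ^ 3)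
  have d7 := mul_lt_mul_of_pos_right b7 (by positivity : 0 < (1 / Real.pi ^ 2) ^ 3)
  obtain ⟨r9, hr9, a9, b9⟩ := riemannZeta_nine_bounds
  have u9 := inv_pi_pow_bounds (k := 4) (by norm_num)
  have c9 := mul_lt_mul_of_pos_right a9 (by positivity : 0 < (1 / Real.pi ^ 2) ^ 4)
  have d9 := mul_lt_mul_of_pos_right b9 (by positivity : 0 < (1 / Real.pi ^ 2) ^ 4)
  have h : sphereDet 9 = ((Real.pi / 4 *
      Real.exp (16399/10080 * (r3 * (1 / Real.pi ^ 2) ^ 1) -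
          2087/1920 * (r5 * (1 / Real.pi ^ 2) ^ 2) + 31/128 * (r7 * (1 / Real.pi ^ 2) ^ 3) -
          1/128 * (r9 * (1 / Real.pi ^ 2) ^ 4)) : ℝ) : ℂ) := by
    rw [sphereDet_nine_eq, hr3, hr5, hr7, hr9]
    push_cast

    congr 2
    field_simp
  norm_num only at u3 c3 d3 u5 c5 d5 u7 c7 d7 u9 c9 d9
  have he := exp_mem_Icc (x := 16399/10080 * (r3 * (1 / Real.pi ^ 2) ^ 1) -
      2087/1920 * (r5 * (1 / Real.pi ^ 2) ^ 2) + 31/128 * (r7 * (1 / Real.pi ^ 2) ^ 3) -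
      1/128 * (r9 * (1 / Real.pi ^ 2) ^ 4))
    (a := 0.18682671) (b := 0.18682680) (l := 1.20541837) (u := 1.20541849)
    (by norm_num) (by norm_num) (by linarith) (by linarith)
    (by norm_num [Finset.sum_range_succ, Nat.factorial])
    (by norm_num [Finset.sum_range_succ, Nat.factorial])
  rw [h, show (0.94673 : ℂ) = ((0.94673 : ℝ) : ℂ) by norm_num]
  have hp1 := Real.pi_gt_d20
  have hp2 := Real.pi_lt_d20
  exact norm_ofReal_sub_lt (by nlinarith [he.1]) (by nlinarith [he.2])

end Values

end

theorem mainTheorem8 :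
    (∀ n : ℕ, 2 ≤ n → n ≤ 9 → ∃ Z, IsSpectralZeta (sphereLaplacian n) Z) ∧
    (sphereDet 2 = Complex.exp (1 / 6) * glaisherKinkelin ^ 4 ∧
      ‖sphereDet 2 - 3.19531‖ < 0.000005) ∧
    (sphereDet 3 = Real.pi * Complex.exp (riemannZeta 3 / (2 * Real.pi ^ 2)) ∧
      ‖sphereDet 3 - 3.33885‖ < 0.000005) ∧
    (sphereDet 4 = 1 / 3 * Complex.exp (83 / 144 - 2 * deriv riemannZeta (-3) / 3) *
      glaisherKinkelin ^ (13 / 3 : ℂ) ∧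
      ‖sphereDet 4 - 1.73694‖ < 0.000005) ∧
    (sphereDet 5 = Real.pi / 2 * Complex.exp (23 * riemannZeta 3 / (24 * Real.pi ^ 2) -
      riemannZeta 5 / (8 * Real.pi ^ 4)) ∧
      ‖sphereDet 5 - 1.76292‖ < 0.000005) ∧
    (sphereDet 6 = 1 / 5 * Complex.exp (1381 / 2160 - 2 * deriv riemannZeta (-3) -
      deriv riemannZeta (-5) / 30) * glaisherKinkelin ^ (149 / 30 : ℂ) ∧
      ‖sphereDet 6 - 1.29002‖ < 0.000005) ∧
    (sphereDet 7 = Real.pi / 3 * Complex.exp (949 * riemannZeta 3 / (720 * Real.pi ^ 2) -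
      13 * riemannZeta 5 / (24 * Real.pi ^ 4) + riemannZeta 7 / (32 * Real.pi ^ 6)) ∧
      ‖sphereDet 7 - 1.22252‖ < 0.000005) ∧
    (sphereDet 8 = 1 / 7 * Complex.exp (4730849 / 7257600 - 1199 * deriv riemannZeta (-3) / 360 -
      71 * deriv riemannZeta (-5) / 360 - deriv riemannZeta (-7) / 1260) *
      glaisherKinkelin ^ (383 / 70 : ℂ) ∧
      ‖sphereDet 8 - 1.05041‖ < 0.000005) ∧
    (sphereDet 9 = Real.pi / 4 * Complex.exp (16399 * riemannZeta 3 / (10080 * Real.pi ^ 2) -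
      2087 * riemannZeta 5 / (1920 * Real.pi ^ 4) + 31 * riemannZeta 7 / (128 * Real.pi ^ 6) -
      riemannZeta 9 / (128 * Real.pi ^ 8)) ∧
      ‖sphereDet 9 - 0.94673‖ < 0.000005) := by
  refine ⟨fun n h2 h9 => ?_, ⟨sphereDet_two_eq, norm_sphereDet_two_sub_lt⟩,
    ⟨sphereDet_three_eq, norm_sphereDet_three_sub_lt⟩,
    ⟨sphereDet_four_eq, norm_sphereDet_four_sub_lt⟩,
    ⟨sphereDet_five_eq, norm_sphereDet_five_sub_lt⟩,
    ⟨sphereDet_six_eq, norm_sphereDet_six_sub_lt⟩,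
    ⟨sphereDet_seven_eq, norm_sphereDet_seven_sub_lt⟩,
    ⟨sphereDet_eight_eq, norm_sphereDet_eight_sub_lt⟩,
    ⟨sphereDet_nine_eq, norm_sphereDet_nine_sub_lt⟩⟩
  interval_cases n
  exacts [⟨_, isSpectralZeta_shiftZeta _ finrank_harmonicSubmodule_fin_3⟩,
    ⟨_, isSpectralZeta_shiftZeta _ finrank_harmonicSubmodule_fin_4⟩,
    ⟨_, isSpectralZeta_shiftZeta _ finrank_harmonicSubmodule_fin_5⟩,
    ⟨_, isSpectralZeta_shiftZeta _ finrank_harmonicSubmodule_fin_6⟩,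
    ⟨_, isSpectralZeta_shiftZeta _ finrank_harmonicSubmodule_fin_7⟩,
    ⟨_, isSpectralZeta_shiftZeta _ finrank_harmonicSubmodule_fin_8⟩,
    ⟨_, isSpectralZeta_shiftZeta _ finrank_harmonicSubmodule_fin_9⟩,
    ⟨_, isSpectralZeta_shiftZeta _ finrank_harmonicSubmodule_fin_10⟩]
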